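/- For $\alpha>0$ let $\mathbb{S}^2_\alpha$ be the metric space obtained by gluing spherical lunes of total angle $\alpha$ cyclically (so $\mathbb{S}^2_{2\pi}=\mathbb{S}^2$), let $o$ be its north pole, and let $D_\alpha(o,r)$ be the open metric disk of radius $r$ about $o$. A spherical surface (with conical singularities) is a surface locally modeled on the spaces $\mathbb{S}^2_\alpha$: every point has a neighborhood isometric to some $D_\alpha(o,\varepsilon)$, the point corresponding to $o$. It is closed if it is compact. A bigon in a spherical surface is an open set which is isometric, for the induced path metrics, to a nonempty intersection of two disks in $\mathbb{S}^2$ of radii less than $\frac{\pi}{2}$, neither of which contains the other. Let $D_i=D_{\alpha_i}(o,r_i)$, $i=1,\dots,n$, with $\alpha_i>0$ and $r_i\in(0,\frac{\pi}{2})$, and let $\iota:D_1\sqcup\cdots\sqcup D_n\to\Sigma$ be a local isometry to a closed spherical surface $\Sigma$ such that - the image of $\iota$ misses only finitely many points of $\Sigma$; - $\iota$ is at most $2$-to-$1$; - $\iota(D_i)\not\subseteq\iota(D_j)$ for all $i\neq j$. Put $B:=\{p\in\Sigma\mid \iota^{-1}(p)\text{ has exactly two points}\}$. Then: 1. $\iota^{-1}(B)$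 is the disjoint union of finitely many bigons, each contained in one of the $D_i$. Each bigon in $D_i$ is isometric to an intersection of two disks as above, the first of which has radius $r_i$, by an isometry which extends continuously to the closure of this intersection in such a way that the closed side on the boundary of the first disk goes to the circle $\partial D_i\subset\mathbb{S}^2_{\alpha_i}$, injectively except that its two endpoints may be identified, while the other side, without its endpoints, goes into $D_i$. 2. These bigons fill up the boundaries of the $D_i$: every point of $\partial D_i$ is in the closure of one of the bigons in $D_i$, and all but finitely many points of $\partial D_i$ have a neighborhood $N$ such that $N\cap D_i$ is contained in a single bigon. 3. The equivalence relation $x\sim y\Leftrightarrow\iota(x)=\iota(y)$ on $\iota^{-1}(B)$ is an isometric pairing of the bigons: for each bigon $U$ there are a bigon $V\neq U$ and an isometry (for the induced path metrics) $g:U\to V$ such that, for each $x\in U$, $g(x)$ is the only point $y\neq x$ with $\iota(y)=\iota(x)$. -/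

import Mathlib

/-- The unit sphere `𝕊²` in Euclidean 3-space, to be equipped with its angular metric. -/
@[ext]
structure UnitSphere where
  /-- the underlying vector -/
  vec : EuclideanSpace ℝ (Fin 3)
  norm_vec : ‖vec‖ = 1

/-- The angular (great-circle) distance on `𝕊²`. -/
noncomputable instance UnitSphere.instMetricSpace : MetricSpace UnitSphere where
  dist x y := InnerProductGeometry.angle x.vec y.vec
  dist_self x := InnerProductGeometry.angle_self (by
    intro h
    have := x.norm_vec
    simp [h] at this)
  dist_comm x y := InnerProductGeometry.angle_comm _ _
  dist_triangle x y z := InnerProductGeometry.angle_le_angle_add_angle _ _ _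
  eq_of_dist_eq_zero := by
    intro x y h
    have h' : InnerProductGeometry.angle x.vec y.vec = 0 := h
    obtain ⟨_, c, hc, hy⟩ := InnerProductGeometry.angle_eq_zero_iff.1 h'
    have h1 := y.norm_vec
    rw [hy, norm_smul, x.norm_vec, mul_one, Real.norm_eq_abs, abs_of_pos hc] at h1
    ext1
    rw [hy, h1, one_smul]

/-- Geodesic polar coordinates for `𝕊²_α`: the distance `colat ∈ [0, π]` to the north pole, and
a longitude in the circle `ℝ / αℤ` of length `α`. -/
structure PolarCoords (α : ℝ) where
  /-- distance to the north pole -/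
  colat : ℝ
  /-- longitude, modulo `α` -/
  lon : AddCircle α
  colat_mem : colat ∈ Set.Icc 0 Real.pi

/-- The third side of a spherical triangle with two sides `a`, `b` enclosing the angle `φ`
(spherical law of cosines). -/
noncomputable def sphericalSide (a b φ : ℝ) : ℝ :=
  Real.arccos (Real.cos a * Real.cos b + Real.sin a * Real.sin b * Real.cos φ)

/-- The unit vector with spherical coordinates `a` (colatitude) and `t` (longitude). -/
noncomputable def sphVec (a t : ℝ) : EuclideanSpace ℝ (Fin 3) :=
  !₂[Real.sin a * Real.cos t, Real.sin a * Real.sin t, Real.cos a]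

theorem norm_sphVec (a t : ℝ) : ‖sphVec a t‖ = 1 := by
  rw [EuclideanSpace.norm_eq, Real.sqrt_eq_one]
  simp only [sphVec, Fin.sum_univ_three, Real.norm_eq_abs, sq_abs]
  simp
  nlinarith [Real.sin_sq_add_cos_sq a, Real.sin_sq_add_cos_sq t]

theorem angle_sphVec (a b s t : ℝ) :
    InnerProductGeometry.angle (sphVec a s) (sphVec b t) = sphericalSide a b (t - s) := by
  rw [InnerProductGeometry.angle, norm_sphVec, norm_sphVec, sphericalSide]
  congr 1
  simp [sphVec, PiLp.inner_apply, Fin.sum_univ_three, Real.cos_sub]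
  ring

theorem sphericalSide_mono {a b φ ψ : ℝ} (ha : a ∈ Set.Icc 0 Real.pi)
    (hb : b ∈ Set.Icc 0 Real.pi) (h0 : 0 ≤ φ) (h : φ ≤ ψ) (hpi : ψ ≤ Real.pi) :
    sphericalSide a b φ ≤ sphericalSide a b ψ := by
  apply Real.arccos_le_arccos
  have h1 := Real.sin_nonneg_of_mem_Icc ha
  have h2 := Real.sin_nonneg_of_mem_Icc hb
  have h3 := Real.cos_le_cos_of_nonneg_of_le_pi h0 hpi h
  have := mul_le_mul_of_nonneg_left h3 (mul_nonneg h1 h2)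
  linarith

theorem sphericalSide_triangle {a b c φ ψ χ : ℝ} (ha : a ∈ Set.Icc 0 Real.pi)
    (hb : b ∈ Set.Icc 0 Real.pi) (hc : c ∈ Set.Icc 0 Real.pi)
    (hφ : φ ∈ Set.Icc 0 Real.pi) (hψ : ψ ∈ Set.Icc 0 Real.pi) (hχ : χ ∈ Set.Icc 0 Real.pi)
    (h : χ ≤ φ + ψ) :
    sphericalSide a c χ ≤ sphericalSide a b φ + sphericalSide b c ψ := by
  set ψ' := min ψ (Real.pi - φ) with hψ'
  have h0 : 0 ≤ ψ' := le_min hψ.1 (by linarith [hφ.2])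
  have h1 : sphericalSide b c ψ' ≤ sphericalSide b c ψ :=
    sphericalSide_mono hb hc h0 (min_le_left _ _) hψ.2
  have h2 : φ + ψ' ≤ Real.pi := by linarith [min_le_right ψ (Real.pi - φ)]
  have h3 : χ ≤ φ + ψ' := by
    rcases min_cases ψ (Real.pi - φ) with h' | h'
    · rw [hψ', h'.1]; exact h
    · rw [hψ', h'.1]; linarith [hχ.2]
  have h4 := sphericalSide_mono ha hc hχ.1 h3 h2
  have h5 := InnerProductGeometry.angle_le_angle_add_angle
    (sphVec a 0) (sphVec b φ) (sphVec c (φ + ψ'))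
  simp only [angle_sphVec, sub_zero, add_sub_cancel_left] at h5
  linarith

/-- The distance on `𝕊²_α` in polar coordinates. Two meridians at longitude distance `φ ≤ π`
span a spherical lune of angle `φ`, in which the spherical law of cosines gives the distance; from
`φ ≥ π` on, the shortest paths run through a pole and have the length given by `φ = π`. -/
noncomputable instance PolarCoords.instPseudoMetricSpace (α : ℝ) :
    PseudoMetricSpace (PolarCoords α) where
  dist p q := sphericalSide p.colat q.colat (min (dist p.lon q.lon) Real.pi)
  dist_self p := by
    have h : Real.cos p.colat * Real.cos p.colat + Real.sin p.colat * Real.sin p.colat = 1 := by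
      nlinarith [Real.sin_sq_add_cos_sq p.colat]
    simp [sphericalSide, min_eq_left Real.pi_pos.le, h]
  dist_comm p q := by
    simp only [sphericalSide, dist_comm p.lon q.lon]
    congr 1
    ring
  dist_triangle p q s := by
    have hm : ∀ x y : AddCircle α, min (dist x y) Real.pi ∈ Set.Icc 0 Real.pi := fun x y =>
      ⟨le_min dist_nonneg Real.pi_pos.le, min_le_right _ _⟩
    refine sphericalSide_triangle p.colat_mem q.colat_mem s.colat_mem (hm _ _) (hm _ _) (hm _ _) ?_
    have h1 := dist_triangle p.lon q.lon s.lon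
    have h2 := dist_nonneg (x := p.lon) (y := q.lon)
    have h3 := dist_nonneg (x := q.lon) (y := s.lon)
    have h4 := Real.pi_pos
    rcases min_cases (dist p.lon q.lon) Real.pi with h | h <;>
    rcases min_cases (dist q.lon s.lon) Real.pi with h' | h' <;>
    rcases min_cases (dist p.lon s.lon) Real.pi with h'' | h'' <;>
    linarith

/-- The metric space `𝕊²_α`, spherical lunes of total angle `α` glued together in cyclic order:
polar coordinates, with the points at distance `0` (all those over one pole) identified. -/
abbrev ConeSphere (α : ℝ) : Type := SeparationQuotient (PolarCoords α)

/-- The north pole `o` of `𝕊²_α`. -/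
noncomputable def northPole (α : ℝ) : ConeSphere α :=
  SeparationQuotient.mk ⟨0, 0, le_refl 0, Real.pi_pos.le⟩

/-- The open disk `D_α(o, r)` in `𝕊²_α` centered at the north pole, with the metric of `𝕊²_α`. -/
abbrev ConeDisk (α r : ℝ) : Type := Metric.ball (northPole α) r

/-- `f` restricts to a local isometry on the open set `s`: around every `x ∈ s` some ball
contained in `s` is mapped isometrically onto the ball of the same radius around `f x`.

A bijection between open subsets of surfaces that satisfies this is exactly an isometry for the
induced path metrics (Riemannian metrics). -/
def IsLocalIsometryOn {X Y : Type*} [MetricSpace X] [MetricSpace Y] (f : X → Y) (s : Set X) :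
    Prop :=
  ∀ x ∈ s, ∃ ε > 0, Metric.ball x ε ⊆ s ∧ f '' Metric.ball x ε = Metric.ball (f x) ε ∧
    ∀ y ∈ Metric.ball x ε, ∀ z ∈ Metric.ball x ε, dist (f y) (f z) = dist y z

/-- A metric space is a spherical surface (with conical singularities) if each point `p` has a
ball isometric to a disk `D_α(o, ε)` in some `𝕊²_α`, `α > 0`, with `p` corresponding to the pole;
`p` is a cone point of angle `α` if `α ≠ 2π`, and a regular point if `α = 2π`. -/
def IsSphericalSurface (S : Type*) [MetricSpace S] : Prop :=
  ∀ p : S, ∃ α > 0, ∃ ε > 0, ∃ f : S → ConeSphere α, f p = northPole α ∧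
    f '' Metric.ball p ε = Metric.ball (northPole α) ε ∧
    ∀ x ∈ Metric.ball p ε, ∀ y ∈ Metric.ball p ε, dist (f x) (f y) = dist x y

/-- `f` exhibits the set `U` as a bigon: `f` maps the (nonempty) intersection of two disks in `𝕊²`
of radii `r₁, r₂ < π/2`, neither of which contains the other, isometrically onto `U`. Here
isometric refers to induced path metrics: `f` is a bijective local isometry. (In particular `U`
is open.) -/
structure IsBigonChart {X : Type*} [MetricSpace X] (c₁ c₂ : UnitSphere) (r₁ r₂ : ℝ)
    (f : UnitSphere → X) (U : Set X) : Prop where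
  radius₁ : r₁ ∈ Set.Ioo 0 (Real.pi / 2)
  radius₂ : r₂ ∈ Set.Ioo 0 (Real.pi / 2)
  not_subset₁ : ¬ Metric.ball c₁ r₁ ⊆ Metric.ball c₂ r₂
  not_subset₂ : ¬ Metric.ball c₂ r₂ ⊆ Metric.ball c₁ r₁
  nonempty : (Metric.ball c₁ r₁ ∩ Metric.ball c₂ r₂).Nonempty
  isLocalIsometryOn : IsLocalIsometryOn f (Metric.ball c₁ r₁ ∩ Metric.ball c₂ r₂)
  bijOn : Set.BijOn f (Metric.ball c₁ r₁ ∩ Metric.ball c₂ r₂) U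

/-- `U` is a bigon in a spherical surface `X`. -/
def IsBigon {X : Type*} [MetricSpace X] (U : Set X) : Prop :=
  ∃ c₁ c₂ r₁ r₂ f, IsBigonChart (X := X) c₁ c₂ r₁ r₂ f U

/-- `U ⊆ D_α(o, r)` is a bigon along the boundary of the disk: it is exhibited as a bigon by a map
that extends continuously to the closed bigon (sides and vertices included) in such a way that the
first side, with the two vertices, goes to the boundary circle of the disk (injectively except
possibly that the two vertices may coincide), and the second side, without the vertices, goes to
the interior of the disk. -/
def IsBoundaryBigon {α r : ℝ} (U : Set (ConeDisk α r)) : Prop :=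
  ∃ (c₁ c₂ : UnitSphere) (r₂ : ℝ) (f : UnitSphere → ConeSphere α),
    IsBigonChart c₁ c₂ r r₂ f (Subtype.val '' U) ∧
    ContinuousOn f (Metric.closedBall c₁ r ∩ Metric.closedBall c₂ r₂) ∧
    Set.MapsTo f (Metric.sphere c₁ r ∩ Metric.closedBall c₂ r₂)
      (Metric.sphere (northPole α) r) ∧
    Set.InjOn f (Metric.sphere c₁ r ∩ Metric.ball c₂ r₂) ∧
    Set.MapsTo f (Metric.ball c₁ r ∩ Metric.sphere c₂ r₂) (Metric.ball (northPole α) r)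

/-- The family `𝔅` of subsets of `D_α(o, r)` fills up the boundary circle of the disk: every
boundary point is in the closure of a member of `𝔅`, and, near every boundary point with finitely
many exceptions, the disk is contained in a single member of `𝔅`. -/
def FillsBoundary {α r : ℝ} (𝔅 : Set (Set (ConeDisk α r))) : Prop :=
  (∀ p ∈ Metric.sphere (northPole α) r, ∃ U ∈ 𝔅, p ∈ closure (Subtype.val '' U)) ∧
  {p ∈ Metric.sphere (northPole α) r |
    ¬ ∃ U ∈ 𝔅, ∃ ε > 0, ∀ x : ConeDisk α r, dist x.1 p < ε → x ∈ U}.Finite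

/-- The set `B` of points with exactly two preimages. -/
def doublePoints {X S : Type*} (ι : X → S) : Set S :=
  {p | (ι ⁻¹' {p}).encard = 2}

/-! The maps `ι ⟨i, ·⟩` are extended (by junk values) to maps `J i : 𝕊²_α → S`, and everything is
transported to the round sphere by developing.

*Rigidity.* A distance-preserving map from an open subset of `𝕊²` to `𝕊²` is the restriction of a
linear isometry (`UnitSphere.exists_rot_of_dist_eq`), so two local isometries from a connected open
subset of `𝕊²` to the same space agree as soon as they agree near one point
(`UnitSphere.eqOn_of_eventuallyEq`). Cone spheres have charts `coneChart` that are local isometries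
off a slit which starts at the pole.

*Lenses.* Let `x ≠ y` be points of the disks `i` and `j` with the same image in `S`. Choose charts
`E₁`, `E₂` of the two disks with the same base point `z`, which take `z` to `x` and `y` and for which
`J i ∘ E₁ = J j ∘ E₂` near `z`. Their poles `c₁`, `c₂` are the developed centers of the two disks. By
continuation along geodesics from `z`, the equality holds on the lens `B(c₁, r i) ∩ B(c₂, r j)`, as
far as the two slits allow. The slit of a chart meets the lens only if its pole does. If one pole
does, then following the geodesic from `z` to the first of the two poles shows that a cone point has
the same image as a regular point, which is impossible since the points of small circles around a
cone point do not have unique antipodes (`eq_two_pi_of_isoOnBall`), or that the two poles coincide.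
In this case the two disks are concentric in `S`, so that one image contains the other
(`IsDiskFamily.image_subset_of_center_eq`). Therefore a lens contains a center only if this is a
regular point, and if one of the disks in `𝕊²` contained the other, then the image of one disk
would contain that of the other. This yields `IsDiskFamily.exists_isLens`.

*Bigons.* Two lenses which develop the same pair of points differ by a linear isometry
(`IsLens.exists_rot`). Hence the images of lenses in a disk are equal or disjoint. The developments
are injective, because an isometry which preserves a development and both poles fixes a point of
the lens. The two images of one lens are different, because an isometry which exchanges the poles
fixes their midpoint. The images of the lenses are the bigons, and `E₂ ∘ E₁⁻¹` is the pairing.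

*The boundary.* Since `J i` does not increase distances on convex sets and `S` is compact, `J i` has
a limit `q` at each boundary point `p`. If `q` is in the image of some disk, then all points of the
disk `i` near `p` are double points and belong to a single bigon (`exists_isFilledBy`). The boundary
points `p` with missed `q` are isolated (`eventually_isFilledBy`): with respect to a chart of `S` at
`q`, the distance to `q` is in the development the distance to a fixed point of `𝕊²`, and this point
would have to be `p` and also every nearby boundary point with the limit `q`. By compactness of
the boundary circle, there are finitely many exceptions and finitely many bigons. -/

/-! ### The unit sphere with its angular metric -/

namespace UnitSphere

open Filter Topology

theorem inner_vec (x y : UnitSphere) : inner ℝ x.vec y.vec = Real.cos (dist x y) := by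
  change _ = Real.cos (InnerProductGeometry.angle x.vec y.vec)
  rw [InnerProductGeometry.cos_angle, x.norm_vec, y.norm_vec]
  simp

theorem inner_self (x : UnitSphere) : inner ℝ x.vec x.vec = (1 : ℝ) := by
  rw [inner_vec, dist_self, Real.cos_zero]

theorem dist_le_pi (x y : UnitSphere) : dist x y ≤ Real.pi :=
  InnerProductGeometry.angle_le_pi _ _

theorem dist_mem_Icc (x y : UnitSphere) : dist x y ∈ Set.Icc 0 Real.pi :=
  ⟨dist_nonneg, dist_le_pi x y⟩

theorem dist_eq_arccos (x y : UnitSphere) : dist x y = Real.arccos (inner ℝ x.vec y.vec) := by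
  rw [inner_vec, Real.arccos_cos dist_nonneg (dist_le_pi x y)]

theorem dist_lt_iff {x y : UnitSphere} {r : ℝ} (hr : r ∈ Set.Icc 0 Real.pi) :
    dist x y < r ↔ Real.cos r < inner ℝ x.vec y.vec := by
  rw [inner_vec, Real.strictAntiOn_cos.lt_iff_gt hr (dist_mem_Icc x y)]

theorem dist_le_iff {x y : UnitSphere} {r : ℝ} (hr : r ∈ Set.Icc 0 Real.pi) :
    dist x y ≤ r ↔ Real.cos r ≤ inner ℝ x.vec y.vec := by
  rw [inner_vec, Real.strictAntiOn_cos.le_iff_ge hr (dist_mem_Icc x y)]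

theorem dist_eq_iff {x y z w : UnitSphere} :
    dist x y = dist z w ↔ inner ℝ x.vec y.vec = (inner ℝ z.vec w.vec : ℝ) := by
  rw [inner_vec, inner_vec]
  exact ⟨fun h => by rw [h], fun h => Real.injOn_cos (dist_mem_Icc _ _) (dist_mem_Icc _ _) h⟩

theorem norm_vec_sub_le (x y : UnitSphere) : ‖x.vec - y.vec‖ ≤ dist x y := by
  refine le_of_sq_le_sq ?_ dist_nonneg
  rw [norm_sub_sq_real, x.norm_vec, y.norm_vec, inner_vec]
  have := Real.one_sub_sq_div_two_le_cos (x := dist x y)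
  linarith

theorem continuous_vec : Continuous UnitSphere.vec := by
  refine (LipschitzWith.of_dist_le_mul (K := 1) fun x y => ?_).continuous
  rw [dist_eq_norm, NNReal.coe_one, one_mul]
  exact norm_vec_sub_le x y

theorem tendsto_iff {Y : Type*} {f : Y → UnitSphere} {l : Filter Y} {x : UnitSphere} :
    Tendsto f l (𝓝 x) ↔ Tendsto (fun y => (f y).vec) l (𝓝 x.vec) := by
  refine ⟨fun h => (continuous_vec.tendsto x).comp h, fun h => ?_⟩
  rw [tendsto_iff_dist_tendsto_zero]
  have h1 : Tendsto (fun y => Real.arccos (inner ℝ (f y).vec x.vec)) l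
      (𝓝 (Real.arccos (inner ℝ x.vec x.vec))) :=
    (Real.continuous_arccos.tendsto _).comp (h.inner tendsto_const_nhds)
  rw [inner_self, Real.arccos_one] at h1
  simpa only [dist_eq_arccos] using h1

theorem continuous_iff {Y : Type*} [TopologicalSpace Y] {f : Y → UnitSphere} :
    Continuous f ↔ Continuous fun y => (f y).vec := by
  simp only [continuous_iff_continuousAt, ContinuousAt, tendsto_iff]

/-- The unit vector in the direction of a nonzero vector. -/
noncomputable def ofVec (v : EuclideanSpace ℝ (Fin 3)) (hv : v ≠ 0) : UnitSphere where
  vec := ‖v‖⁻¹ • v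
  norm_vec := by
    rw [norm_smul, norm_inv, norm_norm, inv_mul_cancel₀ (norm_ne_zero_iff.2 hv)]

/-- `u` lies on the great-circle segment from `z` to `w`: as a vector, it is a nonnegative
combination of `z` and `w`. -/
def Between (z u w : UnitSphere) : Prop :=
  ∃ a b : ℝ, 0 ≤ a ∧ 0 ≤ b ∧ u.vec = a • z.vec + b • w.vec

theorem between_left (z w : UnitSphere) : Between z z w :=
  ⟨1, 0, zero_le_one, le_rfl, by simp⟩

theorem between_right (z w : UnitSphere) : Between z w w :=
  ⟨0, 1, le_rfl, zero_le_one, by simp⟩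

theorem Between.one_le {z u w : UnitSphere} {a b : ℝ} (ha : 0 ≤ a) (hb : 0 ≤ b)
    (h : u.vec = a • z.vec + b • w.vec) : 1 ≤ a + b := by
  have h1 := norm_add_le (a • z.vec) (b • w.vec)
  rw [← h, u.norm_vec, norm_smul, norm_smul, z.norm_vec, w.norm_vec, Real.norm_of_nonneg ha,
    Real.norm_of_nonneg hb] at h1
  linarith

/-- Disks of radius at most `π / 2` are geodesically convex. -/
theorem Between.mem_ball {z u w c : UnitSphere} {r : ℝ} (h : Between z u w)
    (hr : r ∈ Set.Icc 0 (Real.pi / 2)) (hz : z ∈ Metric.ball c r) (hw : w ∈ Metric.ball c r) :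
    u ∈ Metric.ball c r := by
  obtain ⟨a, b, ha, hb, h⟩ := h
  have hr' : r ∈ Set.Icc 0 Real.pi := ⟨hr.1, by linarith [hr.2, Real.pi_pos]⟩
  rw [Metric.mem_ball, dist_lt_iff hr'] at hz hw ⊢
  have h1 := Between.one_le ha hb h
  have h0 : 0 ≤ Real.cos r := Real.cos_nonneg_of_mem_Icc ⟨by linarith [hr.1, Real.pi_pos], hr.2⟩
  rw [h, inner_add_left, inner_smul_left, inner_smul_left]
  simp only [conj_trivial]
  rcases ha.eq_or_lt with rfl | ha
  · nlinarith
  · nlinarith [mul_lt_mul_of_pos_left hz ha, mul_le_mul_of_nonneg_left hw.le hb]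

/-- A segment which starts at an interior point of a disk and does not end outside of the closed
disk stays in the open disk up to its endpoint. -/
theorem Between.mem_ball_of_closedBall {z u w c : UnitSphere} {r : ℝ} (h : Between z u w)
    (hr : r ∈ Set.Icc 0 (Real.pi / 2)) (hz : z ∈ Metric.ball c r)
    (hw : w ∈ Metric.closedBall c r) (hu : u ≠ w) : u ∈ Metric.ball c r := by
  obtain ⟨a, b, ha, hb, h⟩ := h
  have hr' : r ∈ Set.Icc 0 Real.pi := ⟨hr.1, by linarith [hr.2, Real.pi_pos]⟩
  rw [Metric.mem_ball, dist_lt_iff hr'] at hz ⊢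
  rw [Metric.mem_closedBall, dist_le_iff hr'] at hw
  have h1 := Between.one_le ha hb h
  have h0 : 0 ≤ Real.cos r := Real.cos_nonneg_of_mem_Icc ⟨by linarith [hr.1, Real.pi_pos], hr.2⟩
  have ha' : 0 < a := by
    rcases ha.eq_or_lt with rfl | ha
    · exfalso
      apply hu
      rw [zero_smul, zero_add] at h
      have h2 := congrArg norm h
      rw [norm_smul, u.norm_vec, w.norm_vec, Real.norm_of_nonneg hb, mul_one] at h2
      ext1
      rw [h, ← h2, one_smul]
    · exact ha
  rw [h, inner_add_left, inner_smul_left, inner_smul_left]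
  simp only [conj_trivial]
  nlinarith [mul_lt_mul_of_pos_left hz ha', mul_le_mul_of_nonneg_left hw hb]

theorem isPreconnected_between {z w c : UnitSphere} (hz : 0 < inner ℝ z.vec c.vec)
    (hw : 0 < inner ℝ w.vec c.vec) : IsPreconnected {u | Between z u w} := by
  have hne : ∀ s : Set.Icc (0 : ℝ) 1, (1 - s.1) • z.vec + s.1 • w.vec ≠ 0 := by
    intro s h
    have h1 := congrArg (fun v => inner ℝ v c.vec) h
    simp only [inner_add_left, inner_smul_left, inner_zero_left, conj_trivial] at h1
    obtain ⟨s, hs0, hs1⟩ := s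
    rcases hs0.eq_or_lt with rfl | hs0
    · simp at h1; linarith
    · simp only at h1
      nlinarith [mul_pos hs0 hw, mul_nonneg (sub_nonneg.2 hs1) hz.le]
  have hc : Continuous fun s : Set.Icc (0 : ℝ) 1 => ofVec _ (hne s) := by
    rw [continuous_iff]
    refine Continuous.smul (Continuous.inv₀ (by fun_prop) fun s => norm_ne_zero_iff.2 (hne s)) ?_
    fun_prop
  convert isPreconnected_range hc
  ext u
  constructor
  · rintro ⟨a, b, ha, hb, h⟩
    have h1 := Between.one_le ha hb h
    have h2 : 0 < a + b := by linarith
    refine ⟨⟨b / (a + b), by positivity, by rw [div_le_one h2]; linarith⟩, ?_⟩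
    have h3 : (1 - b / (a + b)) • z.vec + (b / (a + b)) • w.vec = (a + b)⁻¹ • u.vec := by
      rw [h, smul_add, smul_smul, smul_smul]
      congr 2 <;> field_simp
      ring
    ext1
    simp only [ofVec, h3, norm_smul, u.norm_vec, norm_inv, Real.norm_of_nonneg h2.le, mul_one,
      inv_inv, smul_smul]
    rw [mul_inv_cancel₀ h2.ne', one_smul]
  · rintro ⟨⟨s, hs0, hs1⟩, rfl⟩
    refine ⟨‖(1 - s) • z.vec + s • w.vec‖⁻¹ * (1 - s), ‖(1 - s) • z.vec + s • w.vec‖⁻¹ * s,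
      mul_nonneg (by positivity) (by linarith), by positivity, ?_⟩
    simp only [ofVec, smul_add, smul_smul]

/-- A subset of an open hemisphere which is star-shaped about one of its points is connected. -/
theorem isPreconnected_of_star {K : Set UnitSphere} {z c : UnitSphere}
    (hc : ∀ w ∈ K, 0 < inner ℝ w.vec c.vec) (hz : z ∈ K)
    (hK : ∀ w ∈ K, ∀ u, Between z u w → u ∈ K) : IsPreconnected K :=
  isPreconnected_of_forall z fun w hw =>
    ⟨{u | Between z u w}, fun u hu => hK w hw u hu, between_left z w, between_right z w,
      isPreconnected_between (hc z hz) (hc w hw)⟩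

theorem inner_pos_of_mem_ball {z c : UnitSphere} {r : ℝ} (hr : r ≤ Real.pi / 2)
    (hz : z ∈ Metric.ball c r) : 0 < inner ℝ z.vec c.vec := by
  rw [Metric.mem_ball] at hz
  rw [inner_vec]
  exact Real.cos_pos_of_mem_Ioo ⟨by linarith [dist_nonneg (x := z) (y := c), Real.pi_pos],
    by linarith⟩

theorem isPreconnected_ball_inter {c c' : UnitSphere} {r r' : ℝ}
    (hr : r ∈ Set.Icc 0 (Real.pi / 2)) (hr' : r' ∈ Set.Icc 0 (Real.pi / 2)) :
    IsPreconnected (Metric.ball c r ∩ Metric.ball c' r') := by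
  rcases (Metric.ball c r ∩ Metric.ball c' r').eq_empty_or_nonempty with h | ⟨z, hz⟩
  · rw [h]; exact isPreconnected_empty
  · exact isPreconnected_of_star (c := c) (fun w hw => inner_pos_of_mem_ball hr.2 hw.1) hz
      fun w hw u hu => ⟨hu.mem_ball hr hz.1 hw.1, hu.mem_ball hr' hz.2 hw.2⟩

/-- A nonempty open subset of the sphere spans the ambient space. -/
theorem eq_zero_of_inner_eq_zero {z : UnitSphere} {n : EuclideanSpace ℝ (Fin 3)}
    (h : ∀ᶠ w in 𝓝 z, inner ℝ w.vec n = (0 : ℝ)) : n = 0 := by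
  by_contra hn
  have h0 : inner ℝ z.vec n = (0 : ℝ) := h.self_of_nhds
  have hne : ∀ s : ℝ, z.vec + s • n ≠ 0 := by
    intro s hs
    have h1 := congrArg (fun v => inner ℝ z.vec v) hs
    simp only [inner_add_right, inner_smul_right, h0, inner_self, inner_zero_right] at h1
    norm_num at h1
  have hc : Continuous fun s : ℝ => ofVec _ (hne s) := by
    rw [continuous_iff]
    exact Continuous.smul (Continuous.inv₀ (by fun_prop) fun s => norm_ne_zero_iff.2 (hne s))
      (by fun_prop)
  have hz : ofVec _ (hne 0) = z := by
    ext1; simp [ofVec, z.norm_vec]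
  have h1 : ∀ᶠ s in 𝓝 (0 : ℝ), inner ℝ (ofVec _ (hne s)).vec n = (0 : ℝ) := by
    have := hc.tendsto 0
    rw [hz] at this
    exact this.eventually h
  obtain ⟨s, hs, hs0⟩ := ((h1.filter_mono nhdsWithin_le_nhds).and
    (self_mem_nhdsWithin (s := Set.Ioi (0 : ℝ)))).exists
  simp only [ofVec, inner_smul_left, inner_add_left, h0, zero_add, conj_trivial] at hs
  rcases mul_eq_zero.1 hs with h2 | h2
  · exact inv_ne_zero (norm_ne_zero_iff.2 (hne s)) h2
  · rcases mul_eq_zero.1 h2 with h3 | h3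
    · exact hs0.ne' h3
    · exact hn (inner_self_eq_zero.1 h3)

/-- A point of the sphere is determined by its distances to the points of an open set. -/
theorem eq_of_eventually_dist_eq {z c c' : UnitSphere}
    (h : ∀ᶠ w in 𝓝 z, dist w c = dist w c') : c = c' := by
  have := eq_zero_of_inner_eq_zero (z := z) (n := c.vec - c'.vec) (by
    filter_upwards [h] with w hw
    rw [inner_sub_right, dist_eq_iff.1 hw, sub_self])
  ext1
  exact sub_eq_zero.1 this

/-- The action of a linear isometry on the unit sphere. -/
noncomputable def rot (R : EuclideanSpace ℝ (Fin 3) ≃ₗᵢ[ℝ] EuclideanSpace ℝ (Fin 3)) (z : UnitSphere) :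
    UnitSphere where
  vec := R z.vec
  norm_vec := by rw [R.norm_map, z.norm_vec]

theorem dist_rot (R : EuclideanSpace ℝ (Fin 3) ≃ₗᵢ[ℝ] EuclideanSpace ℝ (Fin 3))
    (z w : UnitSphere) : dist (rot R z) (rot R w) = dist z w := by
  rw [dist_eq_iff]
  exact R.inner_map_map _ _

theorem isometry_rot (R : EuclideanSpace ℝ (Fin 3) ≃ₗᵢ[ℝ] EuclideanSpace ℝ (Fin 3)) :
    Isometry (rot R) := Isometry.of_dist_eq (dist_rot R)

@[simp] theorem rot_symm_rot (R : EuclideanSpace ℝ (Fin 3) ≃ₗᵢ[ℝ] EuclideanSpace ℝ (Fin 3))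
    (z : UnitSphere) : rot R.symm (rot R z) = z := by
  ext1; simp [rot]

@[simp] theorem rot_rot_symm (R : EuclideanSpace ℝ (Fin 3) ≃ₗᵢ[ℝ] EuclideanSpace ℝ (Fin 3))
    (z : UnitSphere) : rot R (rot R.symm z) = z := by
  ext1; simp [rot]

theorem dist_rot_left (R : EuclideanSpace ℝ (Fin 3) ≃ₗᵢ[ℝ] EuclideanSpace ℝ (Fin 3))
    (z w : UnitSphere) : dist (rot R z) w = dist z (rot R.symm w) := by
  rw [← dist_rot R z, rot_rot_symm]

theorem Between.rot {z u w : UnitSphere} (h : Between z u w)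
    (R : EuclideanSpace ℝ (Fin 3) ≃ₗᵢ[ℝ] EuclideanSpace ℝ (Fin 3)) :
    Between (rot R z) (rot R u) (rot R w) := by
  obtain ⟨a, b, ha, hb, h⟩ := h
  exact ⟨a, b, ha, hb, by simp [UnitSphere.rot, h]⟩

theorem rot_eq_self_of_eventually
    {R : EuclideanSpace ℝ (Fin 3) ≃ₗᵢ[ℝ] EuclideanSpace ℝ (Fin 3)} {z : UnitSphere}
    (h : ∀ᶠ w in 𝓝 z, rot R w = w) (w : UnitSphere) : rot R w = w := by
  have h1 : rot R.symm w = w := eq_of_eventually_dist_eq (z := z) (by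
    filter_upwards [h] with u hu
    rw [← dist_rot_left, hu])
  conv_lhs => rw [← h1]
  simp

/-- A distance-preserving map from an open subset of the sphere to the sphere is the restriction of
a linear isometry. -/
theorem exists_rot_of_dist_eq {K : Set UnitSphere} (hK : IsOpen K) (hne : K.Nonempty)
    {φ : UnitSphere → UnitSphere} (hφ : ∀ a ∈ K, ∀ b ∈ K, dist (φ a) (φ b) = dist a b) :
    ∃ R : EuclideanSpace ℝ (Fin 3) ≃ₗᵢ[ℝ] EuclideanSpace ℝ (Fin 3), ∀ a ∈ K, φ a = rot R a := by
  obtain ⟨z, hz⟩ := hne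
  have hspan : Submodule.span ℝ (UnitSphere.vec '' K) = ⊤ := by
    rw [← Submodule.orthogonal_eq_bot_iff, Submodule.eq_bot_iff]
    intro n hn
    refine eq_zero_of_inner_eq_zero (z := z) ?_
    filter_upwards [hK.mem_nhds hz] with w hw
    exact (Submodule.mem_orthogonal _ _).1 hn _ (Submodule.subset_span ⟨w, hw, rfl⟩)
  obtain ⟨b, hbK, hbspan, hbli⟩ := exists_linearIndependent ℝ (UnitSphere.vec '' K)
  let B : Module.Basis b ℝ (EuclideanSpace ℝ (Fin 3)) :=
    Module.Basis.mk hbli (by rw [Subtype.range_coe, hbspan, hspan])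
  choose p hpK hp using fun x : b => hbK x.2
  have hB : ∀ x, B x = (p x).vec := fun x => by rw [Module.Basis.mk_apply, hp]
  -- equal distances are equal inner products, so the linear extension `T` of `φ` from a basis of
  -- points of `K` preserves the Gram matrix
  let T : EuclideanSpace ℝ (Fin 3) →ₗ[ℝ] EuclideanSpace ℝ (Fin 3) :=
    B.constr ℝ fun x => (φ (p x)).vec
  have hTB : ∀ x, T (B x) = (φ (p x)).vec := fun x => B.constr_basis ℝ _ x
  have hin : ∀ x y, inner ℝ (T x) (T y) = inner ℝ x y := by
    have : (innerₗ (EuclideanSpace ℝ (Fin 3))).compl₁₂ T T = innerₗ (EuclideanSpace ℝ (Fin 3)) := by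
      refine B.ext fun x => B.ext fun y => ?_
      simp only [LinearMap.compl₁₂_apply, innerₗ_apply_apply, hTB]
      rw [hB, hB]
      exact dist_eq_iff.1 (hφ _ (hpK x) _ (hpK y))
    intro x y
    exact congrArg (fun f => f x y) this
  let R := (T.isometryOfInner hin).toLinearIsometryEquiv rfl
  have hR : ∀ v, R v = T v := fun v => rfl
  refine ⟨R, fun a ha => ?_⟩
  have h2 : ∀ v, inner ℝ v ((φ a).vec - R a.vec) = (0 : ℝ) := by
    have h3 : (innerₗ (EuclideanSpace ℝ (Fin 3))).flip ((φ a).vec - R a.vec) ∘ₗ T = 0 := by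
      refine B.ext fun x => ?_
      simp only [LinearMap.comp_apply, LinearMap.flip_apply, innerₗ_apply_apply,
        LinearMap.zero_apply, inner_sub_right, hR, hin]
      rw [hTB, hB, dist_eq_iff.1 (hφ _ (hpK x) _ ha), sub_self]
    intro v
    have := congrArg (fun f => f (R.symm v)) h3
    simpa only [LinearMap.comp_apply, LinearMap.flip_apply, innerₗ_apply_apply,
        LinearMap.zero_apply, ← hR, LinearIsometryEquiv.apply_symm_apply] using this
  ext1
  exact sub_eq_zero.1 (inner_self_eq_zero.1 (h2 _))

/-- Non-antipodal points are joined by a unit speed geodesic. -/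
theorem exists_geodesic {z w : UnitSphere} (h : dist z w < Real.pi) :
    ∃ γ : ℝ → UnitSphere, γ 0 = z ∧ γ (dist z w) = w ∧
      (∀ s ∈ Set.Icc 0 (dist z w), Between z (γ s) w) ∧
      ∀ s ∈ Set.Icc 0 (dist z w), ∀ t ∈ Set.Icc 0 (dist z w), dist (γ s) (γ t) = |s - t| := by
  rcases eq_or_ne z w with rfl | hne
  · refine ⟨fun _ => z, rfl, rfl, fun s _ => between_left z z, ?_⟩
    intro s hs t ht
    rw [dist_self] at hs ht
    simp [le_antisymm hs.2 hs.1, le_antisymm ht.2 ht.1]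
  set l := dist z w with hl
  have hl0 : 0 < l := dist_pos.2 hne
  have hs0 : 0 < Real.sin l := Real.sin_pos_of_pos_of_lt_pi hl0 h
  have hzw : inner ℝ z.vec w.vec = Real.cos l := inner_vec z w
  have hsc := Real.sin_sq_add_cos_sq l
  have key : ∀ s t : ℝ, inner ℝ ((Real.sin l)⁻¹ • (Real.sin (l - s) • z.vec + Real.sin s • w.vec))
      ((Real.sin l)⁻¹ • (Real.sin (l - t) • z.vec + Real.sin t • w.vec)) = Real.cos (s - t) := by
    intro s t
    simp only [inner_smul_left, inner_smul_right, inner_add_left, inner_add_right, conj_trivial,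
      inner_self, hzw, real_inner_comm z.vec w.vec]
    rw [Real.sin_sub, Real.sin_sub, Real.cos_sub]
    field_simp
    linear_combination (-Real.sin t * Real.sin s) * hsc
  have hn : ∀ s : ℝ, ‖(Real.sin l)⁻¹ • (Real.sin (l - s) • z.vec + Real.sin s • w.vec)‖ = 1 := by
    intro s
    have := key s s
    rw [real_inner_self_eq_norm_sq, sub_self, Real.cos_zero] at this
    exact (pow_eq_one_iff_of_nonneg (norm_nonneg _) two_ne_zero).1 this
  refine ⟨fun s => ⟨_, hn s⟩, ?_, ?_, ?_, ?_⟩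
  · ext1; simp [hs0.ne']
  · ext1; simp [hs0.ne']
  · intro s hs
    refine ⟨(Real.sin l)⁻¹ * Real.sin (l - s), (Real.sin l)⁻¹ * Real.sin s, ?_, ?_, ?_⟩
    · exact mul_nonneg (by positivity)
        (Real.sin_nonneg_of_nonneg_of_le_pi (by linarith [hs.2]) (by linarith [hs.1]))
    · exact mul_nonneg (by positivity)
        (Real.sin_nonneg_of_nonneg_of_le_pi hs.1 (by linarith [hs.2]))
    · simp [smul_smul]
  · intro s hs t ht
    rw [dist_eq_arccos, key, ← Real.cos_abs, Real.arccos_cos (abs_nonneg _)]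
    rw [abs_le]
    constructor <;> linarith [hs.1, hs.2, ht.1, ht.2]

end UnitSphere

/-! ### Local isometries -/

section LocalIsometry

open Filter Topology

/-- `f` maps the ball of radius `ε` around `x` isometrically onto the ball of the same radius
around `f x`. -/
def IsoOnBall {X Y : Type*} [MetricSpace X] [MetricSpace Y] (f : X → Y) (x : X) (ε : ℝ) : Prop :=
  f '' Metric.ball x ε = Metric.ball (f x) ε ∧
    ∀ y ∈ Metric.ball x ε, ∀ z ∈ Metric.ball x ε, dist (f y) (f z) = dist y z

variable {X Y Z : Type*} [MetricSpace X] [MetricSpace Y] [MetricSpace Z]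

theorem IsoOnBall.dist_center {f : X → Y} {x y : X} {ε : ℝ} (h : IsoOnBall f x ε)
    (hy : y ∈ Metric.ball x ε) : dist (f y) (f x) = dist y x :=
  h.2 y hy x (Metric.mem_ball_self (dist_nonneg.trans_lt hy))

theorem IsoOnBall.mapsTo {f : X → Y} {x y : X} {ε : ℝ} (h : IsoOnBall f x ε)
    (hy : y ∈ Metric.ball x ε) : f y ∈ Metric.ball (f x) ε := by
  rw [← h.1]; exact ⟨y, hy, rfl⟩

theorem IsoOnBall.injOn {f : X → Y} {x : X} {ε : ℝ} (h : IsoOnBall f x ε) :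
    Set.InjOn f (Metric.ball x ε) := fun y hy z hz hyz => by
  rw [← dist_eq_zero, ← h.2 y hy z hz, hyz, dist_self]

theorem IsoOnBall.exists_preimage {f : X → Y} {x : X} {ε : ℝ} (h : IsoOnBall f x ε) {y : Y}
    (hy : y ∈ Metric.ball (f x) ε) : ∃ z ∈ Metric.ball x ε, f z = y := by
  rw [← h.1] at hy; exact hy

theorem IsoOnBall.mono {f : X → Y} {x : X} {ε δ : ℝ} (h : IsoOnBall f x ε) (hδ : δ ≤ ε) :
    IsoOnBall f x δ := by
  refine ⟨Set.Subset.antisymm ?_ fun y hy => ?_, fun y hy z hz =>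
    h.2 y (Metric.ball_subset_ball hδ hy) z (Metric.ball_subset_ball hδ hz)⟩
  · rintro _ ⟨y, hy, rfl⟩
    rw [Metric.mem_ball, h.dist_center (Metric.ball_subset_ball hδ hy)]
    exact hy
  · obtain ⟨z, hz, rfl⟩ := h.exists_preimage (Metric.ball_subset_ball hδ hy)
    refine ⟨z, ?_, rfl⟩
    rw [Metric.mem_ball, h.dist_center hz] at hy
    exact hy

theorem IsoOnBall.comp {f : X → Y} {g : Y → Z} {x : X} {ε : ℝ} (hg : IsoOnBall g (f x) ε)
    (hf : IsoOnBall f x ε) : IsoOnBall (g ∘ f) x ε := by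
  refine ⟨by rw [Set.image_comp, hf.1, hg.1]; rfl, fun y hy z hz => ?_⟩
  rw [Function.comp, Function.comp, hg.2 _ (hf.mapsTo hy) _ (hf.mapsTo hz), hf.2 y hy z hz]

theorem IsoOnBall.continuousAt {f : X → Y} {x : X} {ε : ℝ} (hε : 0 < ε) (h : IsoOnBall f x ε) :
    ContinuousAt f x := by
  rw [ContinuousAt, tendsto_iff_dist_tendsto_zero]
  refine (tendsto_iff_dist_tendsto_zero.1 (tendsto_id (x := 𝓝 x))).congr' ?_
  filter_upwards [Metric.ball_mem_nhds x hε] with y hy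
  exact (h.dist_center hy).symm

/-- Two maps that are isometric near points with the same image differ near these points by a
change of coordinates. -/
theorem IsoOnBall.exists_transition {f : X → Z} {g : Y → Z} {x : X} {y : Y} {ε : ℝ} (hε : 0 < ε)
    (hf : IsoOnBall f x ε) (hg : IsoOnBall g y ε) (hxy : f x = g y) :
    ∃ φ : X → Y, φ x = y ∧ IsoOnBall φ x ε ∧ ∀ w ∈ Metric.ball x ε, g (φ w) = f w := by
  have h : ∀ w ∈ Metric.ball x ε, ∃ u ∈ Metric.ball y ε, g u = f w := fun w hw =>
    hg.exists_preimage (hxy ▸ hf.mapsTo hw)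
  have : Nonempty Y := ⟨y⟩
  choose! φ hφ hgφ using h
  have hx : φ x = y := by
    have hxε := Metric.mem_ball_self hε (x := x)
    exact hg.injOn (hφ x hxε) (Metric.mem_ball_self hε) (by rw [hgφ x hxε, hxy])
  refine ⟨φ, hx, ⟨?_, ?_⟩, hgφ⟩
  · rw [hx]
    refine Set.Subset.antisymm (Set.image_subset_iff.2 hφ) fun u hu => ?_
    obtain ⟨w, hw, hwu⟩ := hf.exists_preimage (hxy ▸ hg.mapsTo hu)
    exact ⟨w, hw, hg.injOn (hφ w hw) hu (by rw [hgφ w hw, hwu])⟩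
  · intro a ha b hb
    rw [← hg.2 _ (hφ a ha) _ (hφ b hb), hgφ a ha, hgφ b hb, hf.2 a ha b hb]

theorem IsLocalIsometryOn.exists_isoOnBall {f : X → Y} {s : Set X} (h : IsLocalIsometryOn f s)
    {x : X} (hx : x ∈ s) : ∃ ε > 0, Metric.ball x ε ⊆ s ∧ IsoOnBall f x ε := h x hx

theorem IsLocalIsometryOn.isOpen {f : X → Y} {s : Set X} (h : IsLocalIsometryOn f s) :
    IsOpen s := by
  rw [Metric.isOpen_iff]
  intro x hx
  obtain ⟨ε, hε, h1, _⟩ := h x hx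
  exact ⟨ε, hε, h1⟩

theorem IsLocalIsometryOn.continuousAt {f : X → Y} {s : Set X} (h : IsLocalIsometryOn f s)
    {x : X} (hx : x ∈ s) : ContinuousAt f x := by
  obtain ⟨ε, hε, _, h1⟩ := h.exists_isoOnBall hx
  exact h1.continuousAt hε

theorem IsLocalIsometryOn.mono {f : X → Y} {s t : Set X} (h : IsLocalIsometryOn f s)
    (ht : IsOpen t) (hts : t ⊆ s) : IsLocalIsometryOn f t := by
  intro x hx
  obtain ⟨ε, hε, _, h1⟩ := h.exists_isoOnBall (hts hx)
  obtain ⟨δ, hδ, h2⟩ := Metric.isOpen_iff.1 ht x hx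
  exact ⟨min ε δ, lt_min hε hδ, (Metric.ball_subset_ball (min_le_right _ _)).trans h2,
    h1.mono (min_le_left _ _)⟩

theorem IsLocalIsometryOn.comp {f : X → Y} {g : Y → Z} {s : Set X} {t : Set Y}
    (hg : IsLocalIsometryOn g t) (hf : IsLocalIsometryOn f s) (hst : Set.MapsTo f s t) :
    IsLocalIsometryOn (g ∘ f) s := by
  intro x hx
  obtain ⟨ε, hε, h0, h1⟩ := hf.exists_isoOnBall hx
  obtain ⟨δ, hδ, _, h2⟩ := hg.exists_isoOnBall (hst hx)
  exact ⟨min ε δ, lt_min hε hδ, (Metric.ball_subset_ball (min_le_left _ _)).trans h0,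
    (h2.mono (min_le_right _ _)).comp (h1.mono (min_le_left _ _))⟩

theorem IsLocalIsometryOn.exists_mem_nhds_injOn {f : X → Y} {s : Set X} (h : IsLocalIsometryOn f s)
    {x : X} (hx : x ∈ s) : ∃ V ∈ 𝓝 x, Set.InjOn f V := by
  obtain ⟨ε, hε, _, h1⟩ := h.exists_isoOnBall hx
  exact ⟨_, Metric.ball_mem_nhds x hε, h1.injOn⟩

/-- The inverse of an injective local isometry is a local isometry. -/
theorem IsLocalIsometryOn.of_leftInverse {f : X → Y} {g : Y → X} {s : Set X}
    (hf : IsLocalIsometryOn f s) (hg : ∀ x ∈ s, g (f x) = x) : IsLocalIsometryOn g (f '' s) := by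
  rintro _ ⟨x, hx, rfl⟩
  obtain ⟨ε, hε, h0, h1⟩ := hf.exists_isoOnBall hx
  refine ⟨ε, hε, ?_, ?_, ?_⟩
  · rw [← h1.1]; exact Set.image_mono h0
  · rw [← h1.1, hg x hx, Set.image_image]
    exact (Set.image_congr fun y hy => hg y (h0 hy)).trans (Set.image_id' _)
  · rw [← h1.1]
    rintro _ ⟨y, hy, rfl⟩ _ ⟨z, hz, rfl⟩
    rw [hg y (h0 hy), hg z (h0 hz), h1.2 y hy z hz]

namespace UnitSphere

theorem isLocalIsometryOn_rot (R : EuclideanSpace ℝ (Fin 3) ≃ₗᵢ[ℝ] EuclideanSpace ℝ (Fin 3)) :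
    IsLocalIsometryOn (rot R) Set.univ := by
  refine fun x _ => ⟨1, one_pos, Set.subset_univ _, ?_, fun y _ z _ => dist_rot R y z⟩
  ext y
  constructor
  · rintro ⟨z, hz, rfl⟩
    rw [Metric.mem_ball, dist_rot]
    exact hz
  · intro hy
    refine ⟨rot R.symm y, ?_, rot_rot_symm R y⟩
    rw [Metric.mem_ball, dist_rot_left, LinearIsometryEquiv.symm_symm]
    exact hy

theorem isLocalIsometryOn_comp_rot {f : UnitSphere → X} {s : Set UnitSphere}
    (hf : IsLocalIsometryOn f s)
    (R : EuclideanSpace ℝ (Fin 3) ≃ₗᵢ[ℝ] EuclideanSpace ℝ (Fin 3)) :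
    IsLocalIsometryOn (f ∘ rot R) (rot R ⁻¹' s) :=
  hf.comp ((isLocalIsometryOn_rot R).mono (hf.isOpen.preimage (isometry_rot R).continuous)
    (Set.subset_univ _)) fun _ h => h

/-- The change of coordinates between two local isometries on open subsets of the sphere is a linear
isometry. -/
theorem exists_rot_transition {f g : UnitSphere → X} {s t : Set UnitSphere}
    (hf : IsLocalIsometryOn f s) (hg : IsLocalIsometryOn g t) {x y : UnitSphere} (hx : x ∈ s)
    (hy : y ∈ t) (hxy : f x = g y) :
    ∃ R : EuclideanSpace ℝ (Fin 3) ≃ₗᵢ[ℝ] EuclideanSpace ℝ (Fin 3), rot R x = y ∧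
      ∀ᶠ w in 𝓝 x, g (rot R w) = f w := by
  obtain ⟨ε, hε, _, h1⟩ := hf.exists_isoOnBall hx
  obtain ⟨δ, hδ, _, h2⟩ := hg.exists_isoOnBall hy
  have h0 := lt_min hε hδ
  obtain ⟨φ, hφx, hφ, h⟩ := (h1.mono (min_le_left ε δ)).exists_transition h0
    (h2.mono (min_le_right ε δ)) hxy
  have hxb := Metric.mem_ball_self h0 (x := x)
  obtain ⟨R, hR⟩ := exists_rot_of_dist_eq Metric.isOpen_ball ⟨x, hxb⟩ hφ.2
  refine ⟨R, by rw [← hR x hxb, hφx], ?_⟩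
  filter_upwards [Metric.ball_mem_nhds x h0] with w hw
  rw [← hR w hw, h w hw]

/-- Analytic continuation for local isometries: on a connected open subset of the sphere, they are
determined by their germ at one point. -/
theorem eqOn_of_eventuallyEq {f g : UnitSphere → X} {K : Set UnitSphere}
    (hK : IsPreconnected K) (hf : IsLocalIsometryOn f K) (hg : IsLocalIsometryOn g K)
    {z : UnitSphere} (hz : z ∈ K) (h : f =ᶠ[𝓝 z] g) : Set.EqOn f g K := by
  have hsub : K ⊆ {w | f =ᶠ[𝓝 w] g} := by
    refine hK.subset_of_closure_inter_subset ?_ ⟨z, hz, h⟩ ?_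
    · rw [isOpen_iff_mem_nhds]
      exact fun w hw => eventually_eventually_nhds.2 hw
    · rintro w ⟨hw, hwK⟩
      have hw' := mem_closure_iff_frequently.1 hw
      have heq : f w = g w := by
        by_contra hne
        have h1 : ∀ᶠ u in 𝓝 w, 0 < dist (f u) (g u) :=
          ((hf.continuousAt hwK).dist (hg.continuousAt hwK)).eventually
            (lt_mem_nhds (dist_pos.2 hne))
        obtain ⟨u, hu, hu'⟩ := (hw'.and_eventually h1).exists
        rw [hu.self_of_nhds, dist_self] at hu'
        exact lt_irrefl _ hu'
      obtain ⟨R, hR, hRe⟩ := exists_rot_transition hf hg hwK hwK heq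
      obtain ⟨V, hV, hinj⟩ := hg.exists_mem_nhds_injOn hwK
      have hR1 : ∀ᶠ u in 𝓝 w, rot R u ∈ V :=
        (isometry_rot R).continuous.continuousAt.eventually (by rw [hR]; exact hV)
      obtain ⟨u, hu, hu1, hu2, hu3⟩ := (hw'.and_eventually
        (hRe.eventually_nhds.and (hR1.eventually_nhds.and (eventually_eventually_nhds.2 hV)))).exists
      have hid : ∀ᶠ v in 𝓝 u, rot R v = v := by
        filter_upwards [hu, hu1, hu2, hu3] with v h1 h2 h3 h4
        exact hinj h3 h4 (by rw [h2, h1])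
      change f =ᶠ[𝓝 w] g
      filter_upwards [hRe] with v hv
      rw [← hv, rot_eq_self_of_eventually hid]
  exact fun w hw => (hsub hw).self_of_nhds

/-- If a function is, near each point of a connected set, the distance to some point of the sphere,
then it is the distance to one and the same point on the whole set. -/
theorem exists_dist_eq_of_locally {ρ : UnitSphere → ℝ} {K : Set UnitSphere}
    (hK : IsPreconnected K) (hne : K.Nonempty)
    (h : ∀ z ∈ K, ∃ c, ∀ᶠ w in 𝓝 z, ρ w = dist w c) : ∃ c, ∀ w ∈ K, ρ w = dist w c := by
  obtain ⟨z, hz⟩ := hne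
  obtain ⟨c, hc⟩ := h z hz
  have hsub : K ⊆ {w | ∀ᶠ u in 𝓝 w, ρ u = dist u c} := by
    refine hK.subset_of_closure_inter_subset ?_ ⟨z, hz, hc⟩ ?_
    · rw [isOpen_iff_mem_nhds]
      exact fun w hw => eventually_eventually_nhds.2 hw
    · rintro w ⟨hw, hwK⟩
      obtain ⟨c', hc'⟩ := h w hwK
      obtain ⟨u, hu, hu'⟩ :=
        ((mem_closure_iff_frequently.1 hw).and_eventually hc'.eventually_nhds).exists
      have : c = c' := eq_of_eventually_dist_eq (z := u) (by
        filter_upwards [hu, hu'] with v h1 h2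
        rw [← h1, ← h2])
      rw [this]
      exact hc'
  exact ⟨c, fun w hw => (hsub hw).self_of_nhds⟩

/-- A local isometry does not increase the distance of points which are joined by a segment. -/
theorem dist_le_of_isLocalIsometryOn {f : UnitSphere → X} {K : Set UnitSphere}
    (hf : IsLocalIsometryOn f K) {z w : UnitSphere} (hzw : dist z w < Real.pi)
    (hK : ∀ u, Between z u w → u ∈ K) : dist (f z) (f w) ≤ dist z w := by
  obtain ⟨γ, h0, h1, hb, hγ⟩ := exists_geodesic hzw
  set l := dist z w with hl
  have hl0 : 0 ≤ l := dist_nonneg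
  have hcγ : ContinuousOn γ (Set.Icc 0 l) := by
    refine (LipschitzOnWith.of_dist_le_mul (K := 1) fun s hs t ht => ?_).continuousOn
    rw [hγ s hs t ht, NNReal.coe_one, one_mul, Real.dist_eq]
  have hcf : ContinuousOn (f ∘ γ) (Set.Icc 0 l) := fun s hs =>
    (hf.continuousAt (hK _ (hb s hs))).comp_continuousWithinAt (hcγ s hs)
  have hsub : Set.Icc 0 l ⊆ {s | dist (f z) (f (γ s)) ≤ s} := by
    refine IsClosed.Icc_subset_of_forall_mem_nhdsWithin ?_ (by simp [h0]) ?_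
    · have hc : ContinuousOn (fun s => dist (f z) (f (γ s)) - s) (Set.Icc 0 l) :=
        (continuous_dist.comp_continuousOn (continuousOn_const.prodMk hcf)).sub continuousOn_id
      have := hc.preimage_isClosed_of_isClosed isClosed_Icc (isClosed_Iic (a := (0 : ℝ)))
      convert this using 1
      ext s
      simp [and_comm]
    · rintro s ⟨hs, hs0, hs1⟩
      obtain ⟨ε, hε, _, h2⟩ := hf.exists_isoOnBall (hK _ (hb s ⟨hs0, hs1.le⟩))
      have : Set.Ioo s (min l (s + ε)) ∈ 𝓝[>] s :=
        Ioo_mem_nhdsGT (lt_min hs1 (by linarith))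
      filter_upwards [this] with t ht
      have ht1 : t ≤ l := (ht.2.trans_le (min_le_left _ _)).le
      have ht2 : t < s + ε := ht.2.trans_le (min_le_right _ _)
      have h3 := hγ t ⟨hs0.trans ht.1.le, ht1⟩ s ⟨hs0, hs1.le⟩
      rw [abs_of_pos (by linarith [ht.1])] at h3
      have h4 := h2.dist_center (y := γ t) (by rw [Metric.mem_ball, h3]; linarith)
      have h5 := dist_triangle (f z) (f (γ s)) (f (γ t))
      rw [dist_comm (f (γ s)), h4, h3] at h5
      have hs' : dist (f z) (f (γ s)) ≤ s := hs
      change dist (f z) (f (γ t)) ≤ t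
      linarith
  have := hsub ⟨hl0, le_rfl⟩
  rw [Set.mem_ofPred_eq, h1] at this
  exact this

end UnitSphere

end LocalIsometry

/-! ### Charts of the cone spheres -/

section ConeCharts

open Filter Topology UnitSphere

/-- The point of `𝕊²_α` with colatitude `a` and longitude `t`. -/
noncomputable def polar (α a t : ℝ) (ha : a ∈ Set.Icc 0 Real.pi) : ConeSphere α :=
  SeparationQuotient.mk ⟨a, (t : AddCircle α), ha⟩

theorem exists_eq_polar {α : ℝ} (x : ConeSphere α) : ∃ a t ha, x = polar α a t ha := by
  obtain ⟨⟨a, l, ha⟩, rfl⟩ := SeparationQuotient.surjective_mk x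
  obtain ⟨t, rfl⟩ := QuotientAddGroup.mk_surjective l
  exact ⟨a, t, ha, rfl⟩

theorem dist_polar {α a b s t : ℝ} (ha : a ∈ Set.Icc 0 Real.pi) (hb : b ∈ Set.Icc 0 Real.pi) :
    dist (polar α a s ha) (polar α b t hb) =
      sphericalSide a b (min ‖((s - t : ℝ) : AddCircle α)‖ Real.pi) := by
  rw [polar, polar, SeparationQuotient.dist_mk, AddCircle.coe_sub, ← dist_eq_norm]
  rfl

theorem northPole_eq_polar (α : ℝ) : northPole α = polar α 0 0 (Set.left_mem_Icc.2 Real.pi_pos.le) := rfl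

theorem dist_polar_northPole {α a t : ℝ} (ha : a ∈ Set.Icc 0 Real.pi) :
    dist (polar α a t ha) (northPole α) = a := by
  rw [northPole_eq_polar, dist_polar, sphericalSide]
  simp [Real.arccos_cos ha.1 ha.2]

theorem polar_congr {α a b t : ℝ} {ha : a ∈ Set.Icc 0 Real.pi} {hb : b ∈ Set.Icc 0 Real.pi}
    (h : a = b) : polar α a t ha = polar α b t hb := by
  subst h; rfl

theorem coe_eq_of_polar_eq {α a s t : ℝ} (ha : a ∈ Set.Ioo 0 Real.pi)
    {ha' : a ∈ Set.Icc 0 Real.pi} (h : polar α a s ha' = polar α a t ha') :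
    (s : AddCircle α) = (t : AddCircle α) := by
  rw [← dist_eq_zero, dist_polar, sphericalSide, Real.arccos_eq_zero] at h
  set m := min ‖((s - t : ℝ) : AddCircle α)‖ Real.pi with hm
  have hcos : 1 ≤ Real.cos m := by
    have := Real.sin_sq_add_cos_sq a
    have hsin := Real.sin_pos_of_mem_Ioo ha
    have h2 : 0 < Real.sin a * Real.sin a := by positivity
    by_contra! hlt
    nlinarith
  have hm1 : m = 0 := by
    rcases (le_min (norm_nonneg _) Real.pi_pos.le : 0 ≤ m).eq_or_lt with h | h
    · exact h.symm
    · have := Real.cos_lt_cos_of_nonneg_of_le_pi le_rfl (min_le_right _ _) h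
      rw [Real.cos_zero] at this
      linarith
  have hn : ‖((s - t : ℝ) : AddCircle α)‖ = 0 := by
    rcases min_choice ‖((s - t : ℝ) : AddCircle α)‖ Real.pi with h | h
    · rw [← h, ← hm, hm1]
    · exact absurd (h.symm.trans (hm.symm.trans hm1)) Real.pi_pos.ne'
  rwa [norm_eq_zero, AddCircle.coe_sub, sub_eq_zero] at hn

theorem continuous_polar {α a : ℝ} (ha : a ∈ Set.Icc 0 Real.pi) :
    Continuous fun t => polar α a t ha := by
  rw [continuous_iff_continuousAt]
  intro t
  have hc : Continuous fun s : ℝ =>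
      sphericalSide a a (min ‖((s - t : ℝ) : AddCircle α)‖ Real.pi) := by
    have : Continuous fun s : ℝ => ((s - t : ℝ) : AddCircle α) :=
      (AddCircle.continuous_mk' α).comp (continuous_id.sub continuous_const)
    unfold sphericalSide
    exact Real.continuous_arccos.comp (continuous_const.add
      (continuous_const.mul (Real.continuous_cos.comp (this.norm.min continuous_const))))
  have h := hc.tendsto t
  rw [ContinuousAt, tendsto_iff_dist_tendsto_zero]
  simp only [dist_polar]
  rwa [← dist_polar ha ha, dist_self] at h

/-- The point of `𝕊²` with colatitude `a` and longitude `t`. -/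
noncomputable def sph (a t : ℝ) : UnitSphere := ⟨sphVec a t, norm_sphVec a t⟩

theorem dist_sph (a b s t : ℝ) : dist (sph a s) (sph b t) = sphericalSide a b (t - s) :=
  angle_sphVec a b s t

/-- The horizontal part of a point of the sphere, as a complex number. -/
noncomputable def horiz (z : UnitSphere) : ℂ := ⟨z.vec 0, z.vec 1⟩

theorem horiz_sph (a t : ℝ) :
    horiz (sph a t) = (Real.sin a : ℝ) * (Complex.cos t + Complex.sin t * Complex.I) := by
  apply Complex.ext <;> simp [horiz, sph, sphVec, Complex.cos_ofReal_re, Complex.sin_ofReal_re,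
    Complex.cos_ofReal_im, Complex.sin_ofReal_im]

theorem continuous_horiz : Continuous horiz := by
  have h : horiz = fun z => ((z.vec 0 : ℝ) : ℂ) + ((z.vec 1 : ℝ) : ℂ) * Complex.I := by
    funext z
    apply Complex.ext <;> simp [horiz]
  have hv := continuous_vec
  rw [h]
  fun_prop

/-- The distance of a point of the sphere to the pole. -/
noncomputable def colat (z : UnitSphere) : ℝ := Real.arccos (z.vec 2)

theorem colat_mem (z : UnitSphere) : colat z ∈ Set.Icc 0 Real.pi :=
  ⟨Real.arccos_nonneg _, Real.arccos_le_pi _⟩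

theorem inner_sph_zero (z : UnitSphere) : inner ℝ z.vec (sph 0 0).vec = z.vec 2 := by
  simp [sph, sphVec, PiLp.inner_apply, Fin.sum_univ_three]

theorem dist_sph_zero (z : UnitSphere) : dist z (sph 0 0) = colat z := by
  rw [dist_eq_arccos, inner_sph_zero, colat]

theorem sum_sq_coord (z : UnitSphere) : z.vec 0 ^ 2 + z.vec 1 ^ 2 + z.vec 2 ^ 2 = 1 := by
  have h := z.norm_vec
  rw [EuclideanSpace.norm_eq, Real.sqrt_eq_one] at h
  simpa [Fin.sum_univ_three] using h

theorem cos_colat (z : UnitSphere) : Real.cos (colat z) = z.vec 2 := by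
  have := sum_sq_coord z
  exact Real.cos_arccos (by nlinarith [sq_nonneg (z.vec 0), sq_nonneg (z.vec 1)])
    (by nlinarith [sq_nonneg (z.vec 0), sq_nonneg (z.vec 1)])

theorem sin_colat (z : UnitSphere) : Real.sin (colat z) = ‖horiz z‖ := by
  rw [colat, Real.sin_arccos, Complex.norm_def, Complex.normSq_apply, ← sum_sq_coord z, horiz]
  congr 1
  ring

theorem eq_sph (z : UnitSphere) : z = sph (colat z) (horiz z).arg := by
  ext1
  ext i
  fin_cases i
  · simp [sph, sphVec, sin_colat, Complex.norm_mul_cos_arg]; rfl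
  · simp [sph, sphVec, sin_colat, Complex.norm_mul_sin_arg]; rfl
  · simp [sph, sphVec, cos_colat]

theorem colat_sph {a : ℝ} (t : ℝ) (ha : a ∈ Set.Icc 0 Real.pi) : colat (sph a t) = a := by
  simp [colat, sph, sphVec, Real.arccos_cos ha.1 ha.2]

theorem arg_horiz_sph {a t : ℝ} (ha : a ∈ Set.Ioo 0 Real.pi) (ht : t ∈ Set.Ioc (-Real.pi) Real.pi) :
    (horiz (sph a t)).arg = t := by
  rw [horiz_sph, Complex.arg_mul_cos_add_sin_mul_I (Real.sin_pos_of_mem_Ioo ha) ht]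

/-- The map `𝕊² → 𝕊²_α` which preserves the colatitude and sends the longitude `s ∈ (-π, π]` to
`t₀ + s`. -/
noncomputable def coneChart (α t₀ : ℝ) (z : UnitSphere) : ConeSphere α :=
  polar α (colat z) (t₀ + (horiz z).arg) (colat_mem z)

theorem dist_coneChart_northPole (α t₀ : ℝ) (z : UnitSphere) :
    dist (coneChart α t₀ z) (northPole α) = dist z (sph 0 0) := by
  rw [coneChart, dist_polar_northPole, dist_sph_zero]

theorem coneChart_sph {α t₀ a t : ℝ} (ha : a ∈ Set.Ioo 0 Real.pi)
    (ht : t ∈ Set.Ioc (-Real.pi) Real.pi) :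
    coneChart α t₀ (sph a t) = polar α a (t₀ + t) ⟨ha.1.le, ha.2.le⟩ := by
  rw [coneChart, arg_horiz_sph ha ht]
  exact polar_congr (colat_sph t ⟨ha.1.le, ha.2.le⟩)

/-- The sphere without the meridian of longitude `π` (and the poles). -/
def slitSphere : Set UnitSphere := {z | horiz z ∈ Complex.slitPlane}

theorem isOpen_slitSphere : IsOpen slitSphere :=
  Complex.isOpen_slitPlane.preimage continuous_horiz

theorem sph_mem_slitSphere {a : ℝ} (ha : a ∈ Set.Ioo 0 Real.pi) : sph a 0 ∈ slitSphere := by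
  refine Or.inl ?_
  simpa [horiz, sph, sphVec] using Real.sin_pos_of_mem_Ioo ha

theorem coneChart_isLocalIsometryOn {α : ℝ} (hα : 0 < α) (t₀ : ℝ) :
    IsLocalIsometryOn (coneChart α t₀) slitSphere := by
  intro z hz
  set δ := min (α / 4) (Real.pi / 2) with hδ
  have hδ0 : 0 < δ := lt_min (by positivity) (by positivity)
  have hδ1 : δ ≤ α / 4 := min_le_left _ _
  have hδ2 : δ ≤ Real.pi / 2 := min_le_right _ _
  have hc : ContinuousAt (fun w => (horiz w).arg) z :=
    (Complex.continuousAt_arg hz).comp continuous_horiz.continuousAt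
  obtain ⟨ε, hε, hball⟩ := Metric.eventually_nhds_iff_ball.1
    ((hc.eventually (Metric.ball_mem_nhds _ hδ0)).and (isOpen_slitSphere.mem_nhds hz))
  have hiso : ∀ w ∈ Metric.ball z ε, ∀ w' ∈ Metric.ball z ε,
      dist (coneChart α t₀ w) (coneChart α t₀ w') = dist w w' := by
    intro w hw w' hw'
    have h1 := (hball w hw).1
    have h2 := (hball w' hw').1
    rw [Real.dist_eq, abs_lt] at h1 h2
    have h3 : |(horiz w).arg - (horiz w').arg| ≤ 2 * δ := by
      rw [abs_le]; constructor <;> linarith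
    conv_rhs => rw [eq_sph w, eq_sph w', dist_sph]
    rw [coneChart, coneChart, dist_polar, add_sub_add_left_eq_sub,
      (AddCircle.norm_coe_eq_abs_iff α hα.ne').2 (by rw [abs_of_pos hα]; linarith),
      min_eq_left (by linarith), sphericalSide, sphericalSide, Real.cos_abs,
      ← neg_sub (horiz w').arg (horiz w).arg, Real.cos_neg]
  refine ⟨ε, hε, fun w hw => (hball w hw).2, Set.Subset.antisymm ?_ ?_, hiso⟩
  · rintro _ ⟨w, hw, rfl⟩
    rw [Metric.mem_ball, hiso w hw z (Metric.mem_ball_self hε)]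
    exact hw
  · intro y hy
    obtain ⟨b, t, hb, rfl⟩ := exists_eq_polar y
    set s := (horiz z).arg with hs
    set x := t - (t₀ + s) with hx
    set φ := x - round (α⁻¹ * x) * α with hφ
    have hnorm : ‖((t - (t₀ + s) : ℝ) : AddCircle α)‖ = |φ| := AddCircle.norm_eq α
    have hφx : ((t₀ + s + φ : ℝ) : AddCircle α) = (t : AddCircle α) := by
      have : t₀ + s + φ = t - (round (α⁻¹ * x) : ℤ) • α := by
        rw [hφ, hx, zsmul_eq_mul]; ring
      rw [this, AddCircle.coe_sub, AddCircle.coe_zsmul, AddCircle.coe_period, smul_zero, sub_zero]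
    -- `φ` represents the longitude difference with least absolute value; the spherical metric only
    -- sees it truncated at `π`, which is what `ψ` is
    obtain ⟨ψ, hψ, hψcos, hψφ⟩ : ∃ ψ : ℝ, |ψ| ≤ Real.pi ∧
        Real.cos ψ = Real.cos (min |φ| Real.pi) ∧ (|ψ| < Real.pi → ψ = φ) := by
      rcases le_or_gt |φ| Real.pi with h | h
      · exact ⟨φ, h, by rw [min_eq_left h, Real.cos_abs], fun _ => rfl⟩
      · exact ⟨Real.pi, (abs_of_pos Real.pi_pos).le, by rw [min_eq_right h.le],
          fun h => absurd h (by rw [abs_of_pos Real.pi_pos]; exact lt_irrefl _)⟩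
    have hdist : dist (sph b (s + ψ)) z = dist (polar α b t hb) (coneChart α t₀ z) := by
      conv_lhs => rw [eq_sph z, dist_sph]
      rw [coneChart, dist_polar, hnorm, sphericalSide, sphericalSide, ← hψcos, ← hs,
        sub_add_cancel_left, Real.cos_neg]
    have hw : sph b (s + ψ) ∈ Metric.ball z ε := by
      rw [Metric.mem_ball, hdist]; exact hy
    have hsin : 0 < Real.sin b := by
      refine (Real.sin_nonneg_of_mem_Icc hb).lt_of_ne fun h => ?_
      have h1 := Complex.slitPlane_ne_zero (hball _ hw).2
      rw [horiz_sph, ← h] at h1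
      simp at h1
    have hang : ((horiz (sph b (s + ψ))).arg : Real.Angle) = ((s + ψ : ℝ) : Real.Angle) := by
      rw [horiz_sph]
      exact_mod_cast Complex.arg_mul_cos_add_sin_mul_I_coe_angle hsin ((s + ψ : ℝ) : Real.Angle)
    have h1 := (hball _ hw).1
    rw [Real.dist_eq, abs_lt] at h1
    rw [abs_le] at hψ
    obtain ⟨k, hk⟩ := Real.Angle.angle_eq_iff_two_pi_dvd_sub.1 hang
    have hpi := Real.pi_pos
    have hk0 : k = 0 := by
      have h2 : -1 < (k : ℝ) := by
        by_contra! h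
        nlinarith
      have h3 : (k : ℝ) < 1 := by
        by_contra! h
        nlinarith
      have h2' : -1 < k := by exact_mod_cast h2
      have h3' : k < 1 := by exact_mod_cast h3
      omega
    rw [hk0, Int.cast_zero, mul_zero, sub_eq_zero] at hk
    have hψ' : ψ = φ := hψφ (by rw [abs_lt]; constructor <;> linarith)
    refine ⟨_, hw, ?_⟩
    rw [coneChart, hk, ← add_assoc, hψ', polar, polar, hφx]
    congr 2
    exact colat_sph _ hb

theorem cos_min_norm_two_pi (x : ℝ) :
    Real.cos (min ‖(x : AddCircle (2 * Real.pi))‖ Real.pi) = Real.cos x := by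
  have h : ‖(x : AddCircle (2 * Real.pi))‖ ≤ Real.pi := by
    have := AddCircle.norm_le_half_period (2 * Real.pi) (x := (x : AddCircle (2 * Real.pi)))
      Real.two_pi_pos.ne'
    rwa [abs_of_pos Real.two_pi_pos, mul_div_cancel_left₀ _ two_ne_zero] at this
  rw [min_eq_left h, AddCircle.norm_eq, Real.cos_abs, Real.cos_sub_int_mul_two_pi]

/-- The point of `𝕊²_{2π}` with polar coordinates `(a, t)` corresponds to that of `𝕊²`. -/
theorem dist_coneChart_two_pi (t₀ : ℝ) {b t : ℝ} (hb : b ∈ Set.Icc 0 Real.pi) (z : UnitSphere) :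
    dist (coneChart (2 * Real.pi) t₀ z) (polar (2 * Real.pi) b t hb) = dist z (sph b (t - t₀)) := by
  conv_rhs => rw [eq_sph z, dist_sph]
  rw [coneChart, dist_polar, sphericalSide, sphericalSide, cos_min_norm_two_pi,
    show t - t₀ - (horiz z).arg = -(t₀ + (horiz z).arg - t) by ring, Real.cos_neg]

theorem coneChart_two_pi_surjective (t₀ : ℝ) :
    Function.Surjective (coneChart (2 * Real.pi) t₀) := by
  intro y
  obtain ⟨b, t, hb, rfl⟩ := exists_eq_polar y
  refine ⟨sph b (t - t₀), ?_⟩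
  rw [← dist_eq_zero, dist_coneChart_two_pi, dist_self]

theorem coneChart_two_pi_isometry (t₀ : ℝ) : Isometry (coneChart (2 * Real.pi) t₀) := by
  refine Isometry.of_dist_eq fun z w => ?_
  conv_rhs => rw [eq_sph w]
  conv_lhs => rw [coneChart.eq_1 _ _ w]
  rw [dist_coneChart_two_pi, add_sub_cancel_left]

theorem coneChart_two_pi_isLocalIsometryOn (t₀ : ℝ) :
    IsLocalIsometryOn (coneChart (2 * Real.pi) t₀) Set.univ := by
  refine fun z _ => ⟨1, one_pos, Set.subset_univ _, Set.Subset.antisymm ?_ ?_,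
    fun w _ w' _ => (coneChart_two_pi_isometry t₀).dist_eq w w'⟩
  · rintro _ ⟨w, hw, rfl⟩
    rw [Metric.mem_ball, (coneChart_two_pi_isometry t₀).dist_eq]
    exact hw
  · intro y hy
    obtain ⟨w, rfl⟩ := coneChart_two_pi_surjective t₀ y
    rw [Metric.mem_ball, (coneChart_two_pi_isometry t₀).dist_eq] at hy
    exact ⟨w, hy, rfl⟩

/-- Two points of the same image under a chart remain so if both are moved towards the pole. -/
theorem coneChart_radial {α t₀ : ℝ} {z z' : UnitSphere} (hne : z ≠ z')
    (h : coneChart α t₀ z = coneChart α t₀ z') (h0 : 0 < dist z (sph 0 0)) {ε : ℝ} (hε : 0 < ε) :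
    ∃ w w', dist w z < ε ∧ dist w' z' < ε ∧ dist w (sph 0 0) < dist z (sph 0 0) ∧
      dist w' (sph 0 0) < dist z' (sph 0 0) ∧ coneChart α t₀ w = coneChart α t₀ w' := by
  have hcol : colat z = colat z' := by
    rw [← dist_sph_zero, ← dist_sph_zero, ← dist_coneChart_northPole α t₀, h,
      dist_coneChart_northPole]
  set a := colat z with ha
  have ham : a ∈ Set.Icc 0 Real.pi := colat_mem z
  rw [dist_sph_zero, ← ha] at h0
  have hapi : a < Real.pi := by
    refine ham.2.lt_of_ne fun hpi => hne ?_
    rw [eq_sph z, eq_sph z', ← hcol, ← ha, hpi, ← dist_eq_zero, dist_sph, sphericalSide]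
    simp
  have hlon : ((t₀ + (horiz z).arg : ℝ) : AddCircle α) = ((t₀ + (horiz z').arg : ℝ)) := by
    refine coe_eq_of_polar_eq ⟨h0, hapi⟩ (h.trans ?_)
    exact polar_congr hcol.symm
  set b := a - min (ε / 2) (a / 2) with hb
  have hm := min_le_left (ε / 2) (a / 2)
  have hm' := min_le_right (ε / 2) (a / 2)
  have hm0 : 0 < min (ε / 2) (a / 2) := lt_min (by positivity) (by positivity)
  have hbm : b ∈ Set.Ioo 0 Real.pi := ⟨by linarith, by linarith⟩
  have hbm' : b ∈ Set.Icc 0 Real.pi := ⟨hbm.1.le, hbm.2.le⟩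
  have hd : ∀ t, dist (sph b t) (sph a t) = a - b := by
    intro t
    rw [dist_sph, sphericalSide, sub_self, Real.cos_zero, mul_one, ← Real.cos_sub, ← Real.cos_neg,
      Real.arccos_cos (by linarith) (by linarith)]
    ring
  have hsa : z = sph a (horiz z).arg := eq_sph z
  have hsa' : z' = sph a (horiz z').arg := by rw [hcol]; exact eq_sph z'
  refine ⟨sph b (horiz z).arg, sph b (horiz z').arg, ?_, ?_, ?_, ?_, ?_⟩
  · rw [(congrArg (dist (sph b _)) hsa).trans (hd _)]; linarith
  · rw [(congrArg (dist (sph b _)) hsa').trans (hd _)]; linarith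
  · rw [dist_sph_zero, dist_sph_zero, colat_sph _ hbm']; linarith
  · rw [dist_sph_zero, dist_sph_zero, colat_sph _ hbm', ← hcol]; linarith
  · rw [coneChart_sph hbm (Complex.arg_mem_Ioc _), coneChart_sph hbm (Complex.arg_mem_Ioc _)]
    simp only [polar, hlon]

end ConeCharts

/-! ### Charts with a base point, and the development of the pole -/

section SlitChart

open Filter Topology UnitSphere

/-- `E : 𝕊² → 𝕊²_α` preserves the distance to the pole (where `c` is the pole in `𝕊²`) and is a
local isometry on an open set `Ω` which contains the base point `z`. If `α = 2π`, then `Ω` may be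
everything; otherwise `Ω` is the complement of the slit which continues the geodesic from `z` to `c`
beyond `c`. -/
structure IsSlitChart (α : ℝ) (z c : UnitSphere) (Ω : Set UnitSphere)
    (E : UnitSphere → ConeSphere α) : Prop where
  pole : ∀ w, dist (E w) (northPole α) = dist w c
  isLocalIsometryOn : IsLocalIsometryOn E Ω
  base : z ∈ Ω
  star : ∀ w ∈ Ω, ∀ u, Between z u w → u ∈ Ω
  back : ∀ w ∉ Ω, 0 < inner ℝ w.vec c.vec → Between z c w
  regular_or : (α = 2 * Real.pi ∧ Ω = Set.univ ∧ Function.Surjective E) ∨ c ∉ Ω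
  radial : ∀ w w', w ≠ w' → E w = E w' → 0 < dist w c → ∀ ε > 0, ∃ u u', dist u w < ε ∧
    dist u' w' < ε ∧ dist u c < dist w c ∧ dist u' c < dist w' c ∧ E u = E u'

theorem IsSlitChart.apply_center {α : ℝ} {z c : UnitSphere} {Ω : Set UnitSphere}
    {E : UnitSphere → ConeSphere α} (h : IsSlitChart α z c Ω E) : E c = northPole α := by
  rw [← dist_eq_zero, h.pole, dist_self]

theorem IsSlitChart.continuousAt_center {α : ℝ} {z c : UnitSphere} {Ω : Set UnitSphere}
    {E : UnitSphere → ConeSphere α} (h : IsSlitChart α z c Ω E) : ContinuousAt E c := by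
  rw [ContinuousAt, h.apply_center, tendsto_iff_dist_tendsto_zero]
  simp only [h.pole]
  exact tendsto_iff_dist_tendsto_zero.1 tendsto_id

theorem IsSlitChart.comp_rot {α : ℝ} {z c : UnitSphere} {Ω : Set UnitSphere}
    {E : UnitSphere → ConeSphere α} (h : IsSlitChart α z c Ω E)
    (R : EuclideanSpace ℝ (Fin 3) ≃ₗᵢ[ℝ] EuclideanSpace ℝ (Fin 3)) :
    IsSlitChart α (rot R.symm z) (rot R.symm c) (rot R ⁻¹' Ω) (E ∘ rot R) where
  pole w := by rw [Function.comp, h.pole, dist_rot_left]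
  isLocalIsometryOn := isLocalIsometryOn_comp_rot h.isLocalIsometryOn R
  base := by rw [Set.mem_preimage, rot_rot_symm]; exact h.base
  star w hw u hu := h.star _ hw _ (by simpa using hu.rot R)
  back w hw hpos := by
    have hpos' : 0 < inner ℝ (rot R w).vec c.vec := by
      rw [inner_vec, dist_rot_left, ← inner_vec]; exact hpos
    simpa using (h.back _ hw hpos').rot R.symm
  regular_or := by
    rcases h.regular_or with ⟨h1, h2, h3⟩ | h1
    · refine Or.inl ⟨h1, by rw [h2, Set.preimage_univ], h3.comp fun w => ⟨_, rot_rot_symm R w⟩⟩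
    · right
      rwa [Set.mem_preimage, rot_rot_symm]
  radial w w' hne hE h0 ε hε := by
    obtain ⟨u, u', h1, h2, h3, h4, h5⟩ := h.radial (rot R w) (rot R w')
      ((isometry_rot R).injective.ne hne) hE (by rwa [dist_rot_left]) ε hε
    refine ⟨rot R.symm u, rot R.symm u', ?_, ?_, ?_, ?_, ?_⟩
    · rwa [← dist_rot R, rot_rot_symm]
    · rwa [← dist_rot R, rot_rot_symm]
    · rwa [dist_rot, ← dist_rot_left]
    · rwa [dist_rot, ← dist_rot_left]
    · simpa using h5

theorem isSlitChart_coneChart {α : ℝ} (hα : 0 < α) (t₀ : ℝ) {a : ℝ}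
    (ha : a ∈ Set.Ioo 0 (Real.pi / 2)) :
    IsSlitChart α (sph a 0) (sph 0 0) slitSphere (coneChart α t₀) where
  pole := dist_coneChart_northPole α t₀
  isLocalIsometryOn := coneChart_isLocalIsometryOn hα t₀
  base := sph_mem_slitSphere ⟨ha.1, by linarith [ha.2, Real.pi_pos]⟩
  star w hw u hu := by
    obtain ⟨p, q, hp, hq, h⟩ := hu
    have hsin : 0 < Real.sin a := Real.sin_pos_of_pos_of_lt_pi ha.1 (by linarith [ha.2, Real.pi_pos])
    have h0 : u.vec 0 = p * Real.sin a + q * w.vec 0 := by simp [h, sph, sphVec]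
    have h1 : u.vec 1 = q * w.vec 1 := by simp [h, sph, sphVec]
    rw [slitSphere, Set.mem_ofPred_eq, Complex.mem_slitPlane_iff, horiz] at hw ⊢
    simp only at hw ⊢
    rcases hq.eq_or_lt with rfl | hq
    · left
      have := Between.one_le hp le_rfl h
      rw [h0, zero_mul, add_zero]
      exact mul_pos (by linarith) hsin
    · rcases hw with hw | hw
      · left
        rw [h0]
        positivity
      · right
        rw [h1]
        exact mul_ne_zero hq.ne' hw
  back w hw hpos := by
    rw [inner_sph_zero] at hpos
    rw [slitSphere, Set.mem_ofPred_eq, Complex.mem_slitPlane_iff, horiz] at hw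
    simp only [not_or, not_lt, not_not] at hw
    have hsin : 0 < Real.sin a := Real.sin_pos_of_pos_of_lt_pi ha.1 (by linarith [ha.2, Real.pi_pos])
    have hcos : 0 < Real.cos a := Real.cos_pos_of_mem_Ioo ⟨by linarith [ha.1, Real.pi_pos], ha.2⟩
    have hd : 0 < Real.sin a * w.vec 2 - w.vec 0 * Real.cos a := by
      nlinarith [mul_pos hsin hpos, mul_nonneg (neg_nonneg.2 hw.1) hcos.le]
    refine ⟨-w.vec 0 / (Real.sin a * w.vec 2 - w.vec 0 * Real.cos a),
      Real.sin a / (Real.sin a * w.vec 2 - w.vec 0 * Real.cos a),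
      div_nonneg (neg_nonneg.2 hw.1) hd.le, by positivity, ?_⟩
    ext i
    fin_cases i
    · simp [sph, sphVec]; ring
    · simp [sph, sphVec, hw.2]
    · simp [sph, sphVec]
      field_simp
      ring
  regular_or := by
    right
    simp [slitSphere, horiz, sph, sphVec, Complex.mem_slitPlane_iff]
  radial w w' hne hE h0 ε hε := coneChart_radial hne hE h0 hε

theorem isSlitChart_coneChart_two_pi {α : ℝ} (hα : α = 2 * Real.pi) (t₀ : ℝ) (z : UnitSphere) :
    IsSlitChart α z (sph 0 0) Set.univ (coneChart α t₀) where
  pole := dist_coneChart_northPole α t₀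
  isLocalIsometryOn := by subst hα; exact coneChart_two_pi_isLocalIsometryOn t₀
  base := Set.mem_univ _
  star _ _ _ _ := Set.mem_univ _
  back _ h _ := absurd (Set.mem_univ _) h
  regular_or := Or.inl ⟨hα, rfl, by subst hα; exact coneChart_two_pi_surjective t₀⟩
  radial w w' hne hE h0 ε hε := coneChart_radial hne hE h0 hε

theorem not_between_sph {a b : ℝ} (ha : a ∈ Set.Ioo 0 Real.pi) (hb : b ∈ Set.Ioo 0 Real.pi) :
    ¬ Between (sph a 0) (sph 0 0) (sph b 0) := by
  rintro ⟨p, q, hp, hq, h⟩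
  have h0 := congrArg (fun v => v 0) h
  have h2 := congrArg (fun v => v 2) h
  simp [sph, sphVec] at h0 h2
  have hsa := Real.sin_pos_of_mem_Ioo ha
  have hsb := Real.sin_pos_of_mem_Ioo hb
  have h3 := mul_nonneg hp hsa.le
  have h4 := mul_nonneg hq hsb.le
  have h5 : p = 0 := by
    rcases mul_eq_zero.1 (show p * Real.sin a = 0 by linarith) with h | h
    · exact h
    · exact absurd h hsa.ne'
  have h6 : q = 0 := by
    rcases mul_eq_zero.1 (show q * Real.sin b = 0 by linarith) with h | h
    · exact h
    · exact absurd h hsb.ne'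
  rw [h5, h6] at h2
  norm_num at h2

/-- Each point of the open upper half of `𝕊²_α`, except for the pole, is in the image of a slit
chart. The base point of the chart may be moved along the meridian of this point. -/
theorem exists_isSlitChart {α : ℝ} (hα : 0 < α) {x : ConeSphere α}
    (hx : dist x (northPole α) ∈ Set.Ioo 0 (Real.pi / 2)) :
    ∃ (c : UnitSphere) (Ω : Set UnitSphere) (E : UnitSphere → ConeSphere α) (w : UnitSphere),
      IsSlitChart α w c Ω E ∧ E w = x ∧ ∀ a ∈ Set.Ioo 0 (Real.pi / 2), ∃ z,
        IsSlitChart α z c Ω E ∧ dist z c = a ∧ ¬ Between z c w := by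
  obtain ⟨b, t, hb, rfl⟩ := exists_eq_polar x
  rw [dist_polar_northPole] at hx
  have hpi := Real.pi_pos
  have h : ∀ a ∈ Set.Ioo 0 (Real.pi / 2), a ∈ Set.Ioo 0 Real.pi := fun a ha =>
    ⟨ha.1, by linarith [ha.2]⟩
  refine ⟨sph 0 0, slitSphere, coneChart α t, sph b 0, isSlitChart_coneChart hα t hx, ?_,
    fun a ha => ⟨sph a 0, isSlitChart_coneChart hα t ha, ?_, not_between_sph (h a ha) (h b hx)⟩⟩
  · rw [coneChart_sph (h b hx) ⟨by linarith, hpi.le⟩]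
    simp only [add_zero]
  · rw [dist_sph_zero, colat_sph _ ⟨ha.1.le, (h a ha).2.le⟩]

/-- A point which is not a cone point is the base point of a chart. -/
theorem exists_isSlitChart_of_regular {α : ℝ} (hα : 0 < α) {x : ConeSphere α}
    (hx : dist x (northPole α) < Real.pi / 2) (hreg : x ≠ northPole α ∨ α = 2 * Real.pi) :
    ∃ (z c : UnitSphere) (Ω : Set UnitSphere) (E : UnitSphere → ConeSphere α),
      IsSlitChart α z c Ω E ∧ E z = x ∧ (α = 2 * Real.pi → Ω = Set.univ) := by
  by_cases h : α = 2 * Real.pi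
  · have hs : Function.Surjective (coneChart α 0) := by
      subst h; exact coneChart_two_pi_surjective 0
    obtain ⟨z, hz⟩ := hs x
    exact ⟨z, _, _, _, isSlitChart_coneChart_two_pi h 0 z, hz, fun _ => rfl⟩
  · have hx0 := dist_pos.2 (hreg.resolve_right h)
    obtain ⟨c, Ω, E, w, h1, h2, -⟩ := exists_isSlitChart hα ⟨hx0, hx⟩
    exact ⟨w, c, Ω, E, h1, h2, fun h' => absurd h' h⟩

/-- The development of the pole: along a local isometry from a connected open subset of the sphere
to a cone sphere which avoids the pole, the distance to the pole is the distance to some point of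
the sphere. -/
theorem exists_development_center {α : ℝ} (hα : 0 < α) {ψ : UnitSphere → ConeSphere α}
    {K : Set UnitSphere} (hK : IsPreconnected K) (hne : K.Nonempty) (hψ : IsLocalIsometryOn ψ K)
    (h : ∀ z ∈ K, dist (ψ z) (northPole α) ∈ Set.Ioo 0 (Real.pi / 2)) :
    ∃ c, ∀ z ∈ K, dist (ψ z) (northPole α) = dist z c := by
  refine exists_dist_eq_of_locally hK hne fun z hz => ?_
  obtain ⟨c, Ω, E, w, hE, hw, -⟩ := exists_isSlitChart hα (h z hz)
  obtain ⟨R, -, hR⟩ := exists_rot_transition hψ hE.isLocalIsometryOn hz hE.base hw.symm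
  refine ⟨rot R.symm c, ?_⟩
  filter_upwards [hR] with u hu
  rw [← hu, hE.pole, dist_rot_left]

theorem inner_antipode {z x : UnitSphere} {ρ : ℝ} (hx : dist x z = ρ) :
    ‖(2 * Real.cos ρ) • z.vec - x.vec‖ = 1 := by
  have h : inner ℝ z.vec x.vec = Real.cos ρ := by rw [inner_vec, dist_comm, hx]
  rw [← pow_eq_one_iff_of_nonneg (norm_nonneg _) two_ne_zero, norm_sub_sq_real, norm_smul,
    inner_smul_left, z.norm_vec, x.norm_vec, h]
  simp only [conj_trivial, mul_one, Real.norm_eq_abs, sq_abs]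
  ring

/-- The total angle `2π` characterizes the regular points: only there, each point of a small circle
has exactly one antipodal point on this circle. -/
theorem eq_two_pi_of_isoOnBall {α ε : ℝ} (hα : 0 < α) (hε : 0 < ε) {φ : ConeSphere α → UnitSphere}
    (hφ : IsoOnBall φ (northPole α) ε) : α = 2 * Real.pi := by
  have hpi := Real.pi_pos
  set z := φ (northPole α) with hz
  set ρ := min (ε / 2) (Real.pi / 4) with hρ
  have hρ0 : 0 < ρ := lt_min (by positivity) (by positivity)
  have hρε : ρ < ε := (min_le_left _ _).trans_lt (by linarith)
  have hρπ : ρ ≤ Real.pi / 4 := min_le_right _ _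
  have hm : ρ ∈ Set.Icc 0 Real.pi := ⟨hρ0.le, by linarith⟩
  have hball : ∀ t, polar α ρ t hm ∈ Metric.ball (northPole α) ε := fun t => by
    rw [Metric.mem_ball, dist_polar_northPole]; exact hρε
  have hpole : ∀ t, dist (φ (polar α ρ t hm)) z = ρ := fun t => by
    rw [hz, hφ.dist_center (hball t), dist_polar_northPole]
  have hsin : 0 < Real.sin ρ := Real.sin_pos_of_pos_of_lt_pi hρ0 (by linarith)
  have hsq := Real.sin_sq_add_cos_sq ρ
  -- antipodal points on the circle of radius `ρ`
  have hanti : ∀ t : ℝ, Real.pi ≤ ‖((t : ℝ) : AddCircle α)‖ →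
      dist (polar α ρ t hm) (polar α ρ 0 hm) = 2 * ρ := by
    intro t ht
    rw [dist_polar, sub_zero, min_eq_right ht, sphericalSide, Real.cos_pi]
    rw [show Real.cos ρ * Real.cos ρ + Real.sin ρ * Real.sin ρ * -1 = Real.cos (2 * ρ) by
      rw [Real.cos_two_mul]; linarith]
    exact Real.arccos_cos (by linarith) (by linarith)
  set x := φ (polar α ρ 0 hm) with hx
  have hunique : ∀ y : UnitSphere, dist y z = ρ → dist y x = 2 * ρ →
      y.vec = (2 * Real.cos ρ) • z.vec - x.vec := by
    intro y hy hyx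
    have h1 := inner_antipode (hpole 0)
    have h2 : inner ℝ y.vec ((2 * Real.cos ρ) • z.vec - x.vec) = (1 : ℝ) := by
      rw [inner_sub_right, inner_smul_right, inner_vec, inner_vec, hy, hyx, Real.cos_two_mul]
      ring
    rw [← sub_eq_zero, ← norm_eq_zero, ← sq_eq_zero_iff, norm_sub_sq_real, h2, h1, y.norm_vec]
    norm_num
  rcases lt_trichotomy α (2 * Real.pi) with h | h | h
  · exfalso
    let y : UnitSphere := ⟨_, inner_antipode (hpole 0)⟩
    have hyz : dist y z = ρ := by
      rw [dist_eq_arccos, inner_sub_left, inner_smul_left, inner_self, inner_vec, ← hx, hpole 0]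
      simp only [conj_trivial, mul_one]
      rw [show 2 * Real.cos ρ - Real.cos ρ = Real.cos ρ by ring]
      exact Real.arccos_cos hm.1 hm.2
    have hyx : dist y x = 2 * ρ := by
      rw [dist_eq_arccos, inner_sub_left, inner_smul_left, inner_self, inner_vec, dist_comm, hpole 0]
      simp only [conj_trivial]
      rw [show 2 * Real.cos ρ * Real.cos ρ - 1 = Real.cos (2 * ρ) by rw [Real.cos_two_mul]; ring]
      exact Real.arccos_cos (by linarith) (by linarith)
    obtain ⟨u, hu, huy⟩ := hφ.exists_preimage (y := y) (by rw [Metric.mem_ball, hyz]; exact hρε)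
    obtain ⟨b, t, hb, rfl⟩ := exists_eq_polar u
    have hbρ : b = ρ := by
      rw [← dist_polar_northPole (α := α) (t := t) hb, ← hφ.dist_center hu, huy, hyz]
    subst hbρ
    have hd : dist (polar α ρ t hb) (polar α ρ 0 hm) = 2 * ρ := by
      rw [← hφ.2 _ hu _ (hball 0), huy, hyx]
    have hlt : ‖((t - 0 : ℝ) : AddCircle α)‖ < Real.pi := by
      have := AddCircle.norm_le_half_period α (x := ((t - 0 : ℝ) : AddCircle α)) hα.ne'
      rw [abs_of_pos hα] at this
      linarith
    rw [dist_polar, min_eq_left hlt.le] at hd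
    have hlt' : sphericalSide ρ ρ ‖((t - 0 : ℝ) : AddCircle α)‖ < 2 * ρ := by
      rw [sphericalSide]
      have h1 : Real.cos Real.pi < Real.cos ‖((t - 0 : ℝ) : AddCircle α)‖ :=
        Real.cos_lt_cos_of_nonneg_of_le_pi (norm_nonneg _) le_rfl hlt
      rw [Real.cos_pi] at h1
      have h2 : Real.cos (2 * ρ) < Real.cos ρ * Real.cos ρ +
          Real.sin ρ * Real.sin ρ * Real.cos ‖((t - 0 : ℝ) : AddCircle α)‖ := by
        rw [Real.cos_two_mul]
        nlinarith [mul_pos hsin hsin]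
      have h3 : Real.cos ρ * Real.cos ρ +
          Real.sin ρ * Real.sin ρ * Real.cos ‖((t - 0 : ℝ) : AddCircle α)‖ ≤ 1 := by
        nlinarith [mul_pos hsin hsin, Real.cos_le_one ‖((t - 0 : ℝ) : AddCircle α)‖]
      calc _ < Real.arccos (Real.cos (2 * ρ)) :=
            Real.arccos_lt_arccos (Real.neg_one_le_cos _) h2 h3
        _ = 2 * ρ := Real.arccos_cos (by linarith) (by linarith)
    exact absurd hd hlt'.ne
  · exact h
  · exfalso
    have hn1 : ‖((Real.pi : ℝ) : AddCircle α)‖ = Real.pi := by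
      rw [(AddCircle.norm_coe_eq_abs_iff α hα.ne').2, abs_of_pos hpi]
      rw [abs_of_pos hpi, abs_of_pos hα]; linarith
    have hn2 : ‖((α / 2 : ℝ) : AddCircle α)‖ = α / 2 := by
      rw [(AddCircle.norm_coe_eq_abs_iff α hα.ne').2, abs_of_pos (by positivity)]
      rw [abs_of_pos hα, abs_of_pos (by positivity)]
    have h1 := hunique _ (hpole Real.pi) (by
      rw [hx, hφ.2 _ (hball _) _ (hball _), hanti _ hn1.ge])
    have h2 := hunique _ (hpole (α / 2)) (by
      rw [hx, hφ.2 _ (hball _) _ (hball _), hanti _ (by rw [hn2]; linarith)])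
    have h3 : polar α ρ Real.pi hm = polar α ρ (α / 2) hm :=
      hφ.injOn (hball _) (hball _) (by ext1; rw [h1, h2])
    have hn3 : ‖((Real.pi - α / 2 : ℝ) : AddCircle α)‖ = α / 2 - Real.pi := by
      rw [(AddCircle.norm_coe_eq_abs_iff α hα.ne').2, abs_of_neg (by linarith)]
      · ring
      · rw [abs_of_pos hα, abs_of_neg (by linarith)]; linarith
    rw [← dist_eq_zero, dist_polar, hn3, sphericalSide, Real.arccos_eq_zero] at h3
    have hm0 : 0 < min (α / 2 - Real.pi) Real.pi := lt_min (by linarith) hpi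
    have hc := Real.cos_lt_cos_of_nonneg_of_le_pi le_rfl (min_le_right _ _) hm0
    rw [Real.cos_zero] at hc
    nlinarith [mul_pos hsin hsin]

end SlitChart

/-! ### Developing pairs of double points -/

section Develop

open Filter Topology UnitSphere

theorem UnitSphere.Between.antisymm {z u c : UnitSphere} (hpos : 0 < inner ℝ z.vec c.vec)
    (h1 : Between z u c) (h2 : Between z c u) : u = c := by
  obtain ⟨a, b, ha, hb, h1⟩ := h1
  obtain ⟨p, q, hp, hq, h2⟩ := h2
  rcases eq_or_ne z c with rfl | hne
  · have h3 := congrArg norm h1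
    rw [← add_smul, norm_smul, u.norm_vec, z.norm_vec, Real.norm_of_nonneg (by positivity),
      mul_one] at h3
    ext1
    rw [h1, ← add_smul, ← h3, one_smul]
  · set k := inner ℝ z.vec c.vec with hk
    have hk1 : k < 1 := by
      rw [hk, inner_vec, ← Real.cos_zero]
      exact Real.cos_lt_cos_of_nonneg_of_le_pi le_rfl (dist_le_pi _ _) (dist_pos.2 hne)
    have h3 : (1 - q * b) • c.vec = (p + q * a) • z.vec := by
      rw [h1] at h2
      rw [sub_smul, one_smul]
      nth_rewrite 1 [h2]
      rw [smul_add, smul_smul, smul_smul, add_smul]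
      abel
    have h4 := congrArg (fun v => inner ℝ v c.vec) h3
    have h5 := congrArg (fun v => inner ℝ v z.vec) h3
    simp only [inner_smul_left, inner_self, conj_trivial, real_inner_comm z.vec c.vec, ← hk] at h4 h5
    have hpa : p + q * a = 0 := by
      have : (p + q * a) * (1 - k ^ 2) = 0 := by
        linear_combination (-1 : ℝ) * h5 + k * h4
      rcases mul_eq_zero.1 this with h | h
      · exact h
      · nlinarith
    have hqb : q * b = 1 := by
      rw [hpa, zero_mul] at h4; linarith
    have hqa : q * a = 0 := by nlinarith [mul_nonneg hq ha]
    have hq0 : q ≠ 0 := by rintro rfl; simp at hqb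
    have ha0 : a = 0 := (mul_eq_zero.1 hqa).resolve_left hq0
    rw [ha0, zero_smul, zero_add] at h1
    have h6 := congrArg norm h1
    rw [norm_smul, u.norm_vec, c.norm_vec, Real.norm_of_nonneg hb, mul_one] at h6
    ext1
    rw [h1, ← h6, one_smul]

theorem UnitSphere.mem_closure_between {z c : UnitSphere} (hne : z ≠ c)
    (hpi : dist z c < Real.pi) : c ∈ closure {u | Between z u c ∧ u ≠ c} := by
  obtain ⟨γ, -, h1, hb, hγ⟩ := exists_geodesic hpi
  set l := dist z c with hl
  have hl0 : 0 < l := dist_pos.2 hne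
  rw [Metric.mem_closure_iff]
  intro ε hε
  have hm : 0 < min (ε / 2) l := lt_min (by positivity) hl0
  have hs : l - min (ε / 2) l ∈ Set.Icc 0 l := ⟨by linarith [min_le_right (ε / 2) l], by linarith⟩
  have hd := hγ l ⟨hl0.le, le_rfl⟩ _ hs
  rw [h1, sub_sub_cancel, abs_of_pos hm] at hd
  refine ⟨γ (l - min (ε / 2) l), ⟨hb _ hs, fun h => ?_⟩, ?_⟩
  · rw [h, dist_self] at hd
    linarith
  · rw [hd]
    linarith [min_le_left (ε / 2) l]

/-- A disk of radius less than `π / 2` does not contain another disk of the same radius. -/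
theorem UnitSphere.eq_of_ball_subset_ball {c c' : UnitSphere} {r : ℝ}
    (hr : r ∈ Set.Ioo 0 (Real.pi / 2)) (h : Metric.ball c r ⊆ Metric.ball c' r) : c = c' := by
  by_contra hne
  set d := dist c c' with hd
  have hd0 : 0 < d := dist_pos.2 hne
  have hdr : d < r := h (Metric.mem_ball_self hr.1)
  have hs0 : 0 < Real.sin d := Real.sin_pos_of_pos_of_lt_pi hd0 (by linarith [hr.2, Real.pi_pos])
  have hcc : inner ℝ c.vec c'.vec = Real.cos d := inner_vec _ _
  have hsc := Real.sin_sq_add_cos_sq d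
  set e := (Real.sin d)⁻¹ • (Real.cos d • c.vec - c'.vec) with he
  have hce : inner ℝ c.vec e = (0 : ℝ) := by
    rw [he, inner_smul_right, inner_sub_right, inner_smul_right, inner_self, hcc]; ring
  have hec' : inner ℝ e c'.vec = -Real.sin d := by
    rw [he, inner_smul_left, inner_sub_left, inner_smul_left, inner_self, hcc]
    simp only [conj_trivial]
    field_simp
    linarith
  have hee : inner ℝ e e = (1 : ℝ) := by
    nth_rewrite 2 [he]
    rw [inner_smul_right, inner_sub_right, inner_smul_right, real_inner_comm, hce, hec']
    field_simp
    ring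
  set s := r - d / 2 with hs
  have hw : ‖Real.cos s • c.vec + Real.sin s • e‖ = 1 := by
    rw [← pow_eq_one_iff_of_nonneg (norm_nonneg _) two_ne_zero, ← real_inner_self_eq_norm_sq]
    simp only [inner_add_left, inner_add_right, inner_smul_left, inner_smul_right, inner_self, hee,
      hce, real_inner_comm c.vec e, conj_trivial]
    linear_combination Real.sin_sq_add_cos_sq s
  let w : UnitSphere := ⟨_, hw⟩
  have h1 : dist w c = s := by
    rw [dist_eq_arccos, inner_add_left, inner_smul_left, inner_smul_left, inner_self,
      real_inner_comm, hce]
    simp only [conj_trivial, mul_one, mul_zero, add_zero]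
    exact Real.arccos_cos (by linarith) (by linarith [hr.2, Real.pi_pos])
  have h2 : dist w c' = s + d := by
    rw [dist_eq_arccos, inner_add_left, inner_smul_left, inner_smul_left, hcc, hec']
    simp only [conj_trivial]
    rw [show Real.cos s * Real.cos d + Real.sin s * -Real.sin d = Real.cos (s + d) by
      rw [Real.cos_add]; ring]
    exact Real.arccos_cos (by linarith) (by linarith [hr.2, Real.pi_pos])
  have h3 : dist w c' < r := h (Metric.mem_ball.2 (by rw [h1]; linarith))
  linarith

variable {S : Type*} [MetricSpace S] {ι : Type*} {α r : ι → ℝ} {J : ∀ i, ConeSphere (α i) → S}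

/-- The open disk with index `i`, as a subset of the cone sphere. -/
abbrev disk (α r : ι → ℝ) (i : ι) : Set (ConeSphere (α i)) :=
  Metric.ball (northPole (α i)) (r i)

/-- A family of local isometries `J i` from disks of radii less than `π / 2` to a metric space,
which is at most two-to-one, and such that no image contains another. The values of `J i` outside of
the disk do not matter. -/
structure IsDiskFamily (α r : ι → ℝ) (J : ∀ i, ConeSphere (α i) → S) : Prop where
  angle_pos : ∀ i, 0 < α i
  radius : ∀ i, r i ∈ Set.Ioo 0 (Real.pi / 2)
  isLocalIsometryOn : ∀ i, IsLocalIsometryOn (J i) (disk α r i)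
  two : ∀ i j k, ∀ x ∈ disk α r i, ∀ y ∈ disk α r j, ∀ z ∈ disk α r k, J i x = J j y →
    J i x = J k z → (⟨i, x⟩ : Σ i, ConeSphere (α i)) ≠ ⟨j, y⟩ →
    (⟨i, x⟩ : Σ i, ConeSphere (α i)) ≠ ⟨k, z⟩ → (⟨j, y⟩ : Σ i, ConeSphere (α i)) = ⟨k, z⟩
  not_subset : ∀ i j, i ≠ j → ¬ J i '' disk α r i ⊆ J j '' disk α r j

namespace IsDiskFamily

theorem center_mem (hd : IsDiskFamily α r J) (i : ι) : northPole (α i) ∈ disk α r i :=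
  Metric.mem_ball_self (hd.radius i).1

theorem radius_Icc (hd : IsDiskFamily α r J) (i : ι) : r i ∈ Set.Icc 0 (Real.pi / 2) :=
  ⟨(hd.radius i).1.le, (hd.radius i).2.le⟩

theorem mem_disk_iff {i : ι} {z c : UnitSphere} {Ω : Set UnitSphere}
    {E : UnitSphere → ConeSphere (α i)} (hE : IsSlitChart (α i) z c Ω E) {w : UnitSphere} :
    E w ∈ disk α r i ↔ w ∈ Metric.ball c (r i) := by
  rw [Metric.mem_ball, hE.pole, Metric.mem_ball]

theorem comp_chart (hd : IsDiskFamily α r J) {i : ι} {z c : UnitSphere} {Ω : Set UnitSphere}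
    {E : UnitSphere → ConeSphere (α i)} (hE : IsSlitChart (α i) z c Ω E) :
    IsLocalIsometryOn (J i ∘ E) (Ω ∩ Metric.ball c (r i)) :=
  (hd.isLocalIsometryOn i).comp (hE.isLocalIsometryOn.mono
    (hE.isLocalIsometryOn.isOpen.inter Metric.isOpen_ball) Set.inter_subset_left)
    fun _ hw => (mem_disk_iff hE).2 hw.2

/-- A regular point of a disk has a chart which induces a prescribed germ of a local isometry. -/
theorem exists_chart_germ (hd : IsDiskFamily α r J) {j : ι} {f : UnitSphere → S}
    {s : Set UnitSphere} (hf : IsLocalIsometryOn f s) {z : UnitSphere} (hz : z ∈ s)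
    {y : ConeSphere (α j)} (hy : y ∈ disk α r j)
    (hreg : y ≠ northPole (α j) ∨ α j = 2 * Real.pi) (hfy : f z = J j y) :
    ∃ (c : UnitSphere) (Ω : Set UnitSphere) (E : UnitSphere → ConeSphere (α j)),
      IsSlitChart (α j) z c Ω E ∧ E z = y ∧ (α j = 2 * Real.pi → Ω = Set.univ) ∧
      f =ᶠ[𝓝 z] J j ∘ E := by
  obtain ⟨z₁, c, Ω, E, hE, hz₁, hΩ⟩ := exists_isSlitChart_of_regular (hd.angle_pos j)
    ((Metric.mem_ball.1 hy).trans (hd.radius j).2) hreg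
  have hb : z₁ ∈ Metric.ball c (r j) := (mem_disk_iff hE).1 (by rw [hz₁]; exact hy)
  obtain ⟨R, hR, hRe⟩ := exists_rot_transition hf (hd.comp_chart hE) hz ⟨hE.base, hb⟩
    (by rw [hfy, Function.comp, hz₁])
  have hRz : rot R.symm z₁ = z := by rw [← hR, rot_symm_rot]
  refine ⟨_, _, _, hRz ▸ hE.comp_rot R, by rw [Function.comp, hR, hz₁], fun h => ?_, ?_⟩
  · rw [hΩ h, Set.preimage_univ]
  · filter_upwards [hRe] with w hw
    exact hw.symm

/-- The image of a cone point is not the image of a regular point. -/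
theorem angle_eq_two_pi (hd : IsDiskFamily α r J) {i : ι} {f : UnitSphere → S}
    {s : Set UnitSphere} (hf : IsLocalIsometryOn f s) {z : UnitSphere} (hz : z ∈ s)
    (h : J i (northPole (α i)) = f z) : α i = 2 * Real.pi := by
  obtain ⟨ε, hε, _, h1⟩ := (hd.isLocalIsometryOn i).exists_isoOnBall (hd.center_mem i)
  obtain ⟨δ, hδ, _, h2⟩ := hf.exists_isoOnBall hz
  obtain ⟨φ, -, hφ, -⟩ := (h1.mono (min_le_left ε δ)).exists_transition (lt_min hε hδ)
    (h2.mono (min_le_right ε δ)) h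
  exact eq_two_pi_of_isoOnBall (hd.angle_pos i) (lt_min hε hδ) hφ

/-- If two disks have the same center in the surface, then the smaller one is contained in the
larger one, by development along the meridians. -/
theorem image_subset_of_center_eq (hd : IsDiskFamily α r J) {i j : ι} (hr : r i ≤ r j)
    (h : J i (northPole (α i)) = J j (northPole (α j))) :
    J i '' disk α r i ⊆ J j '' disk α r j := by
  rintro _ ⟨x, hx, rfl⟩
  rcases eq_or_ne x (northPole (α i)) with rfl | hne
  · exact ⟨_, hd.center_mem j, h.symm⟩
  obtain ⟨ε₁, hε₁, h0₁, h1⟩ := (hd.isLocalIsometryOn i).exists_isoOnBall (hd.center_mem i)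
  obtain ⟨ε₂, hε₂, h0₂, h2⟩ := (hd.isLocalIsometryOn j).exists_isoOnBall (hd.center_mem j)
  set ε := min (min ε₁ ε₂) (r i) with hε
  have hε0 : 0 < ε := lt_min (lt_min hε₁ hε₂) (hd.radius i).1
  have hεr : ε ≤ r i := min_le_right _ _
  replace h1 := h1.mono (show ε ≤ ε₁ from (min_le_left _ _).trans (min_le_left _ _))
  replace h2 := h2.mono (show ε ≤ ε₂ from (min_le_left _ _).trans (min_le_right _ _))
  have hri := (hd.radius i).2
  obtain ⟨c, Ω, E, w, hEw, hw, hbase⟩ := exists_isSlitChart (hd.angle_pos i)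
    ⟨dist_pos.2 hne, (Metric.mem_ball.1 hx).trans hri⟩
  obtain ⟨z, hE, hzc, hnb⟩ := hbase (ε / 2) ⟨by positivity, by linarith⟩
  have hzε : E z ∈ Metric.ball (northPole (α i)) ε := by
    rw [Metric.mem_ball, hE.pole, hzc]; linarith
  have hzr : z ∈ Metric.ball c (r i) := by rw [Metric.mem_ball, hzc]; linarith
  obtain ⟨y, hy, hyz⟩ := h2.exists_preimage (y := J i (E z)) (h ▸ h1.mapsTo hzε)
  have hyN : dist y (northPole (α j)) = ε / 2 := by
    rw [← h2.dist_center hy, hyz, ← h, h1.dist_center hzε, hE.pole, hzc]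
  obtain ⟨c₂, Ω₂, E₂, hE₂, hz₂, -, hgerm⟩ := hd.exists_chart_germ (hd.comp_chart hE)
    ⟨hE.base, hzr⟩ (j := j) (y := y)
    (by rw [Metric.mem_ball, hyN]; linarith)
    (Or.inl fun h => by rw [h, dist_self] at hyN; linarith) hyz.symm
  have hcc : c = c₂ := by
    refine eq_of_eventually_dist_eq (z := z) ?_
    have hz₂ε : E₂ z ∈ Metric.ball (northPole (α j)) ε := by rw [hz₂]; exact hy
    filter_upwards [hgerm,
      (hE.isLocalIsometryOn.continuousAt hE.base).eventually (Metric.isOpen_ball.mem_nhds hzε),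
      (hE₂.isLocalIsometryOn.continuousAt hE₂.base).eventually
        (Metric.isOpen_ball.mem_nhds hz₂ε)] with u hu hu1 hu2
    rw [← hE.pole, ← hE₂.pole, ← h1.dist_center hu1, ← h2.dist_center hu2, h]
    exact congrArg (fun v => dist v _) hu
  subst hcc
  have hwr : w ∈ Metric.ball c (r i) := (mem_disk_iff hE).1 (by rw [hw]; exact hx)
  have hw₂ : w ∈ Ω₂ := by
    by_contra hn
    exact hnb (hE₂.back w hn (inner_pos_of_mem_ball hri.le hwr))
  have hK : IsPreconnected (Ω ∩ Ω₂ ∩ Metric.ball c (r i)) :=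
    isPreconnected_of_star (fun u hu => inner_pos_of_mem_ball hri.le hu.2)
      ⟨⟨hE.base, hE₂.base⟩, hzr⟩ fun u hu v hv => ⟨⟨hE.star u hu.1.1 v hv, hE₂.star u hu.1.2 v hv⟩,
        hv.mem_ball (hd.radius_Icc i) hzr hu.2⟩
  have hKo : IsOpen (Ω ∩ Ω₂ ∩ Metric.ball c (r i)) :=
    (hE.isLocalIsometryOn.isOpen.inter hE₂.isLocalIsometryOn.isOpen).inter Metric.isOpen_ball
  have heq := eqOn_of_eventuallyEq hK ((hd.comp_chart hE).mono hKo fun u hu => ⟨hu.1.1, hu.2⟩)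
    ((hd.comp_chart hE₂).mono hKo fun u hu => ⟨hu.1.2, Metric.ball_subset_ball hr hu.2⟩)
    ⟨⟨hE.base, hE₂.base⟩, hzr⟩ hgerm
  refine ⟨E₂ w, (mem_disk_iff hE₂).2 (Metric.ball_subset_ball hr hwr), ?_⟩
  rw [← hw]
  exact (heq ⟨⟨hEw.base, hw₂⟩, hwr⟩).symm

theorem eq_of_center_eq (hd : IsDiskFamily α r J) {i j : ι}
    (h : J i (northPole (α i)) = J j (northPole (α j))) : i = j := by
  by_contra hne
  rcases le_total (r i) (r j) with hr | hr
  · exact hd.not_subset i j hne (hd.image_subset_of_center_eq hr h)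
  · exact hd.not_subset j i (Ne.symm hne) (hd.image_subset_of_center_eq hr h.symm)

theorem regular_of_double (hd : IsDiskFamily α r J) {i j : ι} {x : ConeSphere (α i)}
    {y : ConeSphere (α j)} (hy : y ∈ disk α r j) (h : J i x = J j y)
    (hne : (⟨i, x⟩ : Σ i, ConeSphere (α i)) ≠ ⟨j, y⟩) :
    x ≠ northPole (α i) ∨ α i = 2 * Real.pi := by
  by_contra! hcon
  obtain ⟨rfl, hα⟩ := hcon
  by_cases hreg : y ≠ northPole (α j) ∨ α j = 2 * Real.pi
  · obtain ⟨z, c, Ω, E, hE, hz, -⟩ := exists_isSlitChart_of_regular (hd.angle_pos j)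
      ((Metric.mem_ball.1 hy).trans (hd.radius j).2) hreg
    exact hα (hd.angle_eq_two_pi (hd.comp_chart hE)
      ⟨hE.base, (mem_disk_iff hE).1 (by rw [hz]; exact hy)⟩ (by rw [h, Function.comp, hz]))
  · push Not at hreg
    obtain ⟨rfl, -⟩ := hreg
    have := hd.eq_of_center_eq h
    subst this
    exact hne rfl

end IsDiskFamily

end Develop

/-! ### The lens around a pair of double points -/

section Lens

open Filter Topology UnitSphere

variable {S : Type*} {ι : Type*} {α r : ι → ℝ} {J : ∀ i, ConeSphere (α i) → S}

/-- The intersection of two disks in `𝕊²` with centers `c₁`, `c₂` and radii `r i`, `r j`, together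
with maps `E₁`, `E₂` which develop it into the disks with indices `i` and `j`, so that the
corresponding points of the two disks are different but have the same image in the surface. -/
structure IsLens (α r : ι → ℝ) (J : ∀ i, ConeSphere (α i) → S) (i j : ι) (c₁ c₂ : UnitSphere)
    (E₁ : UnitSphere → ConeSphere (α i)) (E₂ : UnitSphere → ConeSphere (α j)) : Prop where
  pole₁ : ∀ z, dist (E₁ z) (northPole (α i)) = dist z c₁
  pole₂ : ∀ z, dist (E₂ z) (northPole (α j)) = dist z c₂
  locIso₁ : IsLocalIsometryOn E₁ (Metric.ball c₁ (r i) ∩ Metric.ball c₂ (r j))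
  locIso₂ : IsLocalIsometryOn E₂ (Metric.ball c₁ (r i) ∩ Metric.ball c₂ (r j))
  cont₁ : ∀ z ∈ Metric.closedBall c₁ (r i) ∩ Metric.closedBall c₂ (r j), ContinuousAt E₁ z
  cont₂ : ∀ z ∈ Metric.closedBall c₁ (r i) ∩ Metric.closedBall c₂ (r j), ContinuousAt E₂ z
  radial₁ : ∀ w w', w ≠ w' → E₁ w = E₁ w' → 0 < dist w c₁ → ∀ ε > 0, ∃ u u', dist u w < ε ∧
    dist u' w' < ε ∧ dist u c₁ < dist w c₁ ∧ dist u' c₁ < dist w' c₁ ∧ E₁ u = E₁ u'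
  radial₂ : ∀ w w', w ≠ w' → E₂ w = E₂ w' → 0 < dist w c₂ → ∀ ε > 0, ∃ u u', dist u w < ε ∧
    dist u' w' < ε ∧ dist u c₂ < dist w c₂ ∧ dist u' c₂ < dist w' c₂ ∧ E₂ u = E₂ u'
  agree : ∀ z ∈ Metric.ball c₁ (r i) ∩ Metric.ball c₂ (r j), J i (E₁ z) = J j (E₂ z)
  ne : ∀ z ∈ Metric.ball c₁ (r i) ∩ Metric.ball c₂ (r j),
    (⟨i, E₁ z⟩ : Σ i, ConeSphere (α i)) ≠ ⟨j, E₂ z⟩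
  nonempty : (Metric.ball c₁ (r i) ∩ Metric.ball c₂ (r j)).Nonempty
  not_subset₁ : ¬ Metric.ball c₁ (r i) ⊆ Metric.ball c₂ (r j)
  not_subset₂ : ¬ Metric.ball c₂ (r j) ⊆ Metric.ball c₁ (r i)

theorem IsLens.symm {i j : ι} {c₁ c₂ : UnitSphere} {E₁ : UnitSphere → ConeSphere (α i)}
    {E₂ : UnitSphere → ConeSphere (α j)} (h : IsLens α r J i j c₁ c₂ E₁ E₂) :
    IsLens α r J j i c₂ c₁ E₂ E₁ where
  pole₁ := h.pole₂
  pole₂ := h.pole₁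
  locIso₁ := by rw [Set.inter_comm]; exact h.locIso₂
  locIso₂ := by rw [Set.inter_comm]; exact h.locIso₁
  cont₁ z hz := h.cont₂ z hz.symm
  cont₂ z hz := h.cont₁ z hz.symm
  radial₁ := h.radial₂
  radial₂ := h.radial₁
  agree z hz := (h.agree z hz.symm).symm
  ne z hz := (h.ne z hz.symm).symm
  nonempty := by rw [Set.inter_comm]; exact h.nonempty
  not_subset₁ := h.not_subset₂
  not_subset₂ := h.not_subset₁

/-- Two charts with the same base point which induce the same germ of a local isometry to the
surface, but different points in the disjoint union of the disks. -/
structure IsChartPair (α r : ι → ℝ) (J : ∀ i, ConeSphere (α i) → S) (i j : ι)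
    (z c₁ c₂ : UnitSphere) (Ω₁ Ω₂ : Set UnitSphere)
    (E₁ : UnitSphere → ConeSphere (α i)) (E₂ : UnitSphere → ConeSphere (α j)) : Prop where
  chart₁ : IsSlitChart (α i) z c₁ Ω₁ E₁
  chart₂ : IsSlitChart (α j) z c₂ Ω₂ E₂
  univ₁ : α i = 2 * Real.pi → Ω₁ = Set.univ
  univ₂ : α j = 2 * Real.pi → Ω₂ = Set.univ
  mem : z ∈ Metric.ball c₁ (r i) ∩ Metric.ball c₂ (r j)
  germ : J i ∘ E₁ =ᶠ[𝓝 z] J j ∘ E₂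
  ne : (⟨i, E₁ z⟩ : Σ i, ConeSphere (α i)) ≠ ⟨j, E₂ z⟩

namespace IsChartPair

variable {i j : ι} {z c₁ c₂ : UnitSphere} {Ω₁ Ω₂ : Set UnitSphere}
  {E₁ : UnitSphere → ConeSphere (α i)} {E₂ : UnitSphere → ConeSphere (α j)}

theorem symm (h : IsChartPair α r J i j z c₁ c₂ Ω₁ Ω₂ E₁ E₂) :
    IsChartPair α r J j i z c₂ c₁ Ω₂ Ω₁ E₂ E₁ :=
  ⟨h.chart₂, h.chart₁, h.univ₂, h.univ₁, h.mem.symm, h.germ.symm, h.ne.symm⟩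

theorem isOpen_common (h : IsChartPair α r J i j z c₁ c₂ Ω₁ Ω₂ E₁ E₂) :
    IsOpen (Ω₁ ∩ Ω₂ ∩ (Metric.ball c₁ (r i) ∩ Metric.ball c₂ (r j))) :=
  (h.chart₁.isLocalIsometryOn.isOpen.inter h.chart₂.isLocalIsometryOn.isOpen).inter
    (Metric.isOpen_ball.inter Metric.isOpen_ball)

variable [MetricSpace S]

theorem isPreconnected_common (hd : IsDiskFamily α r J)
    (h : IsChartPair α r J i j z c₁ c₂ Ω₁ Ω₂ E₁ E₂) :
    IsPreconnected (Ω₁ ∩ Ω₂ ∩ (Metric.ball c₁ (r i) ∩ Metric.ball c₂ (r j))) :=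
  isPreconnected_of_star (fun _ hu => inner_pos_of_mem_ball (hd.radius_Icc i).2 hu.2.1)
    ⟨⟨h.chart₁.base, h.chart₂.base⟩, h.mem⟩ fun u hu v hv =>
      ⟨⟨h.chart₁.star u hu.1.1 v hv, h.chart₂.star u hu.1.2 v hv⟩,
        hv.mem_ball (hd.radius_Icc i) h.mem.1 hu.2.1, hv.mem_ball (hd.radius_Icc j) h.mem.2 hu.2.2⟩

theorem eqOn_common (hd : IsDiskFamily α r J) (h : IsChartPair α r J i j z c₁ c₂ Ω₁ Ω₂ E₁ E₂) :
    Set.EqOn (J i ∘ E₁) (J j ∘ E₂)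
      (Ω₁ ∩ Ω₂ ∩ (Metric.ball c₁ (r i) ∩ Metric.ball c₂ (r j))) :=
  eqOn_of_eventuallyEq (h.isPreconnected_common hd)
    ((hd.comp_chart h.chart₁).mono h.isOpen_common fun _ hu => ⟨hu.1.1, hu.2.1⟩)
    ((hd.comp_chart h.chart₂).mono h.isOpen_common fun _ hu => ⟨hu.1.2, hu.2.2⟩)
    ⟨⟨h.chart₁.base, h.chart₂.base⟩, h.mem⟩ h.germ

theorem ne_common (hd : IsDiskFamily α r J) (h : IsChartPair α r J i j z c₁ c₂ Ω₁ Ω₂ E₁ E₂)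
    {u : UnitSphere} (hu : u ∈ Ω₁ ∩ Ω₂ ∩ (Metric.ball c₁ (r i) ∩ Metric.ball c₂ (r j))) :
    (⟨i, E₁ u⟩ : Σ i, ConeSphere (α i)) ≠ ⟨j, E₂ u⟩ := by
  intro heq
  obtain rfl : i = j := congrArg Sigma.fst heq
  have heq' : E₁ u = E₂ u := by simpa using heq
  obtain ⟨V, hV, hinj⟩ := (hd.isLocalIsometryOn i).exists_mem_nhds_injOn
    ((IsDiskFamily.mem_disk_iff h.chart₁).2 hu.2.1)
  have h1 : E₁ =ᶠ[𝓝 u] E₂ := by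
    filter_upwards [h.isOpen_common.mem_nhds hu,
      (h.chart₁.isLocalIsometryOn.continuousAt hu.1.1).eventually hV,
      (h.chart₂.isLocalIsometryOn.continuousAt hu.1.2).eventually (heq' ▸ hV)] with v hv h1 h2
    exact hinj h1 h2 (h.eqOn_common hd hv)
  refine h.ne ?_
  rw [eqOn_of_eventuallyEq (h.isPreconnected_common hd)
    (h.chart₁.isLocalIsometryOn.mono h.isOpen_common fun _ hu => hu.1.1)
    (h.chart₂.isLocalIsometryOn.mono h.isOpen_common fun _ hu => hu.1.2) hu h1
    ⟨⟨h.chart₁.base, h.chart₂.base⟩, h.mem⟩]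

theorem eq_of_mem_closure (hd : IsDiskFamily α r J)
    (h : IsChartPair α r J i j z c₁ c₂ Ω₁ Ω₂ E₁ E₂) {w : UnitSphere}
    (hw : w ∈ closure (Ω₁ ∩ Ω₂ ∩ (Metric.ball c₁ (r i) ∩ Metric.ball c₂ (r j))))
    (h₁ : ContinuousAt (J i ∘ E₁) w) (h₂ : ContinuousAt (J j ∘ E₂) w) :
    J i (E₁ w) = J j (E₂ w) := by
  set K := Ω₁ ∩ Ω₂ ∩ (Metric.ball c₁ (r i) ∩ Metric.ball c₂ (r j)) with hK
  have := mem_closure_iff_nhdsWithin_neBot.1 hw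
  have h₁' : Tendsto (J i ∘ E₁) (𝓝[K] w) (𝓝 (J i (E₁ w))) := h₁.mono_left nhdsWithin_le_nhds
  refine tendsto_nhds_unique h₁' (Tendsto.congr' ?_ (h₂.mono_left nhdsWithin_le_nhds))
  filter_upwards [self_mem_nhdsWithin] with u hu
  exact (h.eqOn_common hd hu).symm

/-- The center of the first disk lies on the boundary of the slit domain. -/
theorem center_mem_closure (hd : IsDiskFamily α r J)
    (h : IsChartPair α r J i j z c₁ c₂ Ω₁ Ω₂ E₁ E₂) (hc : c₁ ∉ Ω₁) :
    c₁ ∈ closure {u | Between z u c₁ ∧ u ∈ Ω₁ ∧ u ∈ Metric.ball c₁ (r i)} := by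
  have hri := (hd.radius i).2
  have hne : z ≠ c₁ := fun h' => hc (h' ▸ h.chart₁.base)
  have hz := h.mem.1
  refine closure_mono ?_ (mem_closure_between hne ((Metric.mem_ball.1 hz).trans
    (by linarith [Real.pi_pos])))
  rintro u ⟨hu, huc⟩
  have hub := hu.mem_ball (hd.radius_Icc i) hz (Metric.mem_ball_self (hd.radius i).1)
  refine ⟨hu, ?_, hub⟩
  by_contra hn
  exact huc (hu.antisymm (inner_pos_of_mem_ball hri.le hz)
    (h.chart₁.back u hn (inner_pos_of_mem_ball hri.le hub)))

/-- The slit of the first chart does not start at a regular point of the second chart: the pole of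
the first disk would have the same image as that point, hence cone angle `2π`, and a chart centered
at such a pole has no slit. -/
theorem center_notMem_domain (hd : IsDiskFamily α r J)
    (h : IsChartPair α r J i j z c₁ c₂ Ω₁ Ω₂ E₁ E₂) (hc : c₁ ∉ Ω₁)
    (hcj : c₁ ∈ Metric.ball c₂ (r j)) : c₁ ∉ Ω₂ := by
  intro hc₂
  have hcl := h.center_mem_closure hd hc
  have hcl' : c₁ ∈ closure (Ω₁ ∩ Ω₂ ∩ (Metric.ball c₁ (r i) ∩ Metric.ball c₂ (r j))) := by
    have ho : IsOpen (Ω₂ ∩ Metric.ball c₂ (r j)) :=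
      h.chart₂.isLocalIsometryOn.isOpen.inter Metric.isOpen_ball
    rw [mem_closure_iff_frequently] at hcl ⊢
    refine (hcl.and_eventually (ho.mem_nhds ⟨hc₂, hcj⟩)).mono ?_
    rintro u ⟨⟨-, h1, h2⟩, h3, h4⟩
    exact ⟨⟨h1, h3⟩, h2, h4⟩
  have ht₁ : ContinuousAt (J i ∘ E₁) c₁ := by
    refine ContinuousAt.comp ?_ h.chart₁.continuousAt_center
    rw [h.chart₁.apply_center]
    exact (hd.isLocalIsometryOn i).continuousAt (hd.center_mem i)
  have ht₂ : ContinuousAt (J j ∘ E₂) c₁ := (hd.comp_chart h.chart₂).continuousAt ⟨hc₂, hcj⟩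
  have heq : J i (northPole (α i)) = (J j ∘ E₂) c₁ := by
    rw [← h.chart₁.apply_center]
    exact h.eq_of_mem_closure hd hcl' ht₁ ht₂
  exact hc (h.univ₁ (hd.angle_eq_two_pi (hd.comp_chart h.chart₂) ⟨hc₂, hcj⟩ heq) ▸ Set.mem_univ _)

/-- The slits of a chart pair do not start at a common point: both poles would have the same image,
so the two disks would be one and the same, and its map to the surface, being injective near the
pole, would not be two-to-one on the overlap. -/
theorem center_ne (hd : IsDiskFamily α r J)
    (h : IsChartPair α r J i j z c₁ c₂ Ω₁ Ω₂ E₁ E₂) (hc₁ : c₁ ∉ Ω₁) (hc₂ : c₂ ∉ Ω₂) : c₁ ≠ c₂ := by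
  rintro rfl
  have hcl' : c₁ ∈ closure (Ω₁ ∩ Ω₂ ∩ (Metric.ball c₁ (r i) ∩ Metric.ball c₁ (r j))) := by
    have hcl := h.center_mem_closure hd hc₁
    rw [mem_closure_iff_frequently] at hcl ⊢
    have hne : z ≠ c₁ := fun h' => hc₁ (h' ▸ h.chart₁.base)
    refine (hcl.and_eventually (Metric.ball_mem_nhds c₁ (hd.radius j).1)).mono ?_
    rintro u ⟨⟨h1, h2, h3⟩, h4⟩
    refine ⟨⟨h2, ?_⟩, h3, h4⟩
    by_contra hn
    have := h1.antisymm (inner_pos_of_mem_ball (hd.radius_Icc i).2 h.mem.1)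
      (h.chart₂.back u hn (inner_pos_of_mem_ball (hd.radius_Icc j).2 h4))
    exact hc₁ (this ▸ h2)
  have ht₁ : ContinuousAt (J i ∘ E₁) c₁ := by
    refine ContinuousAt.comp ?_ h.chart₁.continuousAt_center
    rw [h.chart₁.apply_center]
    exact (hd.isLocalIsometryOn i).continuousAt (hd.center_mem i)
  have ht₂ : ContinuousAt (J j ∘ E₂) c₁ := by
    refine ContinuousAt.comp ?_ h.chart₂.continuousAt_center
    rw [h.chart₂.apply_center]
    exact (hd.isLocalIsometryOn j).continuousAt (hd.center_mem j)
  have heq : J i (northPole (α i)) = J j (northPole (α j)) := by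
    rw [← h.chart₁.apply_center, ← h.chart₂.apply_center]
    exact h.eq_of_mem_closure hd hcl' ht₁ ht₂
  obtain rfl := hd.eq_of_center_eq heq
  obtain ⟨V, hV, hinj⟩ := (hd.isLocalIsometryOn i).exists_mem_nhds_injOn (hd.center_mem i)
  have e1 : ∀ᶠ u in 𝓝 c₁, E₁ u ∈ V := h.chart₁.continuousAt_center.eventually
    (by rw [h.chart₁.apply_center]; exact hV)
  have e2 : ∀ᶠ u in 𝓝 c₁, E₂ u ∈ V := h.chart₂.continuousAt_center.eventually
    (by rw [h.chart₂.apply_center]; exact hV)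
  obtain ⟨u, hu, hu1, hu2⟩ := ((mem_closure_iff_frequently.1 hcl').and_eventually
    (e1.and e2)).exists
  refine h.ne_common hd hu ?_
  rw [hinj hu1 hu2 (h.eqOn_common hd hu)]

/-- A cone point of the first disk does not lie in the common part of the two disks. -/
theorem center_notMem (hd : IsDiskFamily α r J)
    (h : IsChartPair α r J i j z c₁ c₂ Ω₁ Ω₂ E₁ E₂) (hc : c₁ ∉ Ω₁) :
    c₁ ∉ Metric.ball c₂ (r j) := by
  intro hcj
  have hci := Metric.mem_ball_self (x := c₁) (hd.radius i).1
  have h1 := h.center_notMem_domain hd hc hcj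
  -- the slit of the second chart starts at `c₂`, between the base point and `c₁`
  have hb := h.chart₂.back c₁ h1 (inner_pos_of_mem_ball (hd.radius_Icc j).2 hcj)
  have hc₂ : c₂ ∉ Ω₂ := by
    rcases h.chart₂.regular_or with ⟨-, h2, -⟩ | h2
    · exact absurd (h2 ▸ Set.mem_univ _) h1
    · exact h2
  have hc₂i : c₂ ∈ Metric.ball c₁ (r i) := hb.mem_ball (hd.radius_Icc i) h.mem.1 hci
  have h3 := h.symm.center_notMem_domain hd hc₂ hc₂i
  have hb' := h.chart₁.back c₂ h3 (inner_pos_of_mem_ball (hd.radius_Icc i).2 hc₂i)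
  exact h.center_ne hd hc hc₂ (hb'.antisymm
    (inner_pos_of_mem_ball (hd.radius_Icc j).2 h.mem.2) hb)

theorem subset_domain (hd : IsDiskFamily α r J)
    (h : IsChartPair α r J i j z c₁ c₂ Ω₁ Ω₂ E₁ E₂) :
    Metric.ball c₁ (r i) ∩ Metric.ball c₂ (r j) ⊆ Ω₁ := by
  intro u hu
  rcases h.chart₁.regular_or with ⟨-, h1, -⟩ | h1
  · rw [h1]; exact Set.mem_univ _
  · by_contra hn
    exact h.center_notMem hd h1 ((h.chart₁.back u hn (inner_pos_of_mem_ball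
      (hd.radius_Icc i).2 hu.1)).mem_ball (hd.radius_Icc j) h.mem.2 hu.2)

theorem continuousAt_closure (hd : IsDiskFamily α r J)
    (h : IsChartPair α r J i j z c₁ c₂ Ω₁ Ω₂ E₁ E₂) {u : UnitSphere}
    (hu : u ∈ Metric.closedBall c₁ (r i) ∩ Metric.closedBall c₂ (r j)) : ContinuousAt E₁ u := by
  rcases eq_or_ne u c₁ with rfl | hne
  · exact h.chart₁.continuousAt_center
  · refine h.chart₁.isLocalIsometryOn.continuousAt ?_
    rcases h.chart₁.regular_or with ⟨-, h1, -⟩ | h1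
    · rw [h1]; exact Set.mem_univ _
    · by_contra hn
      have hpos : 0 < inner ℝ u.vec c₁.vec := by
        rw [inner_vec]
        have h1 := Metric.mem_closedBall.1 hu.1
        have h2 := (hd.radius i).2
        exact Real.cos_pos_of_mem_Ioo ⟨by linarith [dist_nonneg (x := u) (y := c₁), Real.pi_pos],
          by linarith⟩
      exact h.center_notMem hd h1 ((h.chart₁.back u hn hpos).mem_ball_of_closedBall
        (hd.radius_Icc j) h.mem.2 hu.2 (Ne.symm hne))

theorem not_ball_subset (hd : IsDiskFamily α r J)
    (h : IsChartPair α r J i j z c₁ c₂ Ω₁ Ω₂ E₁ E₂) :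
    ¬ Metric.ball c₁ (r i) ⊆ Metric.ball c₂ (r j) := by
  intro hsub
  have hc := Metric.mem_ball_self (x := c₁) (hd.radius i).1
  have hc₁ : c₁ ∈ Ω₁ := h.subset_domain hd ⟨hc, hsub hc⟩
  rcases h.chart₁.regular_or with ⟨-, -, hs⟩ | h1
  · have hall : ∀ u ∈ Metric.ball c₁ (r i), u ∈ Ω₁ ∩ Ω₂ ∩
        (Metric.ball c₁ (r i) ∩ Metric.ball c₂ (r j)) := fun u hu =>
      ⟨⟨h.subset_domain hd ⟨hu, hsub hu⟩, h.symm.subset_domain hd ⟨hsub hu, hu⟩⟩, hu, hsub hu⟩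
    have himg : J i '' disk α r i ⊆ J j '' disk α r j := by
      rintro _ ⟨x, hx, rfl⟩
      obtain ⟨u, rfl⟩ := hs x
      have hu := (IsDiskFamily.mem_disk_iff h.chart₁).1 hx
      exact ⟨E₂ u, (IsDiskFamily.mem_disk_iff h.chart₂).2 (hsub hu),
        (h.eqOn_common hd (hall u hu)).symm⟩
    have hij : i = j := by
      by_contra hij
      exact hd.not_subset i j hij himg
    subst hij
    obtain rfl := eq_of_ball_subset_ball (hd.radius i) hsub
    refine h.ne_common hd (hall c₁ hc) ?_
    rw [h.chart₁.apply_center, h.chart₂.apply_center]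
  · exact h1 hc₁

theorem isLens (hd : IsDiskFamily α r J) (h : IsChartPair α r J i j z c₁ c₂ Ω₁ Ω₂ E₁ E₂) :
    IsLens α r J i j c₁ c₂ E₁ E₂ := by
  have hall : ∀ u ∈ Metric.ball c₁ (r i) ∩ Metric.ball c₂ (r j), u ∈ Ω₁ ∩ Ω₂ ∩
      (Metric.ball c₁ (r i) ∩ Metric.ball c₂ (r j)) := fun u hu =>
    ⟨⟨h.subset_domain hd hu, h.symm.subset_domain hd hu.symm⟩, hu⟩
  have ho : IsOpen (Metric.ball c₁ (r i) ∩ Metric.ball c₂ (r j)) :=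
    Metric.isOpen_ball.inter Metric.isOpen_ball
  exact
  { pole₁ := h.chart₁.pole
    pole₂ := h.chart₂.pole
    locIso₁ := h.chart₁.isLocalIsometryOn.mono ho fun u hu => (hall u hu).1.1
    locIso₂ := h.chart₂.isLocalIsometryOn.mono ho fun u hu => (hall u hu).1.2
    cont₁ := fun u hu => h.continuousAt_closure hd hu
    cont₂ := fun u hu => h.symm.continuousAt_closure hd hu.symm
    radial₁ := h.chart₁.radial
    radial₂ := h.chart₂.radial
    agree := fun u hu => h.eqOn_common hd (hall u hu)
    ne := fun u hu => h.ne_common hd (hall u hu)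
    nonempty := ⟨z, h.mem⟩
    not_subset₁ := h.not_ball_subset hd
    not_subset₂ := h.symm.not_ball_subset hd }

end IsChartPair

variable [MetricSpace S]

/-- Each pair of different points with the same image belongs to a lens. -/
theorem IsDiskFamily.exists_isLens (hd : IsDiskFamily α r J) {i j : ι} {x : ConeSphere (α i)}
    {y : ConeSphere (α j)} (hx : x ∈ disk α r i) (hy : y ∈ disk α r j) (h : J i x = J j y)
    (hne : (⟨i, x⟩ : Σ i, ConeSphere (α i)) ≠ ⟨j, y⟩) :
    ∃ c₁ c₂ E₁ E₂, IsLens α r J i j c₁ c₂ E₁ E₂ ∧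
      ∃ z ∈ Metric.ball c₁ (r i) ∩ Metric.ball c₂ (r j), E₁ z = x ∧ E₂ z = y := by
  obtain ⟨z, c₁, Ω₁, E₁, hE₁, rfl, hu₁⟩ := exists_isSlitChart_of_regular (hd.angle_pos i)
    ((Metric.mem_ball.1 hx).trans (hd.radius i).2) (hd.regular_of_double hy h hne)
  have hz₁ := (mem_disk_iff hE₁).1 hx
  obtain ⟨c₂, Ω₂, E₂, hE₂, rfl, hu₂, hgerm⟩ := hd.exists_chart_germ (hd.comp_chart hE₁)
    ⟨hE₁.base, hz₁⟩ hy (hd.regular_of_double hx h.symm hne.symm) h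
  have hz : z ∈ Metric.ball c₁ (r i) ∩ Metric.ball c₂ (r j) := ⟨hz₁, (mem_disk_iff hE₂).1 hy⟩
  exact ⟨c₁, c₂, E₁, E₂, IsChartPair.isLens hd ⟨hE₁, hE₂, hu₁, hu₂, hz, hgerm, hne⟩, z, hz,
    rfl, rfl⟩

end Lens

/-! ### Rigidity of lenses -/

section Rigidity

open Filter Topology UnitSphere

variable {S : Type*} {ι : Type*} {α r : ι → ℝ} {J : ∀ i, ConeSphere (α i) → S}

namespace IsLens

variable {i j : ι} {c₁ c₂ : UnitSphere} {E₁ : UnitSphere → ConeSphere (α i)}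
  {E₂ : UnitSphere → ConeSphere (α j)}

theorem mem_disk₁ (h : IsLens α r J i j c₁ c₂ E₁ E₂) {z : UnitSphere}
    (hz : z ∈ Metric.ball c₁ (r i) ∩ Metric.ball c₂ (r j)) : E₁ z ∈ disk α r i := by
  rw [Metric.mem_ball, h.pole₁]; exact hz.1

theorem mem_disk₂ (h : IsLens α r J i j c₁ c₂ E₁ E₂) {z : UnitSphere}
    (hz : z ∈ Metric.ball c₁ (r i) ∩ Metric.ball c₂ (r j)) : E₂ z ∈ disk α r j := by
  rw [Metric.mem_ball, h.pole₂]; exact hz.2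

variable [MetricSpace S]

theorem isPreconnected (hd : IsDiskFamily α r J) :
    IsPreconnected (Metric.ball c₁ (r i) ∩ Metric.ball c₂ (r j)) :=
  isPreconnected_ball_inter (hd.radius_Icc i) (hd.radius_Icc j)

/-- The partner of a double point is unique. -/
theorem partner_unique (hd : IsDiskFamily α r J) (h : IsLens α r J i j c₁ c₂ E₁ E₂) {k : ι}
    {c₁' c₂' : UnitSphere} {E₁' : UnitSphere → ConeSphere (α i)} {E₂' : UnitSphere → ConeSphere (α k)}
    (h' : IsLens α r J i k c₁' c₂' E₁' E₂') {z z' : UnitSphere}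
    (hz : z ∈ Metric.ball c₁ (r i) ∩ Metric.ball c₂ (r j))
    (hz' : z' ∈ Metric.ball c₁' (r i) ∩ Metric.ball c₂' (r k)) (heq : E₁ z = E₁' z') :
    (⟨j, E₂ z⟩ : Σ i, ConeSphere (α i)) = ⟨k, E₂' z'⟩ :=
  hd.two i j k (E₁ z) (h.mem_disk₁ hz) _ (h.mem_disk₂ hz) _ (h'.mem_disk₂ hz') (h.agree z hz)
    (heq ▸ h'.agree z' hz') (h.ne z hz) (heq ▸ h'.ne z' hz')

/-- Two lenses which develop the same pair of double points differ by an isometry of the sphere. -/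
theorem exists_rot (hd : IsDiskFamily α r J) (h : IsLens α r J i j c₁ c₂ E₁ E₂)
    {c₁' c₂' : UnitSphere} {E₁' : UnitSphere → ConeSphere (α i)} {E₂' : UnitSphere → ConeSphere (α j)}
    (h' : IsLens α r J i j c₁' c₂' E₁' E₂') {z z' : UnitSphere}
    (hz : z ∈ Metric.ball c₁ (r i) ∩ Metric.ball c₂ (r j))
    (hz' : z' ∈ Metric.ball c₁' (r i) ∩ Metric.ball c₂' (r j)) (heq₁ : E₁ z = E₁' z')
    (heq₂ : E₂ z = E₂' z') :
    ∃ R : EuclideanSpace ℝ (Fin 3) ≃ₗᵢ[ℝ] EuclideanSpace ℝ (Fin 3),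
      rot R c₁ = c₁' ∧ rot R c₂ = c₂' ∧ rot R z = z' ∧
      (∀ u, rot R u ∈ Metric.ball c₁' (r i) ∩ Metric.ball c₂' (r j) ↔
        u ∈ Metric.ball c₁ (r i) ∩ Metric.ball c₂ (r j)) ∧
      ∀ u ∈ Metric.ball c₁ (r i) ∩ Metric.ball c₂ (r j), E₁' (rot R u) = E₁ u := by
  obtain ⟨R, hR, hR₁⟩ := exists_rot_transition h.locIso₁ h'.locIso₁ hz hz' heq₁
  have hRc := (isometry_rot R).continuous.continuousAt (x := z)
  have hR₂ : ∀ᶠ w in 𝓝 z, E₂' (rot R w) = E₂ w := by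
    obtain ⟨V, hV, hinj⟩ := (hd.isLocalIsometryOn j).exists_mem_nhds_injOn (h.mem_disk₂ hz)
    have e1 := (h.locIso₂.continuousAt hz).eventually hV
    have e2 : ∀ᶠ w in 𝓝 z, E₂' (rot R w) ∈ V := by
      refine hRc.eventually (p := fun w => E₂' w ∈ V) ?_
      rw [hR]
      exact (h'.locIso₂.continuousAt hz').eventually (heq₂ ▸ hV)
    have e3 : ∀ᶠ w in 𝓝 z, rot R w ∈ Metric.ball c₁' (r i) ∩ Metric.ball c₂' (r j) :=
      hRc.eventually (by rw [hR]; exact h'.locIso₁.isOpen.mem_nhds hz')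
    filter_upwards [e1, e2, e3, h.locIso₁.isOpen.mem_nhds hz, hR₁] with w h1 h2 h3 h4 h5
    refine hinj h2 h1 ?_
    rw [← h'.agree _ h3, ← h.agree _ h4, h5]
  have hc₁ : rot R c₁ = c₁' := by
    have : c₁ = rot R.symm c₁' := eq_of_eventually_dist_eq (z := z) (by
      filter_upwards [hR₁] with w hw
      rw [← dist_rot_left, ← h'.pole₁, hw, h.pole₁])
    rw [this, rot_rot_symm]
  have hc₂ : rot R c₂ = c₂' := by
    have : c₂ = rot R.symm c₂' := eq_of_eventually_dist_eq (z := z) (by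
      filter_upwards [hR₂] with w hw
      rw [← dist_rot_left, ← h'.pole₂, hw, h.pole₂])
    rw [this, rot_rot_symm]
  have hmem : ∀ u, rot R u ∈ Metric.ball c₁' (r i) ∩ Metric.ball c₂' (r j) ↔
      u ∈ Metric.ball c₁ (r i) ∩ Metric.ball c₂ (r j) := by
    intro u
    rw [Set.mem_inter_iff, Set.mem_inter_iff, Metric.mem_ball, Metric.mem_ball, Metric.mem_ball,
      Metric.mem_ball, ← hc₁, ← hc₂, dist_rot, dist_rot]
  refine ⟨R, hc₁, hc₂, hR, hmem, ?_⟩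
  refine eqOn_of_eventuallyEq (f := E₁' ∘ rot R) (isPreconnected hd) ?_ h.locIso₁ hz hR₁
  exact (isLocalIsometryOn_comp_rot h'.locIso₁ R).mono h.locIso₁.isOpen fun u hu => (hmem u).2 hu

/-- A lens contains a point on the great circle through the two centers, which is fixed by all
isometries that fix the centers. -/
theorem exists_fixed (hd : IsDiskFamily α r J) {z : UnitSphere}
    (hz : z ∈ Metric.ball c₁ (r i) ∩ Metric.ball c₂ (r j)) :
    ∃ m ∈ Metric.ball c₁ (r i) ∩ Metric.ball c₂ (r j),
      ∀ R : EuclideanSpace ℝ (Fin 3) ≃ₗᵢ[ℝ] EuclideanSpace ℝ (Fin 3),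
        rot R c₁ = c₁ → rot R c₂ = c₂ → rot R m = m := by
  set K : Submodule ℝ (EuclideanSpace ℝ (Fin 3)) := Submodule.span ℝ {c₁.vec, c₂.vec} with hK
  set v := K.starProjection z.vec with hv
  have hvK : v ∈ K := K.starProjection_apply_mem z.vec
  have hin : ∀ c ∈ K, inner ℝ v c = inner ℝ z.vec c := by
    intro c hc
    have := K.starProjection_inner_eq_zero z.vec c hc
    rw [inner_sub_left, sub_eq_zero] at this
    exact this.symm
  have h₁ := hin c₁.vec (Submodule.subset_span (by simp))
  have h₂ := hin c₂.vec (Submodule.subset_span (by simp))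
  have hv0 : v ≠ 0 := by
    intro h0
    have := inner_pos_of_mem_ball (hd.radius_Icc i).2 hz.1
    rw [h0, inner_zero_left] at h₁
    linarith
  have hv1 : ‖v‖ ≤ 1 := by
    rw [← z.norm_vec]; exact K.norm_starProjection_apply_le z.vec
  have hinv : 1 ≤ ‖v‖⁻¹ := (one_le_inv₀ (norm_pos_iff.2 hv0)).2 hv1
  have key : ∀ (c : UnitSphere) (k : ι), c.vec ∈ K → z ∈ Metric.ball c (r k) →
      ofVec v hv0 ∈ Metric.ball c (r k) := by
    intro c k hc hzc
    have hrk : r k ∈ Set.Icc 0 Real.pi :=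
      ⟨(hd.radius k).1.le, by linarith [(hd.radius k).2, Real.pi_pos]⟩
    have hpos := inner_pos_of_mem_ball (hd.radius_Icc k).2 hzc
    rw [Metric.mem_ball, dist_lt_iff hrk] at hzc ⊢
    simp only [ofVec, inner_smul_left, conj_trivial, hin c.vec hc]
    nlinarith
  refine ⟨ofVec v hv0, ⟨key c₁ i (Submodule.subset_span (by simp)) hz.1,
    key c₂ j (Submodule.subset_span (by simp)) hz.2⟩, fun R hR₁ hR₂ => ?_⟩
  obtain ⟨a, b, hab⟩ := Submodule.mem_span_pair.1 hvK
  have hR₁' : R c₁.vec = c₁.vec := congrArg UnitSphere.vec hR₁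
  have hR₂' : R c₂.vec = c₂.vec := congrArg UnitSphere.vec hR₂
  have hRv : R v = v := by rw [← hab, map_add, map_smul, map_smul, hR₁', hR₂']
  ext1
  simp only [rot, ofVec, map_smul, hRv]

/-- The development of a lens is injective: an isometry of the sphere which preserves the
development fixes a point of the lens, hence is the identity. -/
theorem injOn₁ (hd : IsDiskFamily α r J) (h : IsLens α r J i j c₁ c₂ E₁ E₂) :
    Set.InjOn E₁ (Metric.ball c₁ (r i) ∩ Metric.ball c₂ (r j)) := by
  intro z hz z' hz' heq
  have heq₂ : E₂ z = E₂ z' := by simpa using h.partner_unique hd h hz hz' heq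
  obtain ⟨R, hc₁, hc₂, hR, hmem, hE⟩ := h.exists_rot hd h hz hz' heq heq₂
  obtain ⟨m, hm, hfix⟩ := exists_fixed hd hz
  have hRm := hfix R hc₁ hc₂
  obtain ⟨V, hV, hinj⟩ := h.locIso₁.exists_mem_nhds_injOn hm
  have hid : ∀ᶠ u in 𝓝 m, rot R u = u := by
    have e1 : ∀ᶠ u in 𝓝 m, rot R u ∈ V :=
      (isometry_rot R).continuous.continuousAt.eventually (by rw [hRm]; exact hV)
    filter_upwards [e1, hV, h.locIso₁.isOpen.mem_nhds hm] with u h1 h2 h3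
    exact hinj h1 h2 (hE u h3)
  rw [← hR, rot_eq_self_of_eventually hid]

/-- Images of lenses are equal or disjoint. -/
theorem image_eq (hd : IsDiskFamily α r J) (h : IsLens α r J i j c₁ c₂ E₁ E₂) {k : ι}
    {c₁' c₂' : UnitSphere} {E₁' : UnitSphere → ConeSphere (α i)} {E₂' : UnitSphere → ConeSphere (α k)}
    (h' : IsLens α r J i k c₁' c₂' E₁' E₂')
    (hne : (E₁ '' (Metric.ball c₁ (r i) ∩ Metric.ball c₂ (r j)) ∩
      E₁' '' (Metric.ball c₁' (r i) ∩ Metric.ball c₂' (r k))).Nonempty) :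
    E₁ '' (Metric.ball c₁ (r i) ∩ Metric.ball c₂ (r j)) =
      E₁' '' (Metric.ball c₁' (r i) ∩ Metric.ball c₂' (r k)) := by
  obtain ⟨_, ⟨z, hz, rfl⟩, z', hz', heq⟩ := hne
  have hs := h.partner_unique hd h' hz hz' heq.symm
  obtain rfl : j = k := congrArg Sigma.fst hs
  have heq₂ : E₂ z = E₂' z' := by simpa using hs
  obtain ⟨R, -, -, -, hmem, hE⟩ := h.exists_rot hd h' hz hz' heq.symm heq₂
  ext x
  constructor
  · rintro ⟨u, hu, rfl⟩
    exact ⟨rot R u, (hmem u).2 hu, hE u hu⟩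
  · rintro ⟨u, hu, rfl⟩
    have hu' : rot R.symm u ∈ Metric.ball c₁ (r i) ∩ Metric.ball c₂ (r j) := by
      rw [← hmem, rot_rot_symm]; exact hu
    exact ⟨_, hu', by rw [← hE _ hu', rot_rot_symm]⟩

/-- The two images of a lens are different: otherwise they would be exchanged by an isometry of
the sphere, which fixes the midpoint of the two centers. -/
theorem image_ne (hd : IsDiskFamily α r J) {E₂ : UnitSphere → ConeSphere (α i)}
    (h : IsLens α r J i i c₁ c₂ E₁ E₂) :
    E₁ '' (Metric.ball c₁ (r i) ∩ Metric.ball c₂ (r i)) ≠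
      E₂ '' (Metric.ball c₁ (r i) ∩ Metric.ball c₂ (r i)) := by
  intro himg
  obtain ⟨z, hz⟩ := h.nonempty
  obtain ⟨z', hz', heq⟩ : E₁ z ∈ E₂ '' (Metric.ball c₁ (r i) ∩ Metric.ball c₂ (r i)) :=
    himg ▸ ⟨z, hz, rfl⟩
  have heq₂ : E₂ z = E₁ z' := by
    simpa using h.partner_unique hd h.symm hz hz'.symm heq.symm
  obtain ⟨R, hc₁, hc₂, -, -, hE⟩ := h.exists_rot hd h.symm hz hz'.symm heq.symm heq₂
  have hri : r i ∈ Set.Icc 0 Real.pi :=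
    ⟨(hd.radius i).1.le, by linarith [(hd.radius i).2, Real.pi_pos]⟩
  have hcos : 0 < Real.cos (r i) := Real.cos_pos_of_mem_Ioo
    ⟨by linarith [(hd.radius i).1, Real.pi_pos], (hd.radius i).2⟩
  set v := c₁.vec + c₂.vec with hv
  have hvr : 2 * Real.cos (r i) < ‖v‖ := by
    have h1 := (dist_lt_iff hri).1 hz.1
    have h2 := (dist_lt_iff hri).1 hz.2
    have h3 := real_inner_le_norm z.vec v
    rw [z.norm_vec, one_mul, hv, inner_add_right] at h3
    linarith
  have hv0 : v ≠ 0 := by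
    intro h0
    rw [h0, norm_zero] at hvr
    linarith
  have hsq : ‖v‖ ^ 2 = 2 + 2 * inner ℝ c₁.vec c₂.vec := by
    rw [hv, norm_add_sq_real, c₁.norm_vec, c₂.norm_vec]; ring
  have hm : ofVec v hv0 ∈ Metric.ball c₁ (r i) ∩ Metric.ball c₂ (r i) := by
    have hn : 0 < ‖v‖ := norm_pos_iff.2 hv0
    have hkey : ‖v‖⁻¹ * (1 + inner ℝ c₁.vec c₂.vec) = ‖v‖ / 2 := by
      field_simp
      linarith
    constructor
    · rw [Metric.mem_ball, dist_lt_iff hri]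
      simp only [ofVec, inner_smul_left, conj_trivial]
      rw [hv, inner_add_left, inner_self, real_inner_comm, ← hv, hkey]
      linarith
    · rw [Metric.mem_ball, dist_lt_iff hri]
      simp only [ofVec, inner_smul_left, conj_trivial]
      rw [hv, inner_add_left, inner_self, ← hv, add_comm, hkey]
      linarith
  have hRm : rot R (ofVec v hv0) = ofVec v hv0 := by
    have hc₁' : R c₁.vec = c₂.vec := congrArg UnitSphere.vec hc₁
    have hc₂' : R c₂.vec = c₁.vec := congrArg UnitSphere.vec hc₂
    ext1
    simp only [rot, ofVec, map_smul]
    rw [hv, map_add, hc₁', hc₂', add_comm]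
  refine h.ne _ hm ?_
  rw [← hE _ hm, hRm]

/-- The development is injective on the open side of a lens. -/
theorem injOn_side (hd : IsDiskFamily α r J) (h : IsLens α r J i j c₁ c₂ E₁ E₂) :
    Set.InjOn E₁ (Metric.sphere c₁ (r i) ∩ Metric.ball c₂ (r j)) := by
  intro w hw w' hw' heq
  by_contra hne
  obtain ⟨δ, hδ, hb⟩ := Metric.isOpen_iff.1 Metric.isOpen_ball w hw.2
  obtain ⟨δ', hδ', hb'⟩ := Metric.isOpen_iff.1 Metric.isOpen_ball w' hw'.2
  have hd0 := dist_pos.2 hne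
  obtain ⟨u, u', h1, h2, h3, h4, h5⟩ := h.radial₁ w w' hne heq
    (by rw [Metric.mem_sphere.1 hw.1]; exact (hd.radius i).1) (min (min δ δ') (dist w w' / 2))
    (lt_min (lt_min hδ hδ') (by positivity))
  rw [lt_min_iff, lt_min_iff] at h1 h2
  rw [Metric.mem_sphere.1 hw.1] at h3
  rw [Metric.mem_sphere.1 hw'.1] at h4
  have := h.injOn₁ hd ⟨h3, hb h1.1.1⟩ ⟨h4, hb' h2.1.2⟩ h5
  subst this
  have h6 := dist_triangle_left w w' u
  linarith [h1.2, h2.2]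

/-- The first side of a lens is nonempty. -/
theorem exists_mem_side (hd : IsDiskFamily α r J) (h : IsLens α r J i j c₁ c₂ E₁ E₂) :
    (Metric.sphere c₁ (r i) ∩ Metric.ball c₂ (r j)).Nonempty := by
  by_contra hempty
  rw [Set.not_nonempty_iff_eq_empty] at hempty
  refine h.not_subset₂ ?_
  have hpre := isPreconnected_ball_inter (c := c₂) (c' := c₂) (hd.radius_Icc j) (hd.radius_Icc j)
  rw [Set.inter_self] at hpre
  refine hpre.subset_left_of_subset_union Metric.isOpen_ball
    (Metric.isClosed_closedBall (x := c₁) (ε := r i)).isOpen_compl ?_ ?_ ?_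
  · exact Set.disjoint_left.2 fun u hu hu' => hu' (Metric.ball_subset_closedBall hu)
  · intro u hu
    rcases lt_trichotomy (dist u c₁) (r i) with hlt | heq | hgt
    · exact Or.inl hlt
    · exact absurd (hempty ▸ (⟨heq, hu⟩ : u ∈ Metric.sphere c₁ (r i) ∩ Metric.ball c₂ (r j)))
        (Set.notMem_empty u)
    · exact Or.inr fun hle => hgt.not_ge hle
  · rw [Set.inter_comm]; exact h.nonempty

end IsLens

/-- The bigons in the disk with index `i`: the images of the lenses. -/
def bigons (α r : ι → ℝ) (J : ∀ i, ConeSphere (α i) → S) (i : ι) : Set (Set (ConeSphere (α i))) :=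
  {U | ∃ (j : ι) (c₁ c₂ : UnitSphere) (E₁ : UnitSphere → ConeSphere (α i))
    (E₂ : UnitSphere → ConeSphere (α j)), IsLens α r J i j c₁ c₂ E₁ E₂ ∧
      U = E₁ '' (Metric.ball c₁ (r i) ∩ Metric.ball c₂ (r j))}

theorem subset_disk_of_mem_bigons {i : ι} {U : Set (ConeSphere (α i))} (hU : U ∈ bigons α r J i) :
    U ⊆ disk α r i := by
  obtain ⟨j, c₁, c₂, E₁, E₂, h, rfl⟩ := hU
  rintro _ ⟨z, hz, rfl⟩
  exact h.mem_disk₁ hz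

theorem isOpen_of_mem_bigons {i : ι} {U : Set (ConeSphere (α i))} (hU : U ∈ bigons α r J i) :
    IsOpen U := by
  obtain ⟨j, c₁, c₂, E₁, E₂, h, rfl⟩ := hU
  rw [Metric.isOpen_iff]
  rintro _ ⟨z, hz, rfl⟩
  obtain ⟨ε, hε, h0, h1⟩ := h.locIso₁.exists_isoOnBall hz
  exact ⟨ε, hε, by rw [← h1.1]; exact Set.image_mono h0⟩

variable [MetricSpace S]

theorem eq_of_mem_bigons (hd : IsDiskFamily α r J) {i : ι} {U V : Set (ConeSphere (α i))}
    (hU : U ∈ bigons α r J i) (hV : V ∈ bigons α r J i) (hne : (U ∩ V).Nonempty) : U = V := by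
  obtain ⟨j, c₁, c₂, E₁, E₂, h, rfl⟩ := hU
  obtain ⟨k, c₁', c₂', E₁', E₂', h', rfl⟩ := hV
  exact h.image_eq hd h' hne

theorem exists_mem_bigons (hd : IsDiskFamily α r J) {i j : ι} {x : ConeSphere (α i)}
    {y : ConeSphere (α j)} (hx : x ∈ disk α r i) (hy : y ∈ disk α r j) (h : J i x = J j y)
    (hne : (⟨i, x⟩ : Σ i, ConeSphere (α i)) ≠ ⟨j, y⟩) : ∃ U ∈ bigons α r J i, x ∈ U := by
  obtain ⟨c₁, c₂, E₁, E₂, hL, z, hz, h1, -⟩ := hd.exists_isLens hx hy h hne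
  exact ⟨_, ⟨j, c₁, c₂, E₁, E₂, hL, rfl⟩, z, hz, h1⟩

end Rigidity

/-! ### The bigons along the boundary of a disk -/

section Boundary

open Filter Topology UnitSphere

theorem IsoOnBall.isLocalIsometryOn {X Y : Type*} [MetricSpace X] [MetricSpace Y] {f : X → Y}
    {x : X} {ε : ℝ} (h : IsoOnBall f x ε) : IsLocalIsometryOn f (Metric.ball x ε) := by
  intro y hy
  have hy' := Metric.mem_ball.1 hy
  have hsub : Metric.ball y (ε - dist y x) ⊆ Metric.ball x ε :=
    Metric.ball_subset_ball' (by linarith)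
  refine ⟨ε - dist y x, by linarith, hsub, Set.Subset.antisymm ?_ ?_,
    fun a ha b hb => h.2 a (hsub ha) b (hsub hb)⟩
  · rintro _ ⟨z, hz, rfl⟩
    rw [Metric.mem_ball, h.2 z (hsub hz) y hy]
    exact hz
  · intro z hz
    have hz' : z ∈ Metric.ball (f x) ε := by
      have h1 := dist_triangle z (f y) (f x)
      rw [h.dist_center hy] at h1
      have h2 := Metric.mem_ball.1 hz
      rw [Metric.mem_ball]
      linarith
    obtain ⟨u, hu, rfl⟩ := h.exists_preimage hz'
    refine ⟨u, ?_, rfl⟩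
    rwa [Metric.mem_ball, h.2 u hu y hy] at hz

theorem UnitSphere.sphere_subset_closure_ball {c w : UnitSphere} {r : ℝ}
    (hr : r ∈ Set.Ioo 0 (Real.pi / 2)) (hw : dist w c = r) : w ∈ closure (Metric.ball c r) := by
  have hne : c ≠ w := by
    rintro rfl
    rw [dist_self] at hw
    exact hr.1.ne hw
  refine closure_mono ?_ (mem_closure_between hne (by
    rw [dist_comm, hw]; linarith [hr.2, Real.pi_pos]))
  rintro u ⟨hu, huw⟩
  exact hu.mem_ball_of_closedBall ⟨hr.1.le, hr.2.le⟩ (Metric.mem_ball_self hr.1) hw.le huw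

/-- Points of a disk near its boundary circle, in a chart around a boundary point `p`. -/
theorem exists_boundary_chart {α r : ℝ} (hα : 0 < α) (hr : r ∈ Set.Ioo 0 (Real.pi / 2))
    {p : ConeSphere α} (hp : dist p (northPole α) = r) :
    ∃ (c w : UnitSphere) (E : UnitSphere → ConeSphere α) (ε : ℝ), 0 < ε ∧ ε ≤ Real.pi / 2 ∧
      (∀ u, dist (E u) (northPole α) = dist u c) ∧ E w = p ∧ IsoOnBall E w ε := by
  obtain ⟨c, Ω, E, w, hE, hw, -⟩ := exists_isSlitChart hα (x := p) (by rw [hp]; exact hr)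
  obtain ⟨ε, hε, -, h⟩ := hE.isLocalIsometryOn.exists_isoOnBall hE.base
  exact ⟨c, w, E, min ε (Real.pi / 2), lt_min hε (by positivity), min_le_right _ _, hE.pole, hw,
    h.mono (min_le_left _ _)⟩

theorem mem_closure_disk {α r : ℝ} (hα : 0 < α) (hr : r ∈ Set.Ioo 0 (Real.pi / 2))
    {p : ConeSphere α} (hp : dist p (northPole α) = r) :
    p ∈ closure (Metric.ball (northPole α) r) := by
  obtain ⟨c, w, E, ε, hε, -, hpole, rfl, hE⟩ := exists_boundary_chart hα hr hp
  rw [hpole] at hp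
  have hw := sphere_subset_closure_ball hr hp
  rw [mem_closure_iff_frequently] at hw ⊢
  refine (hE.continuousAt hε).frequently (hw.mono fun u hu => ?_)
  rwa [Metric.mem_ball, hpole]

variable {S : Type*} {ι : Type*} {α r : ι → ℝ} {J : ∀ i, ConeSphere (α i) → S}

/-- The family of maps `J` has, along the disk with index `i`, the boundary value `q` at `p`. The
convergence is stated in the strong form in which it holds. -/
def IsBoundaryValue [MetricSpace S] (α r : ι → ℝ) (J : ∀ i, ConeSphere (α i) → S) (i : ι)
    (p : ConeSphere (α i)) (q : S) : Prop :=
  ∃ ε > 0, ∀ x ∈ disk α r i, dist x p < ε → dist (J i x) q ≤ dist x p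

/-- Near the boundary point `p`, the disk is contained in `U`. -/
def IsFilledBy (α r : ι → ℝ) (i : ι) (p : ConeSphere (α i)) (U : Set (ConeSphere (α i))) : Prop :=
  ∃ ε > 0, ∀ x ∈ disk α r i, dist x p < ε → x ∈ U

theorem IsFilledBy.eventually {i : ι} {p : ConeSphere (α i)} {U : Set (ConeSphere (α i))}
    (h : IsFilledBy α r i p U) : ∀ᶠ p' in 𝓝 p, IsFilledBy α r i p' U := by
  obtain ⟨ε, hε, h⟩ := h
  filter_upwards [Metric.ball_mem_nhds p (half_pos hε)] with p' hp'
  refine ⟨ε / 2, half_pos hε, fun x hx hxp => h x hx ?_⟩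
  have := dist_triangle x p' p
  rw [Metric.mem_ball] at hp'
  linarith

variable [MetricSpace S]

theorem IsFilledBy.mem_closure (hd : IsDiskFamily α r J) {i : ι} {p : ConeSphere (α i)}
    {U : Set (ConeSphere (α i))} (h : IsFilledBy α r i p U)
    (hp : dist p (northPole (α i)) = r i) : p ∈ closure U := by
  obtain ⟨ε, hε, h⟩ := h
  have hcl := mem_closure_disk (hd.angle_pos i) (hd.radius i) hp
  rw [mem_closure_iff_frequently] at hcl ⊢
  exact (hcl.and_eventually (Metric.ball_mem_nhds p hε)).mono fun x hx => h x hx.1 hx.2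

theorem IsFilledBy.eq (hd : IsDiskFamily α r J) {i : ι} {p : ConeSphere (α i)}
    {U V : Set (ConeSphere (α i))} (h : IsFilledBy α r i p U)
    (hU : U ∈ bigons α r J i) (hV : V ∈ bigons α r J i)
    (hpV : p ∈ closure V) : U = V := by
  obtain ⟨ε, hε, h⟩ := h
  obtain ⟨x, hxV, hx⟩ := Metric.mem_closure_iff.1 hpV ε hε
  rw [dist_comm] at hx
  exact eq_of_mem_bigons hd hU hV ⟨x, h x (subset_disk_of_mem_bigons hV hxV) hx, hxV⟩

theorem exists_isBoundaryValue [CompactSpace S] (hd : IsDiskFamily α r J) {i : ι}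
    {p : ConeSphere (α i)} (hp : dist p (northPole (α i)) = r i) :
    ∃ q, IsBoundaryValue α r J i p q := by
  obtain ⟨c, w, E, ε, hε, hεπ, hpole, rfl, hE⟩ :=
    exists_boundary_chart (hd.angle_pos i) (hd.radius i) hp
  rw [hpole] at hp
  have hri := (hd.radius i).2
  set H := Metric.ball w ε ∩ Metric.ball c (r i) with hH
  have hHo : IsOpen H := Metric.isOpen_ball.inter Metric.isOpen_ball
  have hF : IsLocalIsometryOn (J i ∘ E) H :=
    (hd.isLocalIsometryOn i).comp (hE.isLocalIsometryOn.mono hHo Set.inter_subset_left)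
      fun u hu => by rw [Metric.mem_ball, hpole]; exact hu.2
  have hlip : ∀ u ∈ H, ∀ v ∈ H, dist (J i (E u)) (J i (E v)) ≤ dist u v := by
    intro u hu v hv
    refine dist_le_of_isLocalIsometryOn hF ?_ fun x hx =>
      ⟨hx.mem_ball ⟨hε.le, hεπ⟩ hu.1 hv.1, hx.mem_ball (hd.radius_Icc i) hu.2 hv.2⟩
    have := dist_triangle_right u v c
    have h1 := Metric.mem_ball.1 hu.2
    have h2 := Metric.mem_ball.1 hv.2
    linarith
  have hcl : w ∈ closure H := by
    have := sphere_subset_closure_ball (hd.radius i) hp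
    rw [mem_closure_iff_frequently] at this ⊢
    exact (this.and_eventually (Metric.ball_mem_nhds w hε)).mono fun u hu => ⟨hu.2, hu.1⟩
  have : (𝓝[H] w).NeBot := mem_closure_iff_nhdsWithin_neBot.1 hcl
  obtain ⟨q, hq⟩ := exists_clusterPt_of_compactSpace (Filter.map (J i ∘ E) (𝓝[H] w))
  refine ⟨q, ε, hε, fun x hx hxp => ?_⟩
  obtain ⟨u, hu, rfl⟩ := hE.exists_preimage hxp
  have hu' : u ∈ H := ⟨hu, by rwa [Metric.mem_ball, ← hpole]⟩
  rw [hE.dist_center hu]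
  refine le_of_forall_pos_le_add fun η hη => ?_
  have hfreq : ∃ᶠ v in 𝓝[H] w, (J i ∘ E) v ∈ Metric.ball q (η / 2) :=
    Filter.frequently_map.1 (hq.frequently (Metric.ball_mem_nhds q (half_pos hη)))
  obtain ⟨v, hv1, hv2, hv3⟩ := (hfreq.and_eventually (inter_mem self_mem_nhdsWithin
    (nhdsWithin_le_nhds (Metric.ball_mem_nhds w (half_pos hη))))).exists
  have h1 := hlip u hu' v hv2
  have h2 := dist_triangle (J i (E u)) (J i (E v)) q
  have h3 := dist_triangle u w v
  rw [dist_comm w v] at h3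
  have h4 : dist (J i (E v)) q < η / 2 := hv1
  have h5 : dist v w < η / 2 := hv3
  linarith

/-- Near a boundary point whose image is covered by a disk, the points are double points, and they
all belong to the same bigon. -/
theorem exists_isFilledBy (hd : IsDiskFamily α r J) {i : ι} {p : ConeSphere (α i)}
    (hp : dist p (northPole (α i)) = r i) {q : S} (hq : IsBoundaryValue α r J i p q)
    (hcov : q ∈ ⋃ j, J j '' disk α r j) : ∃ U ∈ bigons α r J i, IsFilledBy α r i p U := by
  obtain ⟨j, y, hy, rfl⟩ := Set.mem_iUnion.1 hcov
  obtain ⟨ε₁, hε₁, hlip⟩ := hq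
  obtain ⟨δ, hδ, hδd, hJ⟩ := (hd.isLocalIsometryOn j).exists_isoOnBall hy
  obtain ⟨c, w, E, ε, hε, hεπ, hpole, rfl, hE⟩ :=
    exists_boundary_chart (hd.angle_pos i) (hd.radius i) hp
  set τ := r j - dist y (northPole (α j)) with hτ
  have hτ0 : 0 < τ := sub_pos.2 hy
  set η := min (min ε₁ ε) (min δ (τ / 2)) with hη
  have hη0 : 0 < η := lt_min (lt_min hε₁ hε) (lt_min hδ (by positivity))
  have hη1 : η ≤ ε₁ := (min_le_left _ _).trans (min_le_left _ _)
  have hη2 : η ≤ ε := (min_le_left _ _).trans (min_le_right _ _)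
  have hη3 : η ≤ δ := (min_le_right _ _).trans (min_le_left _ _)
  have hη4 : η ≤ τ / 2 := (min_le_right _ _).trans (min_le_right _ _)
  -- near `p`, all points of the disk are double points
  have hdouble : ∀ x ∈ disk α r i, dist x (E w) < η → ∃ U ∈ bigons α r J i, x ∈ U := by
    intro x hx hxp
    have h1 := hlip x hx (hxp.trans_le hη1)
    obtain ⟨y', hy', hyx⟩ := hJ.exists_preimage (y := J i x)
      (Metric.mem_ball.2 (by linarith))
    refine exists_mem_bigons hd hx (hδd hy') hyx.symm fun heq => ?_
    have h2 : dist x (northPole (α i)) = dist y' (northPole (α j)) :=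
      congrArg (fun a : Σ i, ConeSphere (α i) => dist a.2 (northPole (α a.1))) heq
    have h3 : r i = r j := congrArg r (congrArg Sigma.fst heq)
    have h4 := hJ.dist_center hy'
    rw [hyx] at h4
    have h5 := dist_triangle y' y (northPole (α j))
    have h6 := dist_triangle_left (E w) (northPole (α i)) x
    rw [hp] at h6
    linarith
  have hN : Metric.ball (E w) η ∩ disk α r i = E '' (Metric.ball w η ∩ Metric.ball c (r i)) := by
    ext x
    constructor
    · rintro ⟨hx1, hx2⟩
      obtain ⟨u, hu, rfl⟩ := (hE.mono hη2).exists_preimage hx1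
      exact ⟨u, ⟨hu, by rwa [Metric.mem_ball, ← hpole]⟩, rfl⟩
    · rintro ⟨u, ⟨hu1, hu2⟩, rfl⟩
      exact ⟨(hE.mono hη2).mapsTo hu1, by rwa [Metric.mem_ball, hpole]⟩
  have hpre : IsPreconnected (Metric.ball (E w) η ∩ disk α r i) := by
    rw [hN]
    refine (isPreconnected_ball_inter ⟨hη0.le, hη2.trans hεπ⟩ (hd.radius_Icc i)).image _ ?_
    exact fun u hu => ((hE.mono hη2).isLocalIsometryOn.continuousAt hu.1).continuousWithinAt
  obtain ⟨x₀, hx₀, hx₀p⟩ := Metric.mem_closure_iff.1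
    (mem_closure_disk (hd.angle_pos i) (hd.radius i) hp) η hη0
  rw [dist_comm] at hx₀p
  obtain ⟨U, hU, hx₀U⟩ := hdouble x₀ hx₀ hx₀p
  refine ⟨U, hU, η, hη0, fun x hx hxp => ?_⟩
  have hsub : Metric.ball (E w) η ∩ disk α r i ⊆ U := by
    refine hpre.subset_left_of_subset_union (isOpen_of_mem_bigons hU)
      (isOpen_sUnion (s := bigons α r J i \ {U}) fun V hV => isOpen_of_mem_bigons hV.1) ?_ ?_
      ⟨x₀, ⟨hx₀p, hx₀⟩, hx₀U⟩
    · rw [Set.disjoint_left]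
      rintro u hu ⟨V, ⟨hV, hVU⟩, huV⟩
      exact hVU (eq_of_mem_bigons hd hV hU ⟨u, huV, hu⟩)
    · rintro u ⟨hu1, hu2⟩
      obtain ⟨V, hV, huV⟩ := hdouble u hu2 hu1
      rcases eq_or_ne V U with rfl | hne
      · exact Or.inl huV
      · exact Or.inr ⟨V, ⟨hV, hne⟩, huV⟩
  exact hsub ⟨hxp, hx⟩

/-- The boundary points whose images are missed are isolated among the boundary points: in the
development, a missed point would be the center `c'` of a small disk and have the distance `0` both
from the one and from the other boundary point. -/
theorem eventually_isFilledBy [CompactSpace S] (hS : IsSphericalSurface S)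
    (hd : IsDiskFamily α r J) (hmiss : (⋃ j, J j '' disk α r j)ᶜ.Finite) {i : ι}
    {p : ConeSphere (α i)} (hp : dist p (northPole (α i)) = r i) :
    ∀ᶠ p' in 𝓝 p, dist p' (northPole (α i)) = r i → p' ≠ p →
      ∃ U ∈ bigons α r J i, IsFilledBy α r i p' U := by
  obtain ⟨q, hq⟩ := exists_isBoundaryValue hd hp
  by_cases hcov : q ∈ ⋃ j, J j '' disk α r j
  · obtain ⟨U, hU, hfill⟩ := exists_isFilledBy hd hp hq hcov
    filter_upwards [hfill.eventually] with p' hp' _ _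
    exact ⟨U, hU, hp'⟩
  obtain ⟨ε₁, hε₁, hlip⟩ := hq
  obtain ⟨β, hβ, ε₂, hε₂, φ, hφq, hφ⟩ := hS q
  have hφ' : IsoOnBall φ q ε₂ := ⟨by rw [hφq]; exact hφ.1, hφ.2⟩
  obtain ⟨c, w, E, ε, hε, hεπ, hpole, rfl, hE⟩ :=
    exists_boundary_chart (hd.angle_pos i) (hd.radius i) hp
  have hpc := hp
  rw [hpole] at hpc
  -- the other missed points stay away from `q`
  obtain ⟨δ, hδ, hδq⟩ : ∃ δ > 0, ∀ q' ∉ ⋃ j, J j '' disk α r j, dist q' q < δ → q' = q := by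
    have hfin : ((⋃ j, J j '' disk α r j)ᶜ \ {q}).Finite := hmiss.subset Set.sdiff_subset
    obtain ⟨δ, hδ, h⟩ := Metric.isOpen_iff.1 hfin.isClosed.isOpen_compl q (by simp)
    refine ⟨δ, hδ, fun q' hq' hd => ?_⟩
    by_contra hne
    exact h hd ⟨hq', hne⟩
  set η := min (min ε₁ ε) (min δ ε₂) with hη
  have hη0 : 0 < η := lt_min (lt_min hε₁ hε) (lt_min hδ hε₂)
  have hη1 : η ≤ ε₁ := (min_le_left _ _).trans (min_le_left _ _)
  have hη2 : η ≤ ε := (min_le_left _ _).trans (min_le_right _ _)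
  have hη3 : η ≤ δ := (min_le_right _ _).trans (min_le_left _ _)
  have hη4 : η ≤ ε₂ := (min_le_right _ _).trans (min_le_right _ _)
  set K := Metric.ball w η ∩ Metric.ball c (r i) with hK
  have hKo : IsOpen K := Metric.isOpen_ball.inter Metric.isOpen_ball
  have happrox : ∀ v ∈ Metric.ball w η, dist v c = r i → ∀ δ' > 0, ∃ u ∈ K, dist u v < δ' := by
    intro v hv hvc δ' hδ'
    obtain ⟨u, hu, hu1, hu2⟩ := ((mem_closure_iff_frequently.1 (sphere_subset_closure_ball
      (hd.radius i) hvc)).and_eventually (inter_mem (Metric.isOpen_ball.mem_nhds hv)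
        (Metric.ball_mem_nhds v hδ'))).exists
    exact ⟨u, ⟨hu1, hu⟩, hu2⟩
  have hE' := hE.mono hη2
  have hEdisk : ∀ u ∈ K, E u ∈ disk α r i := fun u hu => by
    rw [Metric.mem_ball, hpole]; exact hu.2
  have hle : ∀ u ∈ K, dist (J i (E u)) q ≤ dist u w := by
    intro u hu
    have h1 := hE'.dist_center hu.1
    rw [← h1]
    refine hlip _ (hEdisk u hu) ?_
    rw [h1]
    exact (Metric.mem_ball.1 hu.1).trans_le hη1
  have hF : IsLocalIsometryOn (J i ∘ E) K :=
    (hd.isLocalIsometryOn i).comp (hE'.isLocalIsometryOn.mono hKo Set.inter_subset_left) hEdisk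
  have hFq : ∀ u ∈ K, (J i ∘ E) u ∈ Metric.ball q ε₂ := fun u hu =>
    (hle u hu).trans_lt ((Metric.mem_ball.1 hu.1).trans_le hη4)
  have hψ : IsLocalIsometryOn (φ ∘ (J i ∘ E)) K := hφ'.isLocalIsometryOn.comp hF hFq
  have hψd : ∀ u ∈ K, dist ((φ ∘ (J i ∘ E)) u) (northPole β) = dist (J i (E u)) q := by
    intro u hu
    rw [← hφq]
    exact hφ'.dist_center (hFq u hu)
  obtain ⟨c', hc'⟩ := exists_development_center hβ
    (isPreconnected_ball_inter ⟨hη0.le, hη2.trans hεπ⟩ (hd.radius_Icc i))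
    (let ⟨u, hu, _⟩ := happrox w (Metric.mem_ball_self hη0) hpc 1 one_pos; ⟨u, hu⟩) hψ (by
      intro u hu
      rw [hψd u hu]
      refine ⟨dist_pos.2 fun h => hcov ?_, (hle u hu).trans_lt
        ((Metric.mem_ball.1 hu.1).trans_le (hη2.trans hεπ))⟩
      exact Set.mem_iUnion.2 ⟨i, E u, hEdisk u hu, h⟩)
  have hdist : ∀ u ∈ K, dist (J i (E u)) q = dist u c' := fun u hu => by rw [← hψd u hu, hc' u hu]
  have hcw : c' = w := by
    by_contra hne
    have h0 := dist_pos.2 hne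
    obtain ⟨u, hu, hu'⟩ := happrox w (Metric.mem_ball_self hη0) hpc (dist c' w / 2) (by positivity)
    have h1 := hle u hu
    rw [hdist u hu] at h1
    have := dist_triangle_left c' w u
    linarith
  subst hcw
  filter_upwards [Metric.ball_mem_nhds _ hη0] with p' hp'η hp' hne
  obtain ⟨v, hv, rfl⟩ := hE'.exists_preimage hp'η
  have hvw : 0 < dist v c' := dist_pos.2 fun h => hne (by rw [h])
  have hvc : dist v c = r i := by rw [← hpole, hp']
  obtain ⟨q', hq'⟩ := exists_isBoundaryValue hd hp'
  by_cases hcov' : q' ∈ ⋃ j, J j '' disk α r j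
  · exact exists_isFilledBy hd hp' hq' hcov'
  exfalso
  obtain ⟨ε', hε', hlip'⟩ := hq'
  have hle' : ∀ u ∈ K, dist u v < ε' → dist (J i (E u)) q' ≤ dist u v := by
    intro u hu huv
    have h1 := hE'.2 u hu.1 v hv
    rw [← h1]
    exact hlip' _ (hEdisk u hu) (by rw [h1]; exact huv)
  have hvη := Metric.mem_ball.1 hv
  have hqq : q' = q := by
    refine hδq q' hcov' ?_
    obtain ⟨u, hu, hu'⟩ := happrox v hv hvc (min ε' ((η - dist v c') / 2))
      (lt_min hε' (by linarith))
    rw [lt_min_iff] at hu'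
    have h1 := hle' u hu hu'.1
    have h2 := hdist u hu
    have h3 := dist_triangle_left q' q (J i (E u))
    have h4 := dist_triangle u v c'
    linarith
  subst hqq
  obtain ⟨u, hu, hu'⟩ := happrox v hv hvc (min ε' (dist v c' / 2)) (lt_min hε' (by linarith))
  rw [lt_min_iff] at hu'
  have h1 := hle' u hu hu'.1
  rw [hdist u hu] at h1
  have h2 := dist_triangle_left v c' u
  linarith

/-- Each bigon fills the disk near some boundary point, namely near each point of its open side. -/
theorem exists_isFilledBy_of_mem_bigons [CompactSpace S] (hd : IsDiskFamily α r J) {i : ι}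
    {U : Set (ConeSphere (α i))} (hU : U ∈ bigons α r J i) :
    ∃ p, dist p (northPole (α i)) = r i ∧ IsFilledBy α r i p U := by
  have hU' := hU
  obtain ⟨j, c₁, c₂, E₁, E₂, h, rfl⟩ := hU'
  obtain ⟨w, hw₁, hw₂⟩ := h.exists_mem_side hd
  have hp : dist (E₁ w) (northPole (α i)) = r i := by rw [h.pole₁]; exact hw₁
  obtain ⟨q, hq⟩ := exists_isBoundaryValue hd hp
  have hwcl : w ∈ Metric.closedBall c₁ (r i) ∩ Metric.closedBall c₂ (r j) :=
    ⟨hw₁.le, Metric.ball_subset_closedBall hw₂⟩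
  have hE₂w : E₂ w ∈ disk α r j := by rw [Metric.mem_ball, h.pole₂]; exact hw₂
  set L := Metric.ball c₁ (r i) ∩ Metric.ball c₂ (r j) with hL
  have hcl : w ∈ closure L := by
    have := sphere_subset_closure_ball (hd.radius i) hw₁
    rw [mem_closure_iff_frequently] at this ⊢
    exact this.and_eventually (Metric.isOpen_ball.mem_nhds hw₂)
  have hne : (𝓝[L] w).NeBot := mem_closure_iff_nhdsWithin_neBot.1 hcl
  -- the boundary value is the image of the corresponding point of the second disk
  have hqe : q = J j (E₂ w) := by
    obtain ⟨ε, hε, hlip⟩ := hq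
    have ht₁ : Tendsto (J i ∘ E₁) (𝓝[L] w) (𝓝 q) := by
      rw [tendsto_iff_dist_tendsto_zero]
      have hE : Tendsto (fun u => dist (E₁ u) (E₁ w)) (𝓝[L] w) (𝓝 0) :=
        tendsto_iff_dist_tendsto_zero.1 ((h.cont₁ w hwcl).mono_left nhdsWithin_le_nhds)
      refine squeeze_zero' (Eventually.of_forall fun _ => dist_nonneg) ?_ hE
      filter_upwards [self_mem_nhdsWithin, hE.eventually (gt_mem_nhds hε)] with u hu hu'
      exact hlip _ (h.mem_disk₁ hu) hu'
    have ht₂ : Tendsto (J j ∘ E₂) (𝓝[L] w) (𝓝 (J j (E₂ w))) :=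
      (ContinuousAt.comp ((hd.isLocalIsometryOn j).continuousAt hE₂w)
        (h.cont₂ w hwcl)).mono_left nhdsWithin_le_nhds
    refine tendsto_nhds_unique ht₁ (ht₂.congr' ?_)
    filter_upwards [self_mem_nhdsWithin] with u hu
    exact (h.agree u hu).symm
  obtain ⟨V, hV, hfill⟩ := exists_isFilledBy hd hp hq
    (Set.mem_iUnion.2 ⟨j, E₂ w, hE₂w, hqe.symm⟩)
  have hpU : E₁ w ∈ closure (E₁ '' L) := by
    rw [mem_closure_iff_frequently] at hcl ⊢
    exact (h.cont₁ w hwcl).frequently (hcl.mono fun u hu => ⟨u, hu, rfl⟩)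
  exact ⟨E₁ w, hp, hfill.eq hd hV hU hpU ▸ hfill⟩

end Boundary

/-! ### Finiteness along the boundary circle -/

section Circle

open Filter Topology UnitSphere

variable {S : Type*} [MetricSpace S] {ι : Type*} {α r : ι → ℝ} {J : ∀ i, ConeSphere (α i) → S}

theorem exists_isFilledBy_of_isPreconnected (hd : IsDiskFamily α r J) {i : ι}
    (ha : r i ∈ Set.Icc 0 Real.pi) {s : Set ℝ} (hs : IsPreconnected s) (hne : s.Nonempty)
    (h : ∀ t ∈ s, ∃ U ∈ bigons α r J i, IsFilledBy α r i (polar (α i) (r i) t ha) U) :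
    ∃ U ∈ bigons α r J i, ∀ t ∈ s, IsFilledBy α r i (polar (α i) (r i) t ha) U := by
  obtain ⟨t₀, ht₀⟩ := hne
  obtain ⟨U, hU, hfill⟩ := h t₀ ht₀
  have hopen : ∀ V, IsOpen {t | IsFilledBy α r i (polar (α i) (r i) t ha) V} := fun V => by
    rw [isOpen_iff_mem_nhds]
    exact fun t ht => (continuous_polar ha).continuousAt.eventually (IsFilledBy.eventually ht)
  suffices hsub : s ⊆ {t | IsFilledBy α r i (polar (α i) (r i) t ha) U} from
    ⟨U, hU, fun t ht => hsub ht⟩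
  refine hs.subset_left_of_subset_union (hopen U) (isOpen_biUnion
    (s := bigons α r J i \ {U}) fun V _ => hopen V) ?_ ?_ ⟨t₀, ht₀, hfill⟩
  · rw [Set.disjoint_left]
    intro t ht ht'
    obtain ⟨V, hV, htV⟩ := Set.mem_iUnion₂.1 ht'
    exact hV.2 (IsFilledBy.eq hd htV hV.1 hU (IsFilledBy.mem_closure hd ht
      (dist_polar_northPole ha)))
  · intro t ht
    obtain ⟨V, hV, htV⟩ := h t ht
    rcases eq_or_ne V U with rfl | hne
    · exact Or.inl htV
    · exact Or.inr (Set.mem_iUnion₂.2 ⟨V, ⟨hV, hne⟩, htV⟩)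

variable [CompactSpace S]

/-- On either side of a boundary point, the disk is filled by a single bigon. -/
theorem exists_isFilledBy_sides (hS : IsSphericalSurface S) (hd : IsDiskFamily α r J)
    (hmiss : (⋃ j, J j '' disk α r j)ᶜ.Finite) {i : ι} (ha : r i ∈ Set.Icc 0 Real.pi) (t₀ : ℝ) :
    ∃ δ > 0, (∃ U ∈ bigons α r J i,
        ∀ t ∈ Set.Ioo t₀ (t₀ + δ), IsFilledBy α r i (polar (α i) (r i) t ha) U) ∧
      ∃ U ∈ bigons α r J i,
        ∀ t ∈ Set.Ioo (t₀ - δ) t₀, IsFilledBy α r i (polar (α i) (r i) t ha) U := by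
  have hα := hd.angle_pos i
  have ha' : r i ∈ Set.Ioo 0 Real.pi :=
    ⟨(hd.radius i).1, by linarith [(hd.radius i).2, Real.pi_pos]⟩
  obtain ⟨δ, hδ, hball⟩ := Metric.eventually_nhds_iff_ball.1
    ((continuous_polar (α := α i) ha).continuousAt.eventually
      (eventually_isFilledBy hS hd hmiss (dist_polar_northPole (t := t₀) ha)))
  have hgood : ∀ t, t ≠ t₀ → |t - t₀| < min δ (α i / 2) →
      ∃ U ∈ bigons α r J i, IsFilledBy α r i (polar (α i) (r i) t ha) U := by
    intro t hne ht
    rw [lt_min_iff] at ht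
    refine hball t (by rw [Metric.mem_ball, Real.dist_eq]; exact ht.1) (dist_polar_northPole ha)
      fun heq => hne ?_
    have h1 := coe_eq_of_polar_eq ha' heq
    rw [← sub_eq_zero, ← AddCircle.coe_sub, ← norm_eq_zero,
      (AddCircle.norm_coe_eq_abs_iff _ hα.ne').2 (by rw [abs_of_pos hα]; exact ht.2.le),
      abs_eq_zero, sub_eq_zero] at h1
    exact h1
  have hm : 0 < min δ (α i / 2) := lt_min hδ (by positivity)
  refine ⟨min δ (α i / 2), hm, ?_, ?_⟩
  · refine exists_isFilledBy_of_isPreconnected hd ha isPreconnected_Ioo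
      (Set.nonempty_Ioo.2 (by linarith)) fun t ht => hgood t ht.1.ne' ?_
    rw [abs_lt]
    constructor <;> linarith [ht.1, ht.2]
  · refine exists_isFilledBy_of_isPreconnected hd ha isPreconnected_Ioo
      (Set.nonempty_Ioo.2 (by linarith)) fun t ht => hgood t ht.2.ne ?_
    rw [abs_lt]
    constructor <;> linarith [ht.1, ht.2]

theorem exists_mem_closure_of_mem_sphere (hS : IsSphericalSurface S) (hd : IsDiskFamily α r J)
    (hmiss : (⋃ j, J j '' disk α r j)ᶜ.Finite) {i : ι} {p : ConeSphere (α i)}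
    (hp : dist p (northPole (α i)) = r i) : ∃ U ∈ bigons α r J i, p ∈ closure U := by
  obtain ⟨a, t₀, ha, rfl⟩ := exists_eq_polar p
  rw [dist_polar_northPole] at hp
  subst hp
  obtain ⟨δ, hδ, ⟨U, hU, hfill⟩, -⟩ := exists_isFilledBy_sides hS hd hmiss ha t₀
  refine ⟨U, hU, ?_⟩
  have h1 : t₀ ∈ closure (Set.Ioo t₀ (t₀ + δ)) := by
    rw [closure_Ioo (by linarith)]
    exact ⟨le_rfl, by linarith⟩
  have h2 := (continuous_polar (α := α i) ha).continuousAt.continuousWithinAt.mem_closure_image h1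
  refine closure_minimal ?_ isClosed_closure h2
  rintro _ ⟨t, ht, rfl⟩
  exact (hfill t ht).mem_closure hd (dist_polar_northPole ha)

theorem finite_bigons_and_exceptions (hS : IsSphericalSurface S) (hd : IsDiskFamily α r J)
    (hmiss : (⋃ j, J j '' disk α r j)ᶜ.Finite) (i : ι) :
    (bigons α r J i).Finite ∧ {p | dist p (northPole (α i)) = r i ∧
      ¬ ∃ U ∈ bigons α r J i, IsFilledBy α r i p U}.Finite := by
  have ha : r i ∈ Set.Icc 0 Real.pi :=
    ⟨(hd.radius i).1.le, by linarith [(hd.radius i).2, Real.pi_pos]⟩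
  have key : {U | U ∈ bigons α r J i ∧ ∃ t ∈ Set.Icc 0 (α i),
        IsFilledBy α r i (polar (α i) (r i) t ha) U}.Finite ∧
      {p | ∃ t ∈ Set.Icc 0 (α i), polar (α i) (r i) t ha = p ∧
        ¬ ∃ U ∈ bigons α r J i, IsFilledBy α r i p U}.Finite := by
    refine isCompact_Icc.induction_on (p := fun s => {U | U ∈ bigons α r J i ∧ ∃ t ∈ s,
        IsFilledBy α r i (polar (α i) (r i) t ha) U}.Finite ∧
      {p | ∃ t ∈ s, polar (α i) (r i) t ha = p ∧
        ¬ ∃ U ∈ bigons α r J i, IsFilledBy α r i p U}.Finite) ?_ ?_ ?_ ?_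
    · simp
    · rintro s t hst ⟨h1, h2⟩
      refine ⟨h1.subset ?_, h2.subset ?_⟩
      · rintro U ⟨hU, u, hu, h⟩
        exact ⟨hU, u, hst hu, h⟩
      · rintro p ⟨u, hu, h⟩
        exact ⟨u, hst hu, h⟩
    · rintro s t ⟨h1, h2⟩ ⟨h3, h4⟩
      refine ⟨(h1.union h3).subset ?_, (h2.union h4).subset ?_⟩
      · rintro U ⟨hU, u, hu | hu, h⟩
        · exact Or.inl ⟨hU, u, hu, h⟩
        · exact Or.inr ⟨hU, u, hu, h⟩
      · rintro p ⟨u, hu | hu, h⟩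
        · exact Or.inl ⟨u, hu, h⟩
        · exact Or.inr ⟨u, hu, h⟩
    · intro t₀ _
      obtain ⟨δ, hδ, ⟨U, hU, hfill⟩, V, hV, hfill'⟩ := exists_isFilledBy_sides hS hd hmiss ha t₀
      have huniq : ∀ t W W', W ∈ bigons α r J i → W' ∈ bigons α r J i →
          IsFilledBy α r i (polar (α i) (r i) t ha) W →
          IsFilledBy α r i (polar (α i) (r i) t ha) W' → W = W' := fun t W W' hW hW' h h' =>
        h.eq hd hW hW' (h'.mem_closure hd (dist_polar_northPole ha))
      refine ⟨Set.Ioo (t₀ - δ) (t₀ + δ),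
        nhdsWithin_le_nhds (Ioo_mem_nhds (by linarith) (by linarith)), ?_, ?_⟩
      · have hsub : {W | W ∈ bigons α r J i ∧
            IsFilledBy α r i (polar (α i) (r i) t₀ ha) W}.Subsingleton :=
          fun W hW W' hW' => huniq t₀ W W' hW.1 hW'.1 hW.2 hW'.2
        refine ((Set.finite_singleton U).union ((Set.finite_singleton V).union
          hsub.finite)).subset ?_
        rintro W ⟨hW, t, ht, h⟩
        rcases lt_trichotomy t t₀ with hlt | rfl | hgt
        · exact Or.inr (Or.inl (huniq t W V hW hV h (hfill' t ⟨ht.1, hlt⟩)))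
        · exact Or.inr (Or.inr ⟨hW, h⟩)
        · exact Or.inl (huniq t W U hW hU h (hfill t ⟨hgt, ht.2⟩))
      · refine (Set.finite_singleton (polar (α i) (r i) t₀ ha)).subset ?_
        rintro p ⟨t, ht, rfl, hbad⟩
        rcases lt_trichotomy t t₀ with hlt | rfl | hgt
        · exact absurd ⟨V, hV, hfill' t ⟨ht.1, hlt⟩⟩ hbad
        · rfl
        · exact absurd ⟨U, hU, hfill t ⟨hgt, ht.2⟩⟩ hbad
  have hcirc : ∀ p : ConeSphere (α i), dist p (northPole (α i)) = r i →
      ∃ t ∈ Set.Icc 0 (α i), polar (α i) (r i) t ha = p := by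
    intro p hp
    obtain ⟨a, t, ha', rfl⟩ := exists_eq_polar p
    rw [dist_polar_northPole] at hp
    subst hp
    have : Fact (0 < α i) := ⟨hd.angle_pos i⟩
    obtain ⟨s, hs, hst⟩ : (t : AddCircle (α i)) ∈
        ((↑) : ℝ → AddCircle (α i)) '' Set.Icc 0 (0 + α i) := by
      rw [AddCircle.coe_image_Icc_eq]; exact Set.mem_univ _
    rw [zero_add] at hs
    exact ⟨s, hs, by simp only [polar, hst]⟩
  refine ⟨key.1.subset fun U hU => ?_, key.2.subset ?_⟩
  · obtain ⟨p, hp, hfill⟩ := exists_isFilledBy_of_mem_bigons hd hU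
    obtain ⟨t, ht, rfl⟩ := hcirc p hp
    exact ⟨hU, t, ht, hfill⟩
  · rintro p ⟨hp, hbad⟩
    obtain ⟨t, ht, rfl⟩ := hcirc p hp
    exact ⟨t, ht, rfl, hbad⟩

end Circle

/-! ### The disks as metric spaces of their own -/

section ConeDisks

open Filter Topology UnitSphere

theorem isLocalIsometryOn_val {X : Type*} [MetricSpace X] {D : Set X} (hD : IsOpen D) :
    IsLocalIsometryOn (Subtype.val : D → X) Set.univ := by
  rintro ⟨x, hx⟩ -
  obtain ⟨ε, hε, h⟩ := Metric.isOpen_iff.1 hD x hx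
  refine ⟨ε, hε, Set.subset_univ _, ?_, fun _ _ _ _ => rfl⟩
  ext y
  constructor
  · rintro ⟨z, hz, rfl⟩
    exact hz
  · intro hy
    exact ⟨⟨y, h hy⟩, hy, rfl⟩

/-- A left inverse of the inclusion of the open disk. -/
noncomputable def toConeDisk {α r : ℝ} (hr : 0 < r) (x : ConeSphere α) : ConeDisk α r :=
  open Classical in
  if h : x ∈ Metric.ball (northPole α) r then ⟨x, h⟩ else ⟨northPole α, Metric.mem_ball_self hr⟩

theorem toConeDisk_of_mem {α r : ℝ} (hr : 0 < r) {x : ConeSphere α}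
    (h : x ∈ Metric.ball (northPole α) r) : toConeDisk hr x = ⟨x, h⟩ := dif_pos h

theorem toConeDisk_val {α r : ℝ} (hr : 0 < r) (x : ConeDisk α r) : toConeDisk hr x.1 = x :=
  toConeDisk_of_mem hr x.2

theorem isLocalIsometryOn_toConeDisk {α r : ℝ} (hr : 0 < r) :
    IsLocalIsometryOn (toConeDisk (α := α) hr) (Metric.ball (northPole α) r) := by
  have := (isLocalIsometryOn_val (X := ConeSphere α) (D := Metric.ball (northPole α) r)
    Metric.isOpen_ball).of_leftInverse (g := toConeDisk hr) fun x _ => toConeDisk_val hr x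
  rwa [Set.image_univ, Subtype.range_val] at this

variable {S : Type*} {ι : Type*} {α r : ι → ℝ}

/-- The maps to the surface, extended by a junk value outside of the disks. -/
noncomputable def extendMap (f : (Σ i, ConeDisk (α i) (r i)) → S) (hr : ∀ i, 0 < r i) (i : ι)
    (x : ConeSphere (α i)) : S := f ⟨i, toConeDisk (hr i) x⟩

theorem extendMap_val (f : (Σ i, ConeDisk (α i) (r i)) → S) (hr : ∀ i, 0 < r i) (i : ι)
    (x : ConeDisk (α i) (r i)) : extendMap f hr i x.1 = f ⟨i, x⟩ := by
  rw [extendMap, toConeDisk_val]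

theorem extendMap_image (f : (Σ i, ConeDisk (α i) (r i)) → S) (hr : ∀ i, 0 < r i) (i : ι) :
    extendMap f hr i '' disk α r i = Set.range fun x => f ⟨i, x⟩ := by
  ext p
  constructor
  · rintro ⟨x, hx, rfl⟩
    exact ⟨⟨x, hx⟩, (extendMap_val f hr i ⟨x, hx⟩).symm⟩
  · rintro ⟨x, rfl⟩
    exact ⟨x.1, x.2, extendMap_val f hr i x⟩

theorem sigma_val_inj {i j : ι} {x : ConeDisk (α i) (r i)} {y : ConeDisk (α j) (r j)} :
    (⟨i, x.1⟩ : Σ i, ConeSphere (α i)) = ⟨j, y.1⟩ ↔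
      (⟨i, x⟩ : Σ i, ConeDisk (α i) (r i)) = ⟨j, y⟩ := by
  constructor
  · intro h
    obtain rfl : i = j := congrArg Sigma.fst h
    have : x.1 = y.1 := by simpa using h
    rw [Subtype.ext this]
  · intro h
    exact congrArg (fun a : Σ i, ConeDisk (α i) (r i) =>
      (⟨a.1, a.2.1⟩ : Σ i, ConeSphere (α i))) h

theorem eq_of_encard_le_two {X : Type*} {s : Set X} (hs : s.encard ≤ 2) {a b c : X} (ha : a ∈ s)
    (hb : b ∈ s) (hc : c ∈ s) (hab : a ≠ b) (hac : a ≠ c) : b = c := by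
  by_contra hbc
  have h1 : ({a, b, c} : Set X).encard = 3 := Set.encard_eq_three.2 ⟨a, b, c, hab, hac, hbc, rfl⟩
  have h2 : ({a, b, c} : Set X) ⊆ s := by
    rintro x (rfl | rfl | rfl)
    · exact ha
    · exact hb
    · exact hc
  have h3 := (Set.encard_le_encard h2).trans hs
  rw [h1] at h3
  exact absurd h3 (by decide)

theorem mem_doublePoints_iff {X : Type*} {f : X → S} (htwo : ∀ p, (f ⁻¹' {p}).encard ≤ 2) {x : X} :
    f x ∈ doublePoints f ↔ ∃ y, y ≠ x ∧ f y = f x := by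
  constructor
  · intro h
    obtain ⟨a, b, hab, h⟩ := Set.encard_eq_two.1 h
    have ha : a ∈ f ⁻¹' {f x} := by rw [h]; simp
    have hb : b ∈ f ⁻¹' {f x} := by rw [h]; simp
    rcases eq_or_ne a x with rfl | hne
    · exact ⟨b, hab.symm, hb⟩
    · exact ⟨a, hne, ha⟩
  · rintro ⟨y, hne, hy⟩
    refine le_antisymm (htwo _) ?_
    rw [← Set.encard_pair hne]
    refine Set.encard_le_encard ?_
    rintro z (rfl | rfl)
    · exact hy
    · rfl

variable [MetricSpace S]

theorem isDiskFamily_extendMap (hα : ∀ i, 0 < α i) (hr : ∀ i, r i ∈ Set.Ioo 0 (Real.pi / 2))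
    (f : (Σ i, ConeDisk (α i) (r i)) → S)
    (hf : ∀ i, IsLocalIsometryOn (fun x : ConeDisk (α i) (r i) => f ⟨i, x⟩) Set.univ)
    (htwo : ∀ p, (f ⁻¹' {p}).encard ≤ 2)
    (hcontain : ∀ i j, i ≠ j →
      ¬ Set.range (fun x : ConeDisk (α i) (r i) => f ⟨i, x⟩) ⊆
        Set.range (fun x : ConeDisk (α j) (r j) => f ⟨j, x⟩)) :
    IsDiskFamily α r (extendMap f fun i => (hr i).1) where
  angle_pos := hα
  radius := hr
  isLocalIsometryOn i :=
    (hf i).comp (isLocalIsometryOn_toConeDisk (hr i).1) fun _ _ => Set.mem_univ _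
  two i j k x hx y hy z hz hxy hxz hne hne' := by
    lift x to ConeDisk (α i) (r i) using hx
    lift y to ConeDisk (α j) (r j) using hy
    lift z to ConeDisk (α k) (r k) using hz
    simp only [extendMap_val] at hxy hxz
    rw [ne_eq, sigma_val_inj] at hne hne'
    rw [sigma_val_inj]
    exact eq_of_encard_le_two (htwo (f ⟨i, x⟩)) rfl hxy.symm hxz.symm hne hne'
  not_subset i j hij := by
    rw [extendMap_image, extendMap_image]
    exact hcontain i j hij

variable {J : ∀ i, ConeSphere (α i) → S} {i j : ι} {c₁ c₂ : UnitSphere}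
  {E₁ : UnitSphere → ConeSphere (α i)} {E₂ : UnitSphere → ConeSphere (α j)}

theorem IsLens.isBigonChart (hd : IsDiskFamily α r J) (h : IsLens α r J i j c₁ c₂ E₁ E₂) :
    IsBigonChart c₁ c₂ (r i) (r j) E₁
      (E₁ '' (Metric.ball c₁ (r i) ∩ Metric.ball c₂ (r j))) where
  radius₁ := hd.radius i
  radius₂ := hd.radius j
  not_subset₁ := h.not_subset₁
  not_subset₂ := h.not_subset₂
  nonempty := h.nonempty
  isLocalIsometryOn := h.locIso₁
  bijOn := (h.injOn₁ hd).bijOn_image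

theorem IsLens.isBoundaryBigon (hd : IsDiskFamily α r J) (h : IsLens α r J i j c₁ c₂ E₁ E₂)
    {U : Set (ConeDisk (α i) (r i))}
    (hU : Subtype.val '' U = E₁ '' (Metric.ball c₁ (r i) ∩ Metric.ball c₂ (r j))) :
    IsBoundaryBigon U := by
  refine ⟨c₁, c₂, r j, E₁, hU ▸ h.isBigonChart hd,
    fun z hz => (h.cont₁ z hz).continuousWithinAt, fun z hz => ?_, h.injOn_side hd, fun z hz => ?_⟩
  · rw [Metric.mem_sphere, h.pole₁]; exact hz.1
  · rw [Metric.mem_ball, h.pole₁]; exact hz.1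

theorem IsLens.isBigon (hd : IsDiskFamily α r J) (h : IsLens α r J i j c₁ c₂ E₁ E₂)
    {U : Set (ConeDisk (α i) (r i))}
    (hU : Subtype.val '' U = E₁ '' (Metric.ball c₁ (r i) ∩ Metric.ball c₂ (r j))) :
    IsBigon U := by
  have hloc : IsLocalIsometryOn (toConeDisk (hd.radius i).1 ∘ E₁)
      (Metric.ball c₁ (r i) ∩ Metric.ball c₂ (r j)) :=
    (isLocalIsometryOn_toConeDisk (hd.radius i).1).comp h.locIso₁ fun z hz => h.mem_disk₁ hz
  refine ⟨c₁, c₂, r i, r j, toConeDisk (hd.radius i).1 ∘ E₁, hd.radius i, hd.radius j,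
    h.not_subset₁, h.not_subset₂, h.nonempty, hloc, fun z hz => ?_, fun z hz z' hz' heq => ?_,
    fun x hx => ?_⟩
  · obtain ⟨x, hx, hxz⟩ : E₁ z ∈ Subtype.val '' U := hU ▸ ⟨z, hz, rfl⟩
    rw [Function.comp, ← hxz, toConeDisk_val]
    exact hx
  · rw [Function.comp, Function.comp, toConeDisk_of_mem _ (h.mem_disk₁ hz),
      toConeDisk_of_mem _ (h.mem_disk₁ hz'), Subtype.mk.injEq] at heq
    exact h.injOn₁ hd hz hz' heq
  · obtain ⟨z, hz, hzx⟩ : x.1 ∈ E₁ '' (Metric.ball c₁ (r i) ∩ Metric.ball c₂ (r j)) :=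
      hU ▸ ⟨x, hx, rfl⟩
    exact ⟨z, hz, by rw [Function.comp, hzx, toConeDisk_val]⟩

/-- The two bigons of a lens correspond to each other by an isometry `g`, which sends each point to
its partner. -/
theorem IsLens.exists_pairing (hd : IsDiskFamily α r J) (h : IsLens α r J i j c₁ c₂ E₁ E₂)
    {U : Set (ConeDisk (α i) (r i))} {V : Set (ConeDisk (α j) (r j))}
    (hU : Subtype.val '' U = E₁ '' (Metric.ball c₁ (r i) ∩ Metric.ball c₂ (r j)))
    (hV : Subtype.val '' V = E₂ '' (Metric.ball c₁ (r i) ∩ Metric.ball c₂ (r j))) :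
    ∃ g : ConeDisk (α i) (r i) → ConeDisk (α j) (r j), IsLocalIsometryOn g U ∧ Set.BijOn g U V ∧
      ∀ x ∈ U, J j (g x).1 = J i x.1 ∧
        (⟨i, x.1⟩ : Σ i, ConeSphere (α i)) ≠ ⟨j, (g x).1⟩ := by
  set L := Metric.ball c₁ (r i) ∩ Metric.ball c₂ (r j) with hL
  have hinj := h.injOn₁ hd
  have hinj₂ : Set.InjOn E₂ L := by
    have := h.symm.injOn₁ hd
    rwa [Set.inter_comm] at this
  obtain ⟨z₀, -⟩ := h.nonempty
  have : Nonempty UnitSphere := ⟨z₀⟩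
  set e := Function.invFunOn E₁ L with he
  have hleft : ∀ z ∈ L, e (E₁ z) = z := fun z hz => hinj.leftInvOn_invFunOn hz
  set g : ConeDisk (α i) (r i) → ConeDisk (α j) (r j) :=
    fun x => toConeDisk (hd.radius j).1 (E₂ (e x.1)) with hg
  have hmem : ∀ x ∈ U, ∃ z ∈ L, E₁ z = x.1 ∧ (g x).1 = E₂ z := by
    intro x hx
    obtain ⟨z, hz, hzx⟩ : x.1 ∈ E₁ '' L := hU ▸ ⟨x, hx, rfl⟩
    refine ⟨z, hz, hzx, ?_⟩
    rw [hg]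
    simp only
    rw [← hzx, hleft z hz, toConeDisk_of_mem _ (h.mem_disk₂ hz)]
  have hUo : IsOpen U := by
    have h1 : IsOpen (Subtype.val '' U) := by
      rw [hU]
      exact isOpen_of_mem_bigons (J := J) ⟨j, c₁, c₂, E₁, E₂, h, rfl⟩
    have := h1.preimage (continuous_subtype_val (p := fun x => x ∈ disk α r i))
    rwa [Set.preimage_image_eq _ Subtype.val_injective] at this
  refine ⟨g, ?_, ⟨fun x hx => ?_, fun x hx x' hx' heq => ?_, fun y hy => ?_⟩, fun x hx => ?_⟩
  · have h1 : IsLocalIsometryOn (Subtype.val : ConeDisk (α i) (r i) → ConeSphere (α i)) U :=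
      (isLocalIsometryOn_val Metric.isOpen_ball).mono hUo (Set.subset_univ _)
    have h2 : IsLocalIsometryOn (e ∘ Subtype.val) U :=
      (h.locIso₁.of_leftInverse hleft).comp h1 fun x hx => hU ▸ ⟨x, hx, rfl⟩
    have hm : Set.MapsTo (e ∘ Subtype.val) U L := by
      intro x hx
      obtain ⟨z, hz, hzx, -⟩ := hmem x hx
      rw [Function.comp, ← hzx, hleft z hz]
      exact hz
    exact (isLocalIsometryOn_toConeDisk (hd.radius j).1).comp (h.locIso₂.comp h2 hm)
      fun x hx => h.mem_disk₂ (hm hx)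
  · obtain ⟨z, hz, -, hzg⟩ := hmem x hx
    obtain ⟨y, hy, hyz⟩ : E₂ z ∈ Subtype.val '' V := hV ▸ ⟨z, hz, rfl⟩
    rw [← hzg] at hyz
    rwa [← Subtype.ext hyz]
  · obtain ⟨z, hz, hzx, hzg⟩ := hmem x hx
    obtain ⟨z', hz', hzx', hzg'⟩ := hmem x' hx'
    rw [heq, hzg'] at hzg
    rw [hinj₂ hz' hz hzg, hzx] at hzx'
    exact Subtype.ext hzx'
  · obtain ⟨z, hz, hzy⟩ : y.1 ∈ E₂ '' L := hV ▸ ⟨y, hy, rfl⟩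
    obtain ⟨x, hx, hxz⟩ : E₁ z ∈ Subtype.val '' U := hU ▸ ⟨z, hz, rfl⟩
    obtain ⟨z', hz', hzx', hzg'⟩ := hmem x hx
    rw [hxz] at hzx'
    rw [hinj hz' hz hzx', hzy] at hzg'
    exact ⟨x, hx, Subtype.ext hzg'⟩
  · obtain ⟨z, hz, hzx, hzg⟩ := hmem x hx
    rw [hzg, ← hzx]
    exact ⟨(h.agree z hz).symm, h.ne z hz⟩

end ConeDisks

theorem proposition1 {S : Type*} [MetricSpace S] [CompactSpace S] (hS : IsSphericalSurface S)
    (n : ℕ) (α r : Fin n → ℝ) (hα : ∀ i, 0 < α i) (hr : ∀ i, r i ∈ Set.Ioo 0 (Real.pi / 2))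
    (ι : (Σ i, ConeDisk (α i) (r i)) → S)
    (hι : ∀ i, IsLocalIsometryOn (fun x : ConeDisk (α i) (r i) => ι ⟨i, x⟩) Set.univ)
    (hmiss : (Set.range ι)ᶜ.Finite)
    (htwo : ∀ p, (ι ⁻¹' {p}).encard ≤ 2)
    (hcontain : ∀ i j, i ≠ j →
      ¬ Set.range (fun x : ConeDisk (α i) (r i) => ι ⟨i, x⟩) ⊆
        Set.range (fun x : ConeDisk (α j) (r j) => ι ⟨j, x⟩)) :
    ∃ 𝔅 : ∀ i, Set (Set (ConeDisk (α i) (r i))),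
      (∀ i, (𝔅 i).Finite ∧ (∀ U ∈ 𝔅 i, IsBigon U ∧ IsBoundaryBigon U) ∧
        (𝔅 i).PairwiseDisjoint id ∧ ⋃₀ 𝔅 i = {x | ι ⟨i, x⟩ ∈ doublePoints ι} ∧
        FillsBoundary (𝔅 i)) ∧
      ∀ i, ∀ U ∈ 𝔅 i, ∃ j, ∃ V ∈ 𝔅 j,
        (⟨i, U⟩ : Σ k, Set (ConeDisk (α k) (r k))) ≠ ⟨j, V⟩ ∧
        ∃ g : ConeDisk (α i) (r i) → ConeDisk (α j) (r j),
          IsLocalIsometryOn g U ∧ Set.BijOn g U V ∧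
          ∀ x ∈ U, ∀ y : Σ k, ConeDisk (α k) (r k),
            (y ≠ ⟨i, x⟩ ∧ ι y = ι ⟨i, x⟩) ↔ y = ⟨j, g x⟩ := by
  have hd := isDiskFamily_extendMap hα hr ι hι htwo hcontain
  set J := extendMap ι fun i => (hr i).1 with hJ
  have hJv : ∀ i (x : ConeDisk (α i) (r i)), J i x.1 = ι ⟨i, x⟩ := extendMap_val ι _
  have hmiss' : (⋃ j, J j '' disk α r j)ᶜ.Finite := by
    convert hmiss using 2
    ext p
    simp only [hJ, extendMap_image, Set.mem_iUnion, Set.mem_range, Sigma.exists]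
  have himg : ∀ i, ∀ U ∈ bigons α r J i,
      Subtype.val '' ((↑) ⁻¹' U : Set (ConeDisk (α i) (r i))) = U := fun i U hU => by
    rw [Subtype.image_preimage_coe]
    exact Set.inter_eq_right.2 (subset_disk_of_mem_bigons hU)
  have hpre : ∀ i, ∀ U ∈ bigons α r J i,
      ((↑) ⁻¹' U : Set (ConeDisk (α i) (r i))) ∈ {U | Subtype.val '' U ∈ bigons α r J i} :=
    fun i U hU => by rw [Set.mem_ofPred_eq, himg i U hU]; exact hU
  refine ⟨fun i => {U | Subtype.val '' U ∈ bigons α r J i}, fun i => ?_, fun i U hU => ?_⟩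
  · obtain ⟨hfin, hexc⟩ := finite_bigons_and_exceptions hS hd hmiss' i
    refine ⟨hfin.preimage (Set.image_injective.2 Subtype.val_injective).injOn, fun U hU => ?_,
      fun U hU V hV hne => ?_, ?_, fun p hp => ?_, hexc.subset ?_⟩
    · obtain ⟨j, c₁, c₂, E₁, E₂, h, hUE⟩ := hU
      exact ⟨h.isBigon hd hUE, h.isBoundaryBigon hd hUE⟩
    · refine Set.disjoint_left.2 fun x hx hx' => hne ?_
      exact Set.image_injective.2 Subtype.val_injective
        (eq_of_mem_bigons hd hU hV ⟨x.1, ⟨x, hx, rfl⟩, x, hx', rfl⟩)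
    · ext x
      rw [Set.mem_ofPred_eq, mem_doublePoints_iff htwo]
      constructor
      · rintro ⟨U, ⟨j, c₁, c₂, E₁, E₂, h, hUE⟩, hx⟩
        obtain ⟨z, hz, hzx⟩ : x.1 ∈ E₁ '' (Metric.ball c₁ (r i) ∩ Metric.ball c₂ (r j)) :=
          hUE ▸ ⟨x, hx, rfl⟩
        have h1 := h.agree z hz
        have h2 := h.ne z hz
        have h3 := h.mem_disk₂ hz
        rw [hzx] at h1 h2
        generalize E₂ z = y at h1 h2 h3
        lift y to ConeDisk (α j) (r j) using h3
        rw [hJv, hJv] at h1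
        rw [ne_eq, sigma_val_inj] at h2
        exact ⟨⟨j, y⟩, Ne.symm h2, h1.symm⟩
      · rintro ⟨⟨j, y⟩, hne, hy⟩
        rw [← hJv, ← hJv] at hy
        obtain ⟨U, hU, hxU⟩ := exists_mem_bigons hd x.2 y.2 hy.symm
          fun h => hne (sigma_val_inj.1 h).symm
        exact ⟨_, hpre i U hU, hxU⟩
    · obtain ⟨U, hU, hpU⟩ := exists_mem_closure_of_mem_sphere hS hd hmiss' hp
      exact ⟨_, hpre i U hU, by rwa [himg i U hU]⟩
    · rintro p ⟨hp, hbad⟩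
      refine ⟨hp, fun ⟨U, hU, ε, hε, hfill⟩ => hbad ⟨_, hpre i U hU, ε, hε, fun x hx => ?_⟩⟩
      exact hfill x.1 x.2 hx
  · obtain ⟨j, c₁, c₂, E₁, E₂, h, hUE⟩ := hU
    have hV : E₂ '' (Metric.ball c₁ (r i) ∩ Metric.ball c₂ (r j)) ∈ bigons α r J j :=
      ⟨i, c₂, c₁, E₂, E₁, h.symm, by rw [Set.inter_comm]⟩
    obtain ⟨g, hg, hbij, hgx⟩ := h.exists_pairing hd hUE (himg j _ hV)
    refine ⟨j, _, hpre j _ hV, fun heq => ?_, g, hg, hbij, fun x hx y => ?_⟩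
    · obtain rfl : i = j := congrArg Sigma.fst heq
      have hUV : U = (↑) ⁻¹' (E₂ '' (Metric.ball c₁ (r i) ∩ Metric.ball c₂ (r i))) := by
        simpa using heq
      refine h.image_ne hd ?_
      rw [← hUE, ← himg i _ hV, ← hUV]
    · obtain ⟨h1, h2⟩ := hgx x hx
      rw [hJv, hJv] at h1
      rw [ne_eq, sigma_val_inj] at h2
      constructor
      · rintro ⟨hne, hy⟩
        exact eq_of_encard_le_two (htwo (ι ⟨i, x⟩)) rfl hy h1 (Ne.symm hne) h2
      · rintro rfl
        exact ⟨Ne.symm h2, h1⟩
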